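/- **Setting.** Let $\mathcal A$ be a $\mathbb Q$-linear abelian category with a $\mathbb Q$-linear symmetric monoidal structure $\otimes$ that is exact in each variable, and let $D^b(\mathcal A)$ be its bounded derived category, with the symmetric monoidal structure induced by the total tensor product of bounded complexes. Let $T$ be a $\mathbb Q$-linear triangulated category with a $\mathbb Q$-linear symmetric monoidal structure, and let $q\colon D^b(\mathcal A)\to T$ be a triangulated functor which is also a (strong) symmetric monoidal functor. Objects of $\mathcal A$ are regarded as objects of $D^b(\mathcal A)$ in degree $0$. **Notation.** For an object $X$ of a $\mathbb Q$-linear symmetric monoidal category and $n\ge 0$, let $p_n=\frac1{n!}\sum_{\sigma\in S_n}\sigma$, an idempotent of $X^{\otimes n}$ (with $X^{\otimes 0}=\mathbf 1$). The $n$-th symmetric power $\mathrm{coSym}^n(X)=\mathrm{Sym}^n(X)$ is an image of $p_n$, i.e. an object with $\iota^n\colon \mathrm{Sym}^n(X)\to X^{\otimes n}$ and $\pi^n\colon X^{\otimes n}\to\mathrm{Sym}^n(X)$ such that $\pi^n\iota^n=\mathrm{id}$ and $\iota^n\pi^n=p_n$; it is unique up to unique isomorphism if it exists, $\mathrm{Sym}^0(X)=\mathbf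 1$, and $\mathrm{Sym}^{-1}(X)=0$. A morphism $f\colon X\to Y$ induces $\mathrm{Sym}^n(f)=\pi^n f^{\otimes n}\iota^n$. For $n\ge1$ let $$\Delta^{n-1,1}=(\pi^{n-1}\otimes\mathrm{id}_X)\circ\iota^n\colon\ \mathrm{coSym}^n(X)\to\mathrm{coSym}^{n-1}(X)\otimes X ,$$ the component of the comultiplication of the symmetric coalgebra: it is the factorization of $\iota^n$ through $\iota^{n-1}\otimes\mathrm{id}_X$. The cup product with a morphism $c\colon X\to K$ is $\cdot\cup c=(\mathrm{id}\otimes c)\circ\Delta^{n-1,1}\colon \mathrm{coSym}^n(X)\to\mathrm{coSym}^{n-1}(X)\otimes K$; for $n=0$ it is the map to $0$. For a short exact sequence $0\to U\to V\to W\to0$ in $\mathcal A$, let $[V]\colon W\to U[1]$ be its extension class in $D^b(\mathcal A)$, and write $[V]$ also for the induced morphism $q(W)\to q(U[1])\cong q(U)[1]$. **Theorem.** For every object $X$ of $\mathcal A$ and every $n\ge0$ the symmetric power $\mathrm{Sym}^n(q(X))$ exists in $T$. For every short exact sequence $0\to U\to V\xrightarrow{g} W\to0$ in $\mathcal A$ with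 $\mathrm{Sym}^2(q(U))=0$ and every $n\ge0$, there is an exact triangle in $T$ $$\mathrm{coSym}^n(q(V))\xrightarrow{\ \mathrm{coSym}^n(q(g))\ }\mathrm{coSym}^n(q(W))\xrightarrow{\ \cdot\cup[V]\ }\mathrm{coSym}^{n-1}(q(W))\otimes q(U)[1]\longrightarrow \mathrm{coSym}^n(q(V))[1].$$ The triangle is canonical: the third morphisms can be chosen simultaneously for all $n$ and all such short exact sequences in such a way that every morphism of short exact sequences $(U,V,W)\to(U',V',W')$, both with $\mathrm{Sym}^2(q(U))=0=\mathrm{Sym}^2(q(U'))$, induces a commutative square between the third morphisms (in particular they do not depend on the choice of the symmetric powers). -/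

import Mathlib

open CategoryTheory Category Limits MonoidalCategory

namespace TensorDerived

universe w v u

section FiniteSupport

variable {C : Type*} [Category* C] [Preadditive C] {J : Type}

/-- A cofan of a finitely supported family which is split by projections is a colimit cofan. -/
theorem isColimit_of_split {X : J → C} [DecidableEq J] (s : Finset J) (hs : ∀ j, j ∉ s → IsZero (X j))
    (c : Cofan X) (p : ∀ j, c.pt ⟶ X j) (h₁ : ∀ j, c.inj j ≫ p j = 𝟙 _)
    (h₂ : ∀ i j, i ≠ j → c.inj i ≫ p j = 0) (h₃ : ∑ j ∈ s, p j ≫ c.inj j = 𝟙 _) :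
    Nonempty (IsColimit c) := by
  refine ⟨Cofan.IsColimit.mk _ (fun t => ∑ j ∈ s, p j ≫ t.inj j) (fun t i => ?_) (fun t m hm => ?_)⟩
  · by_cases hi : i ∈ s
    · rw [Preadditive.comp_sum, Finset.sum_eq_single i]
      · rw [← assoc, h₁, id_comp]
      · intro j _ hj
        rw [← assoc, h₂ i j hj.symm, zero_comp]
      · exact fun h => (h hi).elim
    · exact (hs i hi).eq_of_src _ _
  · rw [← id_comp m, ← h₃, Preadditive.sum_comp]
    exact Finset.sum_congr rfl (fun j _ => by rw [assoc, hm])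

theorem exists_split {X : J → C} [DecidableEq J] (s : Finset J) (hs : ∀ j, j ∉ s → IsZero (X j))
    (c : Cofan X) (hc : IsColimit c) : ∃ (p : ∀ j, c.pt ⟶ X j), (∀ j, c.inj j ≫ p j = 𝟙 _) ∧
    (∀ i j, i ≠ j → c.inj i ≫ p j = 0) ∧ (∑ j ∈ s, p j ≫ c.inj j = 𝟙 _) := by
  let p : ∀ j, c.pt ⟶ X j := fun j => Cofan.IsColimit.desc hc
    (fun i => if h : i = j then eqToHom (by rw [h]) else 0)
  have h₁ : ∀ j, c.inj j ≫ p j = 𝟙 _ := fun j => by simp [p]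
  have h₂ : ∀ i j, i ≠ j → c.inj i ≫ p j = 0 := fun i j h => by simp [p, h]
  refine ⟨p, h₁, h₂, Cofan.IsColimit.hom_ext hc _ _ (fun i => ?_)⟩
  by_cases hi : i ∈ s
  · rw [Preadditive.comp_sum, Finset.sum_eq_single i]
    · rw [← assoc, h₁, id_comp, comp_id]
    · intro j _ hj
      rw [← assoc, h₂ i j hj.symm, zero_comp]
    · exact fun h => (h hi).elim
  · exact (hs i hi).eq_of_src _ _

theorem hasCoproduct_of_finite_support [HasFiniteBiproducts C] (X : J → C) (s : Finset J)
    (hs : ∀ j, j ∉ s → IsZero (X j)) : HasCoproduct X := by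
  classical
  let b := fun j : s => X j.1
  let c : Cofan X := Cofan.mk (⨁ b) (fun j => if h : j ∈ s then biproduct.ι b ⟨j, h⟩ else 0)
  let p : ∀ j, c.pt ⟶ X j := fun j => if h : j ∈ s then biproduct.π b ⟨j, h⟩ else 0
  obtain ⟨hc⟩ := isColimit_of_split s hs c p (fun j => by
      by_cases h : j ∈ s
      · simp [c, p, h, b]
      · exact (hs j h).eq_of_src _ _)
    (fun i j hij => by
      by_cases h : i ∈ s
      · by_cases h' : j ∈ s
        · simp only [c, p, Cofan.mk_pt, Cofan.mk_ι_app, Cofan.inj, h, h', dif_pos]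
          exact biproduct.ι_π_ne b (fun e => hij (congrArg Subtype.val e))
        · exact (hs j h').eq_of_tgt _ _
      · exact (hs i h).eq_of_src _ _)
    (by
      rw [← Finset.sum_attach]
      have := biproduct.total (f := b)
      change _ = 𝟙 (⨁ b)
      rw [← this]
      exact Finset.sum_congr rfl (fun j _ => by simp [c, p, Cofan.inj, b]))
  exact ⟨⟨c, hc⟩⟩

theorem preservesCoproduct_of_finite_support {D : Type*} [Category* D] [Preadditive D]
    (X : J → C) (s : Finset J) (hs : ∀ j, j ∉ s → IsZero (X j)) (F : C ⥤ D) [F.Additive] :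
    PreservesColimit (Discrete.functor X) F where
  preserves {c} hc := by
    classical
    obtain ⟨p, h₁, h₂, h₃⟩ := exists_split s hs c hc
    obtain ⟨hc'⟩ := isColimit_of_split (X := fun j => F.obj (X j)) s
      (fun j hj => F.map_isZero (hs j hj))
      (Cofan.mk (F.obj c.pt) (fun j => F.map (Cofan.inj c j))) (fun j => F.map (p j))
      (fun j => by
        simp only [Cofan.inj, Cofan.mk_ι_app] at h₁ ⊢
        rw [← F.map_comp, h₁, F.map_id])
      (fun i j h => by
        have := h₂ i j h
        simp only [Cofan.inj, Cofan.mk_ι_app] at this ⊢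
        rw [← F.map_comp, this, F.map_zero])
      (by
        simp only [Cofan.inj, Cofan.mk_ι_app] at h₃ ⊢
        simp only [← F.map_comp, ← F.map_sum, h₃, F.map_id, Cofan.mk_pt])
    exact ⟨(isColimitMapCoconeCofanMkEquiv F X (Cofan.inj c)).symm hc'⟩

end FiniteSupport

section Graded

variable {A : Type*} [Category* A] [Abelian A]

/-- A `ℤ`-graded object is bounded if it vanishes outside a bounded interval. -/
class IsBdd (X : GradedObject ℤ A) : Prop where
  out : ∃ a b : ℤ, ∀ i, i < a ∨ b < i → IsZero (X i)

theorem exists_finset (X : GradedObject ℤ A) [hX : IsBdd X] :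
    ∃ s : Finset ℤ, ∀ i, i ∉ s → IsZero (X i) := by
  obtain ⟨a, b, h⟩ := hX.out
  exact ⟨Finset.Icc a b, fun i hi => h i (by simp only [Finset.mem_Icc] at hi; lia)⟩

variable [MonoidalCategory A] [MonoidalPreadditive A]

theorem isZero_tensor_left {X : A} (h : IsZero X) (Y : A) : IsZero (X ⊗ Y) :=
  (tensorRight Y).map_isZero h

theorem isZero_tensor_right (X : A) {Y : A} (h : IsZero Y) : IsZero (X ⊗ Y) :=
  (tensorLeft X).map_isZero h

theorem exists_support₂ (X Y : GradedObject ℤ A) [IsBdd X] [IsBdd Y] (n : ℤ) :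
    ∃ s : Finset ((fun (i : ℤ × ℤ) => i.1 + i.2) ⁻¹' {n}),
      ∀ i, i ∉ s → IsZero (X i.1.1 ⊗ Y i.1.2) := by
  classical
  obtain ⟨s, hs⟩ := exists_finset X
  obtain ⟨t, ht⟩ := exists_finset Y
  refine ⟨(s ×ˢ t).subtype _, fun i hi => ?_⟩
  rw [Finset.mem_subtype, Finset.mem_product, not_and_or] at hi
  exact hi.elim (fun h => isZero_tensor_left (hs _ h) _) (fun h => isZero_tensor_right _ (ht _ h))

theorem exists_support₃ (X Y Z : GradedObject ℤ A) [IsBdd X] [IsBdd Y] [IsBdd Z] (n : ℤ) :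
    ∃ s : Finset { i : ℤ × ℤ × ℤ | i.1 + i.2.1 + i.2.2 = n },
      ∀ i, i ∉ s → IsZero (X i.1.1 ⊗ Y i.1.2.1 ⊗ Z i.1.2.2) := by
  classical
  obtain ⟨s, hs⟩ := exists_finset X
  obtain ⟨t, ht⟩ := exists_finset Y
  obtain ⟨u, hu⟩ := exists_finset Z
  refine ⟨(s ×ˢ t ×ˢ u).subtype _, fun i hi => ?_⟩
  rw [Finset.mem_subtype, Finset.mem_product, Finset.mem_product, not_and_or, not_and_or] at hi
  rcases hi with h | h | h
  · exact isZero_tensor_left (hs _ h) _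
  · exact isZero_tensor_right _ (isZero_tensor_left (ht _ h) _)
  · exact isZero_tensor_right _ (isZero_tensor_right _ (hu _ h))

variable (X Y Z T : GradedObject ℤ A) [IsBdd X] [IsBdd Y] [IsBdd Z] [IsBdd T]

instance hasTensor : GradedObject.HasTensor X Y := fun n => by
  obtain ⟨s, hs⟩ := exists_support₂ X Y n
  have : HasFiniteBiproducts A := Abelian.hasFiniteBiproducts
  exact hasCoproduct_of_finite_support _ s hs

instance hasGood₁₂ : GradedObject.HasGoodTensor₁₂Tensor X Y Z := fun n k => by
  obtain ⟨s, hs⟩ := exists_support₂ X Y n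
  exact preservesCoproduct_of_finite_support _ s hs (tensorRight (Z k))

instance hasGood₂₃ : GradedObject.HasGoodTensorTensor₂₃ X Y Z := fun k n => by
  obtain ⟨s, hs⟩ := exists_support₂ Y Z n
  exact preservesCoproduct_of_finite_support _ s hs (tensorLeft (X k))

instance hasTensor₄ : GradedObject.HasTensor₄ObjExt X Y Z T := fun k n => by
  obtain ⟨s, hs⟩ := exists_support₃ Y Z T n
  exact preservesCoproduct_of_finite_support _ s hs (tensorLeft (X k))

instance isBdd_tensor : IsBdd (GradedObject.Monoidal.tensorObj X Y) where
  out := by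
    obtain ⟨a, b, h⟩ := IsBdd.out (X := X)
    obtain ⟨c, d, h'⟩ := IsBdd.out (X := Y)
    refine ⟨a + c, b + d, fun n hn => (IsZero.iff_id_eq_zero _).2 ?_⟩
    refine GradedObject.Monoidal.tensorObj_ext _ _ (fun i j hij => IsZero.eq_of_src ?_ _ _)
    by_cases hi : i < a ∨ b < i
    · exact isZero_tensor_left (h i hi) _
    · exact isZero_tensor_right _ (h' j (by lia))

instance isBdd_unit : IsBdd (GradedObject.Monoidal.tensorUnit : GradedObject ℤ A) where
  out := ⟨0, 0, fun i hi => (initialIsInitial.isZero).of_iso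
    ((GradedObject.Monoidal.isInitialTensorUnitApply i (by lia)).uniqueUpToIso initialIsInitial)⟩

instance preservesEmpty₁ (X : A) :
    PreservesColimit (Functor.empty.{0} A) ((curriedTensor A).obj X) :=
  inferInstanceAs (PreservesColimit _ (tensorLeft X))

instance preservesEmpty₂ (X : A) :
    PreservesColimit (Functor.empty.{0} A) ((curriedTensor A).flip.obj X) :=
  inferInstanceAs (PreservesColimit _ (tensorRight X))

end Graded

section

variable (A : Type u) [Category.{v} A] [Abelian A]

/-- The cochain complexes which vanish outside a bounded interval. -/
def isBounded : ObjectProperty (CochainComplex A ℤ) := fun K =>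
  (∃ a : ℤ, K.IsStrictlyGE a) ∧ (∃ b : ℤ, K.IsStrictlyLE b)

/-- The category of bounded cochain complexes. -/
abbrev BoundedComplex := (isBounded A).FullSubcategory

variable {A}

instance isBdd_X (K : BoundedComplex A) : IsBdd K.obj.X where
  out := by
    obtain ⟨⟨a, ha⟩, ⟨b, hb⟩⟩ := K.property
    exact ⟨a, b, fun i hi => hi.elim (fun h => K.obj.isZero_of_isStrictlyGE a i)
      (fun h => K.obj.isZero_of_isStrictlyLE b i)⟩

theorem isBounded_of_isBdd (K : CochainComplex A ℤ) [h : IsBdd K.X] : isBounded A K := by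
  obtain ⟨a, b, h⟩ := h.out
  exact ⟨⟨a, (K.isStrictlyGE_iff a).2 fun i hi => h i (Or.inl hi)⟩,
    ⟨b, (K.isStrictlyLE_iff b).2 fun i hi => h i (Or.inr hi)⟩⟩

variable [MonoidalCategory A] [MonoidalPreadditive A]

instance (K L : BoundedComplex A) : HomologicalComplex.HasTensor K.obj L.obj :=
  hasTensor K.obj.X L.obj.X

instance isBdd_tensor_X (K L : BoundedComplex A) :
   IsBdd (HomologicalComplex.tensorObj K.obj L.obj).X :=
  isBdd_tensor K.obj.X L.obj.X

/-- The total tensor product of bounded complexes. -/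
noncomputable abbrev tensor (K L : BoundedComplex A) : BoundedComplex A :=
  ⟨HomologicalComplex.tensorObj K.obj L.obj, isBounded_of_isBdd _⟩

variable (A) in
noncomputable abbrev unit : BoundedComplex A :=
  ⟨HomologicalComplex.tensorUnit A (.up ℤ), ⟨⟨0, inferInstance⟩, ⟨0, inferInstance⟩⟩⟩

noncomputable abbrev tensorMap {K K' L L' : BoundedComplex A} (f : K ⟶ K') (g : L ⟶ L') :
    tensor K L ⟶ tensor K' L' :=
  ObjectProperty.homMk (HomologicalComplex.tensorHom f.hom g.hom)

noncomputable abbrev tensorAssoc (K L M : BoundedComplex A) :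
    tensor (tensor K L) M ≅ tensor K (tensor L M) :=
  ObjectProperty.isoMk _ (HomologicalComplex.associator K.obj L.obj M.obj)

noncomputable abbrev tensorUnitLeft (K : BoundedComplex A) : tensor (unit A) K ≅ K :=
  ObjectProperty.isoMk _ (HomologicalComplex.leftUnitor K.obj)

noncomputable abbrev tensorUnitRight (K : BoundedComplex A) : tensor K (unit A) ≅ K :=
  ObjectProperty.isoMk _ (HomologicalComplex.rightUnitor K.obj)

theorem hom_ext {K L : BoundedComplex A} {f g : K ⟶ L} (h : f.hom.f = g.hom.f) : f = g := by
  ext n; exact congrFun h n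

noncomputable instance : MonoidalCategoryStruct (BoundedComplex A) where
  tensorObj := tensor
  tensorUnit := unit A
  tensorHom := tensorMap
  whiskerLeft K _ _ g := tensorMap (𝟙 K) g
  whiskerRight f K := tensorMap f (𝟙 K)
  associator := tensorAssoc
  leftUnitor := tensorUnitLeft
  rightUnitor := tensorUnitRight

open GradedObject

section

variable (A) in
/-- The unit complex, as a graded object. -/
noncomputable abbrev unitX : GradedObject ℤ A := (HomologicalComplex.tensorUnit A (.up ℤ)).X

instance : IsBdd (unitX A) := isBdd_X (unit A)

variable (A) in
noncomputable abbrev unitXIso : (Monoidal.tensorUnit : GradedObject ℤ A) ≅ unitX A :=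
  HomologicalComplex.tensorUnitIso A (.up ℤ)

theorem leftUnitor_aux {X Y : GradedObject ℤ A} [IsBdd X] [IsBdd Y] (f : X ⟶ Y) :
    Monoidal.tensorHom (𝟙 (unitX A)) f ≫
      Monoidal.tensorHom (unitXIso A).inv (𝟙 Y) ≫ (Monoidal.leftUnitor Y).hom =
    (Monoidal.tensorHom (unitXIso A).inv (𝟙 X) ≫ (Monoidal.leftUnitor X).hom) ≫ f := by
  rw [assoc, ← Monoidal.leftUnitor_naturality, Monoidal.tensorHom_comp_tensorHom_assoc,
    Monoidal.tensorHom_comp_tensorHom_assoc, id_comp, comp_id, id_comp, comp_id]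

theorem rightUnitor_aux {X Y : GradedObject ℤ A} [IsBdd X] [IsBdd Y] (f : X ⟶ Y) :
    Monoidal.tensorHom f (𝟙 (unitX A)) ≫
      Monoidal.tensorHom (𝟙 Y) (unitXIso A).inv ≫ (Monoidal.rightUnitor Y).hom =
    (Monoidal.tensorHom (𝟙 X) (unitXIso A).inv ≫ (Monoidal.rightUnitor X).hom) ≫ f := by
  rw [assoc, ← Monoidal.rightUnitor_naturality, Monoidal.tensorHom_comp_tensorHom_assoc,
    Monoidal.tensorHom_comp_tensorHom_assoc, id_comp, comp_id, id_comp, comp_id]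

theorem triangle_aux (X Y : GradedObject ℤ A) [IsBdd X] [IsBdd Y] :
    (Monoidal.associator X (unitX A) Y).hom ≫ Monoidal.tensorHom (𝟙 X)
      (Monoidal.tensorHom (unitXIso A).inv (𝟙 Y) ≫ (Monoidal.leftUnitor Y).hom) =
    Monoidal.tensorHom (Monoidal.tensorHom (𝟙 X) (unitXIso A).inv ≫
      (Monoidal.rightUnitor X).hom) (𝟙 Y) := by
  have h := Monoidal.associator_naturality (𝟙 X) (unitXIso A).inv (𝟙 Y)
  have t := Monoidal.triangle X Y
  rw [← id_comp (𝟙 X), ← Monoidal.tensorHom_comp_tensorHom, ← reassoc_of% h, t,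
    Monoidal.tensorHom_comp_tensorHom, id_comp, id_comp]

end

noncomputable instance : MonoidalCategory (BoundedComplex A) where
  tensorHom_def f g := hom_ext (Monoidal.tensorHom_def f.hom.f g.hom.f)
  id_tensorHom_id K L := hom_ext (Monoidal.id_tensorHom_id K.obj.X L.obj.X)
  tensorHom_comp_tensorHom f₁ f₂ g₁ g₂ :=
    hom_ext (Monoidal.tensorHom_comp_tensorHom f₁.hom.f g₁.hom.f f₂.hom.f g₂.hom.f)
  whiskerLeft_id K L := hom_ext (Monoidal.id_tensorHom_id K.obj.X L.obj.X)
  id_whiskerRight K L := hom_ext (Monoidal.id_tensorHom_id K.obj.X L.obj.X)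
  associator_naturality f₁ f₂ f₃ :=
    hom_ext (Monoidal.associator_naturality f₁.hom.f f₂.hom.f f₃.hom.f)
  leftUnitor_naturality f := hom_ext (leftUnitor_aux f.hom.f)
  rightUnitor_naturality f := hom_ext (rightUnitor_aux f.hom.f)
  pentagon K L M N := hom_ext (Monoidal.pentagon K.obj.X L.obj.X M.obj.X N.obj.X)
  triangle K L := hom_ext (triangle_aux K.obj.X L.obj.X)
end

section
open GradedObject GradedObject.Monoidal

variable {A : Type u} [Category.{v} A] [Abelian A] [MonoidalCategory A] [MonoidalPreadditive A]

theorem units_smul_whiskerRight (n : ℤˣ) {X Y : A} (f : X ⟶ Y) (Z : A) :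
    (n • f) ▷ Z = n • (f ▷ Z) := (tensorRight Z).map_zsmul

theorem whiskerLeft_units_smul (n : ℤˣ) {X Y : A} (f : X ⟶ Y) (Z : A) :
    Z ◁ (n • f) = n • (Z ◁ f) := (tensorLeft Z).map_zsmul

theorem ι_tensor_d' (K L : BoundedComplex A) (i j k : ℤ) (h : i + j = k) :
    HomologicalComplex.ιTensorObj K.obj L.obj i j k h ≫
      (HomologicalComplex.tensorObj K.obj L.obj).d k (k + 1) =
    K.obj.d i (i + 1) ▷ L.obj.X j ≫
        HomologicalComplex.ιTensorObj K.obj L.obj (i + 1) j (k + 1) (by lia) +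
      i.negOnePow • (K.obj.X i ◁ L.obj.d j (j + 1) ≫
        HomologicalComplex.ιTensorObj K.obj L.obj i (j + 1) (k + 1) (by lia)) := by
  rw [HomologicalComplex.mapBifunctor.d_eq, Preadditive.comp_add,
    HomologicalComplex.mapBifunctor.ι_D₁, HomologicalComplex.mapBifunctor.ι_D₂,
    HomologicalComplex.mapBifunctor.d₁_eq _ _ _ _
      (show (ComplexShape.up ℤ).Rel i (i + 1) from rfl) _ _ (show i + 1 + j = k + 1 by lia),
    HomologicalComplex.mapBifunctor.d₂_eq _ _ _ _ _
      (show (ComplexShape.up ℤ).Rel j (j + 1) from rfl) _ (show i + (j + 1) = k + 1 by lia)]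
  congr 1
  exact one_smul _ _

/-- The differential of the tensor product. -/
noncomputable def tensorD (K L : BoundedComplex A) (k : ℤ) :
    Monoidal.tensorObj K.obj.X L.obj.X k ⟶ Monoidal.tensorObj K.obj.X L.obj.X (k + 1) :=
  (HomologicalComplex.tensorObj K.obj L.obj).d k (k + 1)

theorem ι_tensorD (K L : BoundedComplex A) (i j k : ℤ) (h : i + j = k) :
    ιTensorObj K.obj.X L.obj.X i j k h ≫ tensorD K L k =
    K.obj.d i (i + 1) ▷ L.obj.X j ≫
        ιTensorObj K.obj.X L.obj.X (i + 1) j (k + 1) (by lia) +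
      i.negOnePow • (K.obj.X i ◁ L.obj.d j (j + 1) ≫
        ιTensorObj K.obj.X L.obj.X i (j + 1) (k + 1) (by lia)) :=
  ι_tensor_d' K L i j k h

theorem ι_tensorD_assoc (K L : BoundedComplex A) (i j k : ℤ) (h : i + j = k) {W : A}
    (f : Monoidal.tensorObj K.obj.X L.obj.X (k + 1) ⟶ W) :
    ιTensorObj K.obj.X L.obj.X i j k h ≫ tensorD K L k ≫ f =
    (K.obj.d i (i + 1) ▷ L.obj.X j ≫
        ιTensorObj K.obj.X L.obj.X (i + 1) j (k + 1) (by lia) +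
      i.negOnePow • (K.obj.X i ◁ L.obj.d j (j + 1) ≫
        ιTensorObj K.obj.X L.obj.X i (j + 1) (k + 1) (by lia))) ≫ f := by
  rw [← ι_tensorD, assoc]

variable [SymmetricCategory A]

section

variable (X Y Z : GradedObject ℤ A) [IsBdd X] [IsBdd Y] [IsBdd Z]

/-- The exchange of factors on graded objects, with the sign `(-1) ^ (i * j)` on the
summand of bidegree `(i, j)`. -/
noncomputable def swap : Monoidal.tensorObj X Y ⟶ Monoidal.tensorObj Y X := fun k =>
  tensorObjDesc (fun i j hij => (i * j).negOnePow • ((β_ (X i) (Y j)).hom ≫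
    ιTensorObj Y X j i k (by rw [add_comm]; exact hij)))

theorem ι_swap (i j k : ℤ) (h : i + j = k) : ιTensorObj X Y i j k h ≫ swap X Y k =
    (i * j).negOnePow • ((β_ (X i) (Y j)).hom ≫ ιTensorObj Y X j i k (by rw [add_comm]; exact h)) :=
  ι_tensorObjDesc _ _ _ _

theorem ι_swap_assoc (i j k : ℤ) (h : i + j = k) {W : A} (f : Monoidal.tensorObj Y X k ⟶ W) :
    ιTensorObj X Y i j k h ≫ swap X Y k ≫ f =
    ((i * j).negOnePow • ((β_ (X i) (Y j)).hom ≫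
      ιTensorObj Y X j i k (by rw [add_comm]; exact h))) ≫ f := by
  rw [← ι_swap, assoc]

theorem swap_swap : swap X Y ≫ swap Y X = 𝟙 _ := by
  ext k i j h
  change ιTensorObj X Y i j k h ≫ swap X Y k ≫ swap Y X k = _ ≫ 𝟙 _
  rw [ι_swap_assoc, Linear.units_smul_comp, assoc, ι_swap, Linear.comp_units_smul, smul_smul,
    mul_comm j i, Int.units_mul_self, one_smul, ← assoc, SymmetricCategory.symmetry, id_comp,
    comp_id]

variable {X Y} in
theorem swap_naturality {X' Y' : GradedObject ℤ A} [IsBdd X'] [IsBdd Y']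
    (f : X ⟶ X') (g : Y ⟶ Y') :
    Monoidal.tensorHom f g ≫ swap X' Y' = swap X Y ≫ Monoidal.tensorHom g f := by
  ext k i j h
  change ιTensorObj X Y i j k h ≫ Monoidal.tensorHom f g k ≫ swap X' Y' k =
    ιTensorObj X Y i j k h ≫ swap X Y k ≫ Monoidal.tensorHom g f k
  rw [ι_tensorHom_assoc, ι_swap, ι_swap_assoc, Linear.units_smul_comp, Linear.comp_units_smul,
    assoc, ι_tensorHom, BraidedCategory.braiding_naturality_assoc]

theorem swap_hexagon :
    (Monoidal.associator X Y Z).hom ≫ swap X (Monoidal.tensorObj Y Z) ≫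
      (Monoidal.associator Y Z X).hom =
    Monoidal.whiskerRight (swap X Y) Z ≫ (Monoidal.associator Y X Z).hom ≫
      Monoidal.whiskerLeft Y (swap X Z) := by
  ext k i₁ i₂ i₃ h
  change _ ≫ (Monoidal.associator X Y Z).hom k ≫ swap X (Monoidal.tensorObj Y Z) k ≫
      (Monoidal.associator Y Z X).hom k =
    _ ≫ Monoidal.whiskerRight (swap X Y) Z k ≫ (Monoidal.associator Y X Z).hom k ≫
      Monoidal.whiskerLeft Y (swap X Z) k
  conv_lhs => rw [ιTensorObj₃'_associator_hom_assoc, ιTensorObj₃_eq X Y Z i₁ i₂ i₃ k h _ rfl,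
    assoc, ι_swap_assoc, Linear.units_smul_comp, Linear.comp_units_smul, Linear.comp_units_smul,
    assoc, ← MonoidalCategory.id_tensorHom,
    BraidedCategory.braiding_naturality_assoc,
    BraidedCategory.braiding_tensor_right_hom, assoc, assoc, assoc, assoc, Iso.hom_inv_id_assoc,
    MonoidalCategory.tensorHom_id,
    ← ιTensorObj₃'_eq_assoc Y Z X i₂ i₃ i₁ k (by rw [add_comm _ i₁, ← add_assoc, h]) _ rfl,
    ιTensorObj₃'_associator_hom, Iso.inv_hom_id_assoc]
  conv_rhs => rw [ιTensorObj₃'_eq X Y Z i₁ i₂ i₃ k h _ rfl, assoc, ι_tensorHom_assoc,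
    ← MonoidalCategory.tensorHom_id,
    MonoidalCategory.tensorHom_comp_tensorHom_assoc, id_comp, ι_swap,
    categoryOfGradedObjects_id, MonoidalCategory.tensorHom_id, units_smul_whiskerRight,
    Linear.units_smul_comp, MonoidalCategory.comp_whiskerRight, assoc,
    ← ιTensorObj₃'_eq_assoc Y X Z i₂ i₁ i₃ k
      (by rw [add_comm i₂ i₁, h]) (i₁ + i₂) (add_comm i₂ i₁),
    ιTensorObj₃'_associator_hom_assoc,
    ιTensorObj₃_eq Y X Z i₂ i₁ i₃ k (by rw [add_comm i₂ i₁, h]) _ rfl, assoc,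
    ι_tensorHom, categoryOfGradedObjects_id, MonoidalCategory.id_tensorHom,
    ← MonoidalCategory.whiskerLeft_comp_assoc, ι_swap, whiskerLeft_units_smul,
    Linear.units_smul_comp, Linear.comp_units_smul, Linear.comp_units_smul, smul_smul,
    MonoidalCategory.whiskerLeft_comp, assoc,
    ← ιTensorObj₃_eq Y Z X i₂ i₃ i₁ k (by rw [add_comm _ i₁, ← add_assoc, h])
      (i₁ + i₃) (add_comm _ _)]
  rw [mul_add, Int.negOnePow_add]

end

/-- The exchange of factors on the tensor product of two bounded complexes. -/
noncomputable def braid (K L : BoundedComplex A) : K ⊗ L ⟶ L ⊗ K :=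
  ObjectProperty.homMk
    { f := swap K.obj.X L.obj.X
      comm' := by
        rintro k _ rfl
        refine GradedObject.Monoidal.tensorObj_ext _ _ (fun i j h => ?_)
        change ιTensorObj K.obj.X L.obj.X i j k h ≫ swap K.obj.X L.obj.X k ≫ tensorD L K k =
          ιTensorObj K.obj.X L.obj.X i j k h ≫ tensorD K L k ≫ swap K.obj.X L.obj.X (k + 1)
        rw [ι_tensorD_assoc, ι_swap_assoc, Linear.units_smul_comp, assoc,
          ι_tensorD, Preadditive.add_comp, Linear.units_smul_comp, assoc, assoc,
          ι_swap, ι_swap, Linear.comp_units_smul, Linear.comp_units_smul,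
          BraidedCategory.braiding_naturality_left_assoc,
          BraidedCategory.braiding_naturality_right_assoc, Preadditive.comp_add, smul_add,
          Linear.comp_units_smul, smul_smul, smul_smul]
        have e₁ : ((i + 1) * j).negOnePow = (i * j).negOnePow * j.negOnePow := by
          rw [add_mul, one_mul, Int.negOnePow_add]
        have e₂ : i.negOnePow * (i * (j + 1)).negOnePow = (i * j).negOnePow := by
          rw [mul_add, mul_one, Int.negOnePow_add, mul_comm, mul_assoc, Int.units_mul_self, mul_one]
        rw [e₁, e₂]
        exact add_comm _ _ }

theorem braid_braid (K L : BoundedComplex A) : braid K L ≫ braid L K = 𝟙 _ :=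
  hom_ext (swap_swap K.obj.X L.obj.X)

theorem braid_naturality {K K' L L' : BoundedComplex A} (f : K ⟶ K') (g : L ⟶ L') :
    (f ⊗ₘ g) ≫ braid K' L' = braid K L ≫ (g ⊗ₘ f) :=
  hom_ext (swap_naturality f.hom.f g.hom.f)

theorem braid_hexagon (K L M : BoundedComplex A) :
    (α_ K L M).hom ≫ braid K (L ⊗ M) ≫ (α_ L M K).hom =
      braid K L ▷ M ≫ (α_ L K M).hom ≫ L ◁ braid K M :=
  hom_ext (swap_hexagon K.obj.X L.obj.X M.obj.X)

noncomputable instance : BraidedCategory (BoundedComplex A) where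
  braiding K L := ⟨braid K L, braid L K, braid_braid K L, braid_braid L K⟩
  braiding_naturality_left f K := by simpa using braid_naturality f (𝟙 K)
  braiding_naturality_right K _ _ f := by simpa using braid_naturality (𝟙 K) f
  hexagon_forward := braid_hexagon
  hexagon_reverse K L M := by
    have h₁ : ∀ X Y Z : BoundedComplex A, braid X Y ▷ Z ≫ braid Y X ▷ Z = 𝟙 _ := fun X Y Z => by
      rw [← comp_whiskerRight, braid_braid, id_whiskerRight]
    have h₂ : ∀ X Y Z : BoundedComplex A, Z ◁ braid X Y ≫ Z ◁ braid Y X = 𝟙 _ := fun X Y Z => by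
      rw [← MonoidalCategory.whiskerLeft_comp, braid_braid, MonoidalCategory.whiskerLeft_id]
    have h := braid_hexagon M K L
    let f : (M ⊗ K) ⊗ L ≅ K ⊗ L ⊗ M :=
      ⟨(α_ M K L).hom ≫ braid M (K ⊗ L) ≫ (α_ K L M).hom,
        (α_ K L M).inv ≫ braid (K ⊗ L) M ≫ (α_ M K L).inv,
        by simp [reassoc_of% braid_braid], by simp [reassoc_of% braid_braid]⟩
    let g : (M ⊗ K) ⊗ L ≅ K ⊗ L ⊗ M :=
      ⟨braid M K ▷ L ≫ (α_ K M L).hom ≫ K ◁ braid M L,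
        K ◁ braid L M ≫ (α_ K M L).inv ≫ braid K M ▷ L,
        by simp [reassoc_of% h₂, h₁], by simp [reassoc_of% h₁, h₂]⟩
    exact congrArg Iso.inv (Iso.ext h : f = g)

noncomputable instance : SymmetricCategory (BoundedComplex A) where
  symmetry := braid_braid

end

section
variable (A : Type u) [Category.{v} A] [Abelian A]

/-- The cochain complexes which vanish in large degrees. -/
def minus : ObjectProperty (CochainComplex A ℤ) := fun K => ∃ b : ℤ, K.IsStrictlyLE b

/-- The complexes which vanish in large degrees, in the homotopy category of
bounded below complexes. -/
def plusMinus : ObjectProperty (HomotopyCategory.Plus A) :=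
  ((minus A).strictMap (HomotopyCategory.quotient A (.up ℤ))).inverseImage
    (HomotopyCategory.Plus.ι A)

/-- The homotopy category of bounded complexes. -/
abbrev HomotopyBounded := (plusMinus A).FullSubcategory

variable {A} in
theorem plusMinus_iff (K : CochainComplex.Plus A) :
    plusMinus A ((HomotopyCategory.Plus.quotient A).obj K) ↔ minus A K.obj := by
  refine ⟨?_, fun h => ⟨_, h⟩⟩
  simp only [plusMinus, ObjectProperty.prop_inverseImage_iff, ObjectProperty.strictMap_iff]
  rintro ⟨L, h, hL⟩
  obtain rfl : L = K.obj := congr_arg Quotient.as hL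
  exact h

theorem isStrictlyLE_mappingCone {K L : CochainComplex A ℤ} (f : K ⟶ L) (b c : ℤ)
    [K.IsStrictlyLE b] [L.IsStrictlyLE c] :
    (CochainComplex.mappingCone f).IsStrictlyLE (max b c) := by
  rw [CochainComplex.isStrictlyLE_iff]
  intro i hi
  simp only [CochainComplex.mappingCone.isZero_X_iff]
  exact ⟨K.isZero_of_isStrictlyLE b _ (by grind), L.isZero_of_isStrictlyLE c _ (by grind)⟩

instance : (plusMinus A).ContainsZero where
  exists_zero := by
    obtain ⟨Z, hZ⟩ := HasZeroObject.zero (C := CochainComplex A ℤ)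
    have h (i : ℤ) : IsZero (Z.X i) := (HomologicalComplex.eval A (.up ℤ) i).map_isZero hZ
    let Z' : CochainComplex.Plus A :=
      ⟨Z, ⟨0, (CochainComplex.isStrictlyGE_iff _ _).2 fun i _ => h i⟩⟩
    refine ⟨(HomotopyCategory.Plus.quotient A).obj Z', ?_,
      (plusMinus_iff Z').2 ⟨0, (CochainComplex.isStrictlyLE_iff _ _).2 fun i _ => h i⟩⟩
    rw [IsZero.iff_id_eq_zero]
    exact (HomotopyCategory.Plus.ι A).map_injective
      ((((HomotopyCategory.quotient A (.up ℤ)).map_isZero hZ)).eq_of_src _ _)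

instance : (plusMinus A).IsStableUnderShift ℤ where
  isStableUnderShiftBy n :=
    { le_shift K hK := by
        obtain ⟨K, rfl⟩ := HomotopyCategory.Plus.quotient_obj_surjective K
        obtain ⟨b, hb⟩ := (plusMinus_iff K).1 hK
        change ((minus A).strictMap (HomotopyCategory.quotient A (.up ℤ))) _
        exact ObjectProperty.strictMap_iff .. |>.2 ⟨(shiftFunctor _ n).obj K.obj,
          ⟨b - n, K.obj.isStrictlyLE_shift b n (b - n) (by lia)⟩,
          by
            refine (HomotopyCategory.shift_quotient_obj K.obj n).symm.trans ?_
            with_unfolding_all rfl⟩ }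

instance : (plusMinus A).IsTriangulatedClosed₃ where
  ext₃' T hT h₁ h₂ := by
    obtain ⟨X, Y, Z, f, g, h⟩ := T
    obtain ⟨K, rfl⟩ := HomotopyCategory.Plus.quotient_obj_surjective X
    obtain ⟨L, rfl⟩ := HomotopyCategory.Plus.quotient_obj_surjective Y
    obtain ⟨f, rfl⟩ := (HomotopyCategory.Plus.quotient _).map_surjective f
    obtain ⟨b, hb⟩ := (plusMinus_iff K).1 h₁
    obtain ⟨c, hc⟩ := (plusMinus_iff L).1 h₂
    obtain ⟨a, ha⟩ := K.property
    obtain ⟨a', ha'⟩ := L.property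
    let M : CochainComplex.Plus A := ⟨CochainComplex.mappingCone f.hom, min (a - 1) a',
      CochainComplex.isStrictlyGE_mappingCone f.hom a a' _ (by simp) (by simp)⟩
    refine ⟨(HomotopyCategory.Plus.quotient A).obj M,
      (plusMinus_iff M).2 ⟨_, isStrictlyLE_mappingCone A f.hom b c⟩,
      ⟨(HomotopyCategory.Plus.ι A).preimageIso ?_⟩⟩
    exact Pretriangulated.Triangle.π₃.mapIso (Pretriangulated.isoTriangleOfIso₁₂ _ _
      ((HomotopyCategory.Plus.ι A).map_distinguished _ hT)
      (HomotopyCategory.mappingCone_triangleh_distinguished f.hom) (Iso.refl _) (Iso.refl _)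
      ((comp_id _).trans (id_comp _).symm))

instance : (plusMinus A).IsTriangulated where
  toIsTriangulatedClosed₂ := .of_isTriangulatedClosed₃

instance : (plusMinus A).IsVerdierLeftLocalizing
    (HomotopyCategory.Plus.subcategoryAcyclic A) where
  fac {K L} φ hK hL := by
    obtain ⟨K, rfl⟩ := HomotopyCategory.Plus.quotient_obj_surjective K
    obtain ⟨L, rfl⟩ := HomotopyCategory.Plus.quotient_obj_surjective L
    obtain ⟨φ, rfl⟩ := (HomotopyCategory.Plus.quotient _).map_surjective φ
    obtain ⟨b, hb⟩ := (plusMinus_iff K).1 hK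
    obtain ⟨a, ha⟩ := L.property
    have hL' : L.obj.Acyclic := by
      rw [← HomotopyCategory.quotient_obj_mem_subcategoryAcyclic_iff_acyclic]
      exact hL
    let M : CochainComplex.Plus A := ⟨L.obj.truncLE b, a, inferInstance⟩
    let p : K ⟶ M := ObjectProperty.homMk
      (inv (K.obj.ιTruncLE b) ≫ CochainComplex.truncLEMap φ.hom b)
    let i : M ⟶ L := ObjectProperty.homMk (L.obj.ιTruncLE b)
    refine ⟨(HomotopyCategory.Plus.quotient A).obj M, (HomotopyCategory.Plus.quotient A).map p,
      (HomotopyCategory.Plus.quotient A).map i, (plusMinus_iff M).2 ⟨b, ?_⟩, ?_, ?_⟩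
    · change (L.obj.truncLE b).IsStrictlyLE b
      infer_instance
    · change HomotopyCategory.subcategoryAcyclic A
        ((HomotopyCategory.quotient A (.up ℤ)).obj (L.obj.truncLE b))
      rw [HomotopyCategory.quotient_obj_mem_subcategoryAcyclic_iff_acyclic]
      exact hL'.truncLE _
    · rw [← Functor.map_comp]
      congr 1
      ext : 1
      change (inv (K.obj.ιTruncLE b) ≫ CochainComplex.truncLEMap φ.hom b) ≫ L.obj.ιTruncLE b = _
      rw [assoc, CochainComplex.ιTruncLE_naturality, IsIso.inv_hom_id_assoc]

end

section
variable (A : Type u) [Category.{v} A] [Abelian A]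

open HomologicalComplex in
theorem minus_cylinder (K : CochainComplex A ℤ) (hK : minus A K) : minus A (cylinder K) := by
  obtain ⟨n, hn⟩ := hK
  refine ⟨n, ?_⟩
  rw [CochainComplex.isStrictlyLE_iff]
  intro i hi
  refine homotopyCofiber.isZero_X (biprod.lift (𝟙 K) (-𝟙 K)) _ ?_ (fun j hj => ?_)
  · exact IsZero.of_iso (by simpa using K.isZero_of_isStrictlyLE n i hi)
      ((HomologicalComplex.eval A (.up ℤ) i).mapBiprod _ _)
  · simp only [ComplexShape.up_Rel] at hj
    exact K.isZero_of_isStrictlyLE n _ (by lia)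

/-- Bounded complexes as bounded below complexes. -/
abbrev toPlus : BoundedComplex A ⥤ CochainComplex.Plus A :=
  ObjectProperty.ιOfLE fun _ h => h.1

/-- The functor from bounded complexes to the homotopy category. -/
def toHomotopyBounded : BoundedComplex A ⥤ HomotopyBounded A :=
  (plusMinus A).lift (toPlus A ⋙ HomotopyCategory.Plus.quotient A)
    fun K => (plusMinus_iff _).2 K.property.2

instance : (toHomotopyBounded A).EssSurj where
  mem_essImage K := by
    obtain ⟨L, hL⟩ := HomotopyCategory.Plus.quotient_obj_surjective K.obj
    have h := K.property
    rw [← hL, plusMinus_iff] at h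
    exact ⟨⟨L.obj, L.property, h⟩, ⟨ObjectProperty.isoMk _ (eqToIso hL)⟩⟩

instance : (toHomotopyBounded A).Full where
  map_surjective {K L} f := by
    obtain ⟨g, hg⟩ := (HomotopyCategory.Plus.quotient A).map_surjective
      (X := (toPlus A).obj K) (Y := (toPlus A).obj L) f.hom
    exact ⟨ObjectProperty.homMk g.hom, by ext : 1; exact hg⟩

theorem toHomotopyBounded_map_eq {K L : BoundedComplex A} {f g : K ⟶ L}
    (h : (toHomotopyBounded A).map f = (toHomotopyBounded A).map g) :
    (HomotopyCategory.quotient A (.up ℤ)).map f.hom =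
      (HomotopyCategory.quotient A (.up ℤ)).map g.hom :=
  (HomotopyCategory.Plus.ι A).congr_map ((plusMinus A).ι.congr_map h)

open HomologicalComplex in
instance : (toHomotopyBounded A).IsLocalization
    ((homotopyEquivalences A (.up ℤ)).inverseImage (isBounded A).ι) :=
  Functor.isLocalization_of_essSurj_of_full_of_exists_cylinders _ _
    (fun K L f hf => by
      rw [← isIso_iff_of_reflects_iso _ ((plusMinus A).ι ⋙ HomotopyCategory.Plus.ι A)]
      change IsIso ((HomotopyCategory.quotient A (.up ℤ)).map f.hom)
      rw [← HomotopyCategory.inverseImage_quotient_isomorphisms] at hf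
      exact hf) (by
    rintro K L f₀ f₁ hf
    obtain ⟨f₀, rfl⟩ := ObjectProperty.homMk_surjective f₀
    obtain ⟨f₁, rfl⟩ := ObjectProperty.homMk_surjective f₁
    replace hf := HomotopyCategory.homotopyOfEq f₀ f₁ (toHomotopyBounded_map_eq A hf)
    exact ⟨K.obj.precylinder.toFullSubcategory ⟨K.obj.plus_cylinder K.property.1,
        minus_cylinder A K.obj K.property.2⟩,
      HomotopicalAlgebra.Precylinder.LeftHomotopy.fullSubcategoryEquiv.symm
      { h := cylinder.desc _ _ hf,
        h₀ := cylinder.ι₀_desc _ _ hf,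
        h₁ := cylinder.ι₁_desc _ _ hf }, ⟨cylinder.homotopyEquiv _ (fun n => ⟨n - 1, by simp⟩), rfl⟩⟩)

/-- The quasi-isomorphisms of bounded complexes. -/
def quasiIso : MorphismProperty (BoundedComplex A) :=
  (HomologicalComplex.quasiIso A (.up ℤ)).inverseImage (isBounded A).ι

variable [HasDerivedCategory.{w} A]

open DerivedCategory DerivedCategory.TStructure

theorem bounded_Q (K : BoundedComplex A) :
    (t : Triangulated.TStructure (DerivedCategory A)).bounded (Q.obj K.obj) := by
  obtain ⟨⟨a, _⟩, ⟨b, _⟩⟩ := K.property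
  exact ⟨⟨a, (inferInstance : (Q.obj K.obj).IsGE a)⟩, ⟨b, (inferInstance : (Q.obj K.obj).IsLE b)⟩⟩

/-- The localization functor from bounded complexes to the bounded derived category. -/
noncomputable def Qb : BoundedComplex A ⥤ Bounded A :=
  t.bounded.lift ((isBounded A).ι ⋙ Q) (bounded_Q A)

noncomputable def Qhb : HomotopyBounded A ⥤ Bounded A :=
  t.bounded.lift ((plusMinus A).ι ⋙ HomotopyCategory.Plus.ι A ⋙ Qh) (by
    rintro ⟨K, hK⟩
    obtain ⟨K, rfl⟩ := HomotopyCategory.Plus.quotient_obj_surjective K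
    exact t.bounded.prop_of_iso ((quotientCompQhIso A).symm.app K.obj)
      (bounded_Q A ⟨K.obj, K.property, (plusMinus_iff K).1 hK⟩))

instance : (Qb A).EssSurj where
  mem_essImage X := by
    obtain ⟨X, ⟨a, ha⟩, ⟨b, hb⟩⟩ := X
    have : X.IsGE a := ha
    have : X.IsLE b := hb
    obtain ⟨K, _, _, ⟨e⟩⟩ := exists_iso_Q_obj_of_isGE_of_isLE X a b
    exact ⟨⟨K, ⟨a, inferInstance⟩, ⟨b, inferInstance⟩⟩, ⟨ObjectProperty.isoMk _ e.symm⟩⟩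

noncomputable def toHomotopyBoundedCompQhb : toHomotopyBounded A ⋙ Qhb A ≅ Qb A :=
  t.bounded.fullyFaithfulι.whiskeringRight _ |>.preimageIso
    (Functor.isoWhiskerLeft (isBounded A).ι (quotientCompQhIso A))

instance : (Qhb A).EssSurj where
  mem_essImage X := ⟨(toHomotopyBounded A).obj ((Qb A).objPreimage X),
    ⟨(toHomotopyBoundedCompQhb A).app _ ≪≫ (Qb A).objObjPreimageIso X⟩⟩

noncomputable def boundedToPlus : Bounded A ⥤ Plus A :=
  ObjectProperty.ιOfLE fun _ h => h.1

instance : (boundedToPlus A).Full := by dsimp only [boundedToPlus]; infer_instance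
instance : (boundedToPlus A).Faithful := by dsimp only [boundedToPlus]; infer_instance

instance : (Qhb A).IsLocalization
    ((HomotopyCategory.Plus.subcategoryAcyclic A).inverseImage (plusMinus A).ι).trW :=
  ((plusMinus A).triangulatedLocalizerMorphism
    (HomotopyCategory.Plus.subcategoryAcyclic A)).isLocalization_of_isLocalizedFullyFaithful
      (L₂ := Plus.Qh) (F := boundedToPlus A) (Iso.refl _)

theorem trW_iff {K L : HomotopyBounded A} (f : K ⟶ L) :
    ((HomotopyCategory.Plus.subcategoryAcyclic A).inverseImage (plusMinus A).ι).trW f ↔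
    HomotopyCategory.Plus.quasiIso A f.hom := by
  rw [HomotopyCategory.Plus.quasiIso_eq_subcategoryAcyclic_trW]
  obtain ⟨M, g, h, mem⟩ := CategoryTheory.Pretriangulated.distinguished_cocone_triangle f
  exact (((HomotopyCategory.Plus.subcategoryAcyclic A).inverseImage
    (plusMinus A).ι).trW_iff_of_distinguished _ mem).trans
      ((HomotopyCategory.Plus.subcategoryAcyclic A).trW_iff_of_distinguished _
        ((plusMinus A).ι.map_distinguished _ mem)).symm

theorem quasiIso_iff {K L : BoundedComplex A} (f : K ⟶ L) :
    quasiIso A f ↔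
    ((HomotopyCategory.Plus.subcategoryAcyclic A).inverseImage (plusMinus A).ι).trW
      ((toHomotopyBounded A).map f) := by
  rw [trW_iff]
  exact (HomotopyCategory.quotient_map_mem_quasiIso_iff f.hom).symm

instance : (Qb A).IsLocalization (quasiIso A) := by
  have h : (toHomotopyBounded A ⋙ Qhb A).IsLocalization (quasiIso A) := by
    refine Functor.IsLocalization.comp (toHomotopyBounded A) (Qhb A)
      ((HomologicalComplex.homotopyEquivalences A (.up ℤ)).inverseImage (isBounded A).ι)
      ((HomotopyCategory.Plus.subcategoryAcyclic A).inverseImage (plusMinus A).ι).trW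
      (quasiIso A) ?_ ?_ ?_
    · intro K L f hf
      exact Localization.inverts (Qhb A) _ _ ((quasiIso_iff A f).1 hf)
    · exact fun K L f hf => homotopyEquivalences_le_quasiIso _ _ _ hf
    · intro K L f hf
      let F := toHomotopyBounded A
      obtain ⟨g, hg⟩ := F.map_surjective
        ((F.objObjPreimageIso K).hom ≫ f ≫ (F.objObjPreimageIso L).inv)
      let e : Arrow.mk (F.map g) ≅ Arrow.mk f :=
        Arrow.isoMk (F.objObjPreimageIso K) (F.objObjPreimageIso L) (by simp [hg])
      exact ⟨_, _, g, (quasiIso_iff A g).2 ((MorphismProperty.arrow_mk_iso_iff _ e).2 hf), ⟨e⟩⟩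
  exact Functor.IsLocalization.of_iso _ (toHomotopyBoundedCompQhb A)

end

section
variable {A : Type u} [Category.{v} A] [Abelian A]

/-- A finitely supported coproduct of short exact sequences is short exact. -/
theorem shortExact_of_coproduct {J : Type} (X : J → ShortComplex A) (s : Finset J)
    (hs₁ : ∀ j, j ∉ s → IsZero (X j).X₁) (hs₂ : ∀ j, j ∉ s → IsZero (X j).X₂)
    (hs₃ : ∀ j, j ∉ s → IsZero (X j).X₃)
    (hX : ∀ j, (X j).ShortExact) (S : ShortComplex A)
    (i₁ : ∀ j, (X j).X₁ ⟶ S.X₁) (i₂ : ∀ j, (X j).X₂ ⟶ S.X₂) (i₃ : ∀ j, (X j).X₃ ⟶ S.X₃)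
    (h₁ : IsColimit (Cofan.mk _ i₁)) (h₂ : IsColimit (Cofan.mk _ i₂))
    (h₃ : IsColimit (Cofan.mk _ i₃))
    (hf : ∀ j, i₁ j ≫ S.f = (X j).f ≫ i₂ j) (hg : ∀ j, i₂ j ≫ S.g = (X j).g ≫ i₃ j) :
    S.ShortExact := by
  classical
  obtain ⟨p₁, a₁, b₁, c₁⟩ := exists_split s hs₁ _ h₁
  obtain ⟨p₂, a₂, b₂, c₂⟩ := exists_split s hs₂ _ h₂
  obtain ⟨p₃, a₃, b₃, c₃⟩ := exists_split s hs₃ _ h₃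
  change ∀ j, i₁ j ≫ p₁ j = 𝟙 _ at a₁
  change ∀ j, i₂ j ≫ p₂ j = 𝟙 _ at a₂
  change ∀ j, i₃ j ≫ p₃ j = 𝟙 _ at a₃
  change ∀ i j, i ≠ j → i₁ i ≫ p₁ j = 0 at b₁
  change ∀ i j, i ≠ j → i₂ i ≫ p₂ j = 0 at b₂
  change ∀ i j, i ≠ j → i₃ i ≫ p₃ j = 0 at b₃
  change ∑ j ∈ s, p₁ j ≫ i₁ j = 𝟙 S.X₁ at c₁
  change ∑ j ∈ s, p₂ j ≫ i₂ j = 𝟙 S.X₂ at c₂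
  change ∑ j ∈ s, p₃ j ≫ i₃ j = 𝟙 S.X₃ at c₃
  have hf' : ∀ j, S.f ≫ p₂ j = p₁ j ≫ (X j).f := fun j => by
    refine Cofan.IsColimit.hom_ext h₁ _ _ (fun i => ?_)
    change i₁ i ≫ _ = i₁ i ≫ _
    rw [reassoc_of% (hf i)]
    by_cases h : i = j
    · subst h
      rw [a₂, reassoc_of% (a₁ i), comp_id]
    · rw [b₂ i j h, reassoc_of% (b₁ i j h), comp_zero, zero_comp]
  have hg' : ∀ j, S.g ≫ p₃ j = p₂ j ≫ (X j).g := fun j => by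
    refine Cofan.IsColimit.hom_ext h₂ _ _ (fun i => ?_)
    change i₂ i ≫ _ = i₂ i ≫ _
    rw [reassoc_of% (hg i)]
    by_cases h : i = j
    · subst h
      rw [a₃, reassoc_of% (a₂ i), comp_id]
    · rw [b₃ i j h, reassoc_of% (b₂ i j h), comp_zero, zero_comp]
  have m : Mono S.f := Preadditive.mono_of_cancel_zero _ (fun g hg => by
    rw [← comp_id g, ← c₁, Preadditive.comp_sum]
    refine Finset.sum_eq_zero (fun j _ => ?_)
    have := (hX j).mono_f
    have h : g ≫ p₁ j = 0 := by
      rw [← cancel_mono (X j).f, assoc, ← hf', reassoc_of% hg, zero_comp, zero_comp]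
    rw [reassoc_of% h, zero_comp])
  have e : Epi S.g := Preadditive.epi_of_cancel_zero _ (fun g hg₀ =>
    Cofan.IsColimit.hom_ext h₃ _ _ (fun j => by
      change i₃ j ≫ _ = i₃ j ≫ _
      have := (hX j).epi_g
      rw [← cancel_epi (X j).g, ← reassoc_of% (hg j), hg₀, comp_zero, comp_zero, comp_zero]))
  refine ShortComplex.ShortExact.mk' (ShortComplex.exact_of_f_is_kernel _ ?_) m e
  refine KernelFork.IsLimit.ofι' _ _ (fun k hk => ?_)
  have hk' : ∀ j, (k ≫ p₂ j) ≫ (X j).g = 0 := fun j => by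
    rw [assoc, ← hg', reassoc_of% hk, zero_comp]
  have := fun j => (hX j).mono_f
  refine ⟨∑ j ∈ s, (hX j).exact.lift _ (hk' j) ≫ i₁ j, ?_⟩
  rw [Preadditive.sum_comp]
  conv_rhs => rw [← comp_id k, ← c₂, Preadditive.comp_sum]
  refine Finset.sum_congr rfl (fun j _ => ?_)
  rw [assoc, hf, (hX j).exact.lift_f_assoc, assoc]

theorem acyclic_of_homotopy (K : CochainComplex A ℤ) (h : Homotopy (𝟙 K) 0) : K.Acyclic := by
  intro n
  rw [HomologicalComplex.exactAt_iff_isZero_homology, IsZero.iff_id_eq_zero,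
    ← HomologicalComplex.homologyMap_id, h.homologyMap_eq, HomologicalComplex.homologyMap_zero]

/-- An acyclic complex concentrated in two consecutive degrees is contractible. -/
theorem contractible (K : CochainComplex A ℤ) (n m : ℤ) (hnm : n + 1 = m) [K.IsStrictlyGE n]
    [K.IsStrictlyLE m] (hK : K.Acyclic) : Nonempty (Homotopy (𝟙 K) 0) := by
  have hm : Mono (K.d n m) :=
    ((K.sc' (n - 1) n m).exact_iff_mono
      ((K.isZero_of_isStrictlyGE n (n - 1)).eq_of_src _ _)).1
      ((K.exactAt_iff' (n - 1) n m (by simp) (by simp [hnm])).1 (hK n))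
  have he : Epi (K.d n m) :=
    ((K.sc' n m (m + 1)).exact_iff_epi
      ((K.isZero_of_isStrictlyLE m (m + 1)).eq_of_tgt _ _)).1
      ((K.exactAt_iff' n m (m + 1) (by simp [← hnm]) (by simp)).1 (hK m))
  have hi : IsIso (K.d n m) := isIso_of_mono_of_epi _
  classical
  let h : ∀ i j, (ComplexShape.up ℤ).Rel j i → (K.X i ⟶ K.X j) := fun i j _ =>
    if hd : j = n ∧ IsIso (K.d j i) then (have := hd.2; inv (K.d j i)) else 0
  have key : 𝟙 K = Homotopy.nullHomotopicMap' h := by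
    ext i
    by_cases h₁ : i = n
    · subst h₁
      rw [Homotopy.nullHomotopicMap'_f (k₂ := i - 1) (k₁ := i) (k₀ := m) (by simp) (by simp [hnm])]
      simp [h, hi]
    · by_cases h₂ : i = m
      · subst h₂
        rw [Homotopy.nullHomotopicMap'_f (k₂ := n) (k₁ := i) (k₀ := i + 1) (by simp [hnm]) (by simp)]
        simp [h, hi, h₁]
      · by_cases h₃ : i < n
        · exact (K.isZero_of_isStrictlyGE n i h₃).eq_of_src _ _
        · exact (K.isZero_of_isStrictlyLE m i (by lia)).eq_of_src _ _
  exact ⟨(Homotopy.ofEq key).trans (Homotopy.nullHomotopy' h)⟩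

theorem isBdd_of {K : CochainComplex A ℤ} (a b : ℤ) [K.IsStrictlyGE a] [K.IsStrictlyLE b] :
    IsBdd K.X :=
  isBdd_X ⟨K, ⟨a, inferInstance⟩, ⟨b, inferInstance⟩⟩

theorem isBdd_shift (K : CochainComplex A ℤ) [IsBdd K.X] (n : ℤ) :
    IsBdd ((shiftFunctor (CochainComplex A ℤ) n).obj K).X := by
  obtain ⟨⟨a, ha⟩, ⟨b, hb⟩⟩ := isBounded_of_isBdd K
  have := K.isStrictlyGE_shift a n (a - n) (by lia)
  have := K.isStrictlyLE_shift b n (b - n) (by lia)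
  exact isBdd_of (a - n) (b - n)

theorem isBdd_mappingCone {K L : CochainComplex A ℤ} [IsBdd K.X] [IsBdd L.X] (f : K ⟶ L) :
    IsBdd (CochainComplex.mappingCone f).X := by
  obtain ⟨⟨a, ha⟩, ⟨b, hb⟩⟩ := isBounded_of_isBdd K
  obtain ⟨⟨a', ha'⟩, ⟨b', hb'⟩⟩ := isBounded_of_isBdd L
  have := CochainComplex.isStrictlyGE_mappingCone f a a' (min (a - 1) a') (by simp) (by simp)
  have := isStrictlyLE_mappingCone A f b b'
  exact isBdd_of (min (a - 1) a') (max b b')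

theorem acyclic_mappingCone {K L : CochainComplex A ℤ} (f : K ⟶ L) [QuasiIso f] :
    (CochainComplex.mappingCone f).Acyclic := by
  have h := (HomotopyCategory.subcategoryAcyclic A).trW_iff_of_distinguished _
    (HomotopyCategory.mappingCone_triangleh_distinguished f)
  rw [← HomotopyCategory.quasiIso_eq_trW_subcategoryAcyclic] at h
  rw [← HomotopyCategory.quotient_obj_mem_subcategoryAcyclic_iff_acyclic]
  refine h.1 ((HomotopyCategory.quotient_map_mem_quasiIso_iff f).2 ?_)
  change QuasiIso f
  infer_instance

variable [MonoidalCategory A] [MonoidalPreadditive A]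

instance hasTensor_complex (K L : CochainComplex A ℤ) [IsBdd K.X] [IsBdd L.X] :
    HomologicalComplex.HasTensor K L := hasTensor K.X L.X

theorem tensorHom_id_comp (K : CochainComplex A ℤ) {L L' L'' : CochainComplex A ℤ} [IsBdd K.X]
    [IsBdd L.X] [IsBdd L'.X] [IsBdd L''.X] (f : L ⟶ L') (g : L' ⟶ L'') :
    HomologicalComplex.tensorHom (𝟙 K) (f ≫ g) =
    HomologicalComplex.tensorHom (𝟙 K) f ≫ HomologicalComplex.tensorHom (𝟙 K) g := by
  ext n i j h
  simp

theorem tensorHom_id_id (K L : CochainComplex A ℤ) [IsBdd K.X] [IsBdd L.X] :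
    HomologicalComplex.tensorHom (𝟙 K) (𝟙 L) = 𝟙 _ := by
  ext n i j h
  simp

/-- The tensor product of a complex with a short complex of complexes. -/
noncomputable abbrev tensorShort (K : CochainComplex A ℤ) [IsBdd K.X]
    (S : ShortComplex (CochainComplex A ℤ)) [IsBdd S.X₁.X] [IsBdd S.X₂.X] [IsBdd S.X₃.X] :
    ShortComplex (CochainComplex A ℤ) where
  f := HomologicalComplex.tensorHom (𝟙 K) S.f
  g := HomologicalComplex.tensorHom (𝟙 K) S.g
  zero := by
    ext n i j h
    have := HomologicalComplex.congr_hom S.zero j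
    simp only [HomologicalComplex.comp_f, HomologicalComplex.zero_f] at this
    simp [← MonoidalCategory.whiskerLeft_comp_assoc, this]

theorem acyclic_tensor_of_homotopy (K L : CochainComplex A ℤ) [IsBdd K.X] [IsBdd L.X]
    (h : Homotopy (𝟙 L) 0) : (HomologicalComplex.tensorObj K L).Acyclic := by
  refine acyclic_of_homotopy _ ((Homotopy.ofEq ?_).trans
    ((HomologicalComplex.mapBifunctorMapHomotopy₂ (𝟙 K) h (curriedTensor A) (.up ℤ)).trans
      (Homotopy.ofEq ?_)))
  · ext n i j hij
    simp
  · ext n i j hij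
    simp

variable [∀ X : A, PreservesFiniteLimits (tensorLeft X)]
  [∀ X : A, PreservesFiniteColimits (tensorLeft X)]

theorem tensorShort_shortExact (K : CochainComplex A ℤ) [IsBdd K.X]
    (S : ShortComplex (CochainComplex A ℤ)) [IsBdd S.X₁.X] [IsBdd S.X₂.X] [IsBdd S.X₃.X]
    (hS : S.ShortExact) : (tensorShort K S).ShortExact := by
  classical
  refine HomologicalComplex.shortExact_of_degreewise_shortExact _ (fun n => ?_)
  obtain ⟨s₁, hs₁⟩ := exists_support₂ K.X S.X₁.X n
  obtain ⟨s₂, hs₂⟩ := exists_support₂ K.X S.X₂.X n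
  obtain ⟨s₃, hs₃⟩ := exists_support₂ K.X S.X₃.X n
  refine shortExact_of_coproduct (J := ((fun (i : ℤ × ℤ) => i.1 + i.2) ⁻¹' {n}))
    (fun i => (S.map (HomologicalComplex.eval A (.up ℤ) i.1.2)).map (tensorLeft (K.X i.1.1)))
    (s₁ ∪ s₂ ∪ s₃) (fun j hj => hs₁ j (by grind)) (fun j hj => hs₂ j (by grind))
    (fun j hj => hs₃ j (by grind))
    (fun j => ((HomologicalComplex.shortExact_iff_degreewise_shortExact S).1 hS _).map_of_exact _)
    _
    (fun i => HomologicalComplex.ιTensorObj K S.X₁ i.1.1 i.1.2 n i.2)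
    (fun i => HomologicalComplex.ιTensorObj K S.X₂ i.1.1 i.1.2 n i.2)
    (fun i => HomologicalComplex.ιTensorObj K S.X₃ i.1.1 i.1.2 n i.2)
    (GradedObject.isColimitCofanMapObj _ _ _) (GradedObject.isColimitCofanMapObj _ _ _)
    (GradedObject.isColimitCofanMapObj _ _ _) (fun i => ?_) (fun i => ?_)
  · exact (HomologicalComplex.ι_mapBifunctorMap ..).trans (by simp; rfl)
  · exact (HomologicalComplex.ι_mapBifunctorMap ..).trans (by simp; rfl)

theorem acyclic_tensor_aux (K : CochainComplex A ℤ) [IsBdd K.X] (a : ℤ) (n : ℕ) :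
    ∀ (L : CochainComplex A ℤ) [L.IsStrictlyGE a] [L.IsStrictlyLE (a + 1 + n)] [IsBdd L.X],
      L.Acyclic → (HomologicalComplex.tensorObj K L).Acyclic := by
  induction n with
  | zero =>
    intro L _ hL _ h
    have : L.IsStrictlyLE (a + 1) := by simpa using hL
    obtain ⟨e⟩ := contractible L a (a + 1) rfl h
    exact acyclic_tensor_of_homotopy K L e
  | succ n ih =>
    intro L _ hL _ h
    let b : ℤ := a + 1 + n
    let S := L.shortComplexTruncLE b
    have hS : S.ShortExact := L.shortComplexTruncLE_shortExact b
    have h₁ : S.X₁.Acyclic := HomologicalComplex.Acyclic.truncLE h _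
    have h₃ : S.X₃.Acyclic := hS.acyclic_X₃ ⟨fun i => by
      rw [quasiIsoAt_iff_exactAt]
      · exact h i
      · exact h₁ i⟩
    have e₁ : S.X₁.IsStrictlyGE a := inferInstanceAs ((L.truncLE b).IsStrictlyGE a)
    have e₂ : S.X₁.IsStrictlyLE b := inferInstanceAs ((L.truncLE b).IsStrictlyLE b)
    have deg := fun i => (HomologicalComplex.shortExact_iff_degreewise_shortExact S).1 hS i
    have e₃ : S.X₃.IsStrictlyLE (b + 1) := by
      rw [CochainComplex.isStrictlyLE_iff]
      intro i hi
      have : Epi (S.g.f i) := (deg i).epi_g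
      exact IsZero.of_epi (S.g.f i) (L.isZero_of_isStrictlyLE (a + 1 + (n + 1 : ℕ)) i
        (by push_cast; lia))
    have e₄ : S.X₃.IsStrictlyGE b := by
      rw [CochainComplex.isStrictlyGE_iff]
      intro i hi
      have : IsIso (S.f.f i) := by
        obtain ⟨k, hk⟩ := Int.le.dest hi.le
        have h₀ : (ComplexShape.embeddingUpIntLE b).f k = i := by
          change b - k = i
          lia
        change IsIso ((L.op.πTruncGE (ComplexShape.embeddingUpIntLE b).op).f i).unop
        have : IsIso ((L.op.πTruncGE (ComplexShape.embeddingUpIntLE b).op).f i) := by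
          unfold HomologicalComplex.πTruncGE
          refine ((ComplexShape.embeddingUpIntLE b).op.isIso_liftExtend_f_iff _ _ h₀).2 ?_
          refine L.op.isIso_restrictionToTruncGE' _ k ?_
          rw [ComplexShape.Embedding.op_boundaryGE_iff,
            ComplexShape.boundaryLE_embeddingUpIntLE_iff]
          lia
        infer_instance
      exact (deg i).isIso_f_iff.1 this
    have := isBdd_of (K := S.X₁) a b
    have := isBdd_of (K := S.X₃) b (b + 1)
    have : IsBdd S.X₂.X := inferInstanceAs (IsBdd L.X)
    obtain ⟨e⟩ := contractible S.X₃ b (b + 1) rfl h₃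
    exact (tensorShort_shortExact K S hS).acyclic_X₂ (ih S.X₁ h₁)
      (acyclic_tensor_of_homotopy K S.X₃ e)

theorem acyclic_tensor (K L : CochainComplex A ℤ) [IsBdd K.X] [hL : IsBdd L.X]
    (h : L.Acyclic) : (HomologicalComplex.tensorObj K L).Acyclic := by
  obtain ⟨⟨a, ha⟩, ⟨b, hb⟩⟩ := isBounded_of_isBdd L
  have := L.isStrictlyLE_of_le b (a + 1 + (b - a).toNat) (by lia)
  exact acyclic_tensor_aux K a (b - a).toNat L h

theorem quasiIso_tensor (K : CochainComplex A ℤ) [IsBdd K.X] {L L' : CochainComplex A ℤ}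
    [IsBdd L.X] [IsBdd L'.X] (f : L ⟶ L') [QuasiIso f] :
    QuasiIso (HomologicalComplex.tensorHom (𝟙 K) f) := by
  let S := CochainComplex.mappingCone.triangleRotateShortComplex (𝟙 L)
  let S' := CochainComplex.mappingCone.triangleRotateShortComplex f
  have e (M M' : CochainComplex A ℤ) (g : M ⟶ M') :
      (CochainComplex.mappingCone.triangleRotateShortComplex g).ShortExact :=
    HomologicalComplex.shortExact_of_degreewise_shortExact _ fun n =>
      (CochainComplex.mappingCone.triangleRotateShortComplexSplitting g n).shortExact
  have : IsBdd S.X₁.X := inferInstanceAs (IsBdd L.X)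
  have : IsBdd S'.X₁.X := inferInstanceAs (IsBdd L'.X)
  have : IsBdd S.X₂.X := isBdd_mappingCone (𝟙 L)
  have : IsBdd S'.X₂.X := isBdd_mappingCone f
  have : IsBdd S.X₃.X := isBdd_shift L 1
  have : IsBdd S'.X₃.X := isBdd_shift L 1
  let φ : S ⟶ S' :=
    { τ₁ := f
      τ₂ := CochainComplex.mappingCone.map (𝟙 L) f (𝟙 L) f rfl
      τ₃ := 𝟙 _
      comm₁₂ := (CochainComplex.mappingCone.triangleMap (𝟙 L) f (𝟙 L) f rfl).comm₂.symm
      comm₂₃ := by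
        have h := (CochainComplex.mappingCone.triangleMap (𝟙 L) f (𝟙 L) f rfl).comm₃
        refine h.symm.trans (congrArg (fun t => S.g ≫ t) ?_)
        exact (shiftFunctor (CochainComplex A ℤ) (1 : ℤ)).map_id L }
  let ψ : tensorShort K S ⟶ tensorShort K S' :=
    { τ₁ := HomologicalComplex.tensorHom (𝟙 K) φ.τ₁
      τ₂ := HomologicalComplex.tensorHom (𝟙 K) φ.τ₂
      τ₃ := HomologicalComplex.tensorHom (𝟙 K) φ.τ₃
      comm₁₂ := (tensorHom_id_comp K _ _).symm.trans
        ((congrArg (fun t => HomologicalComplex.tensorHom (𝟙 K) t) φ.comm₁₂).trans (tensorHom_id_comp K _ _))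
      comm₂₃ := (tensorHom_id_comp K _ _).symm.trans
        ((congrArg (fun t => HomologicalComplex.tensorHom (𝟙 K) t) φ.comm₂₃).trans (tensorHom_id_comp K _ _)) }
  have hψ : IsIso ψ.τ₃ := by
    have := tensorHom_id_id K S.X₃
    have h : ψ.τ₃ = 𝟙 (tensorShort K S).X₃ := this
    exact h ▸ (inferInstance : IsIso (𝟙 (tensorShort K S).X₃))
  have hS := tensorShort_shortExact K S (e _ _ _)
  have hS' := tensorShort_shortExact K S' (e _ _ _)
  have a : (tensorShort K S).X₂.Acyclic := acyclic_tensor K _ (acyclic_mappingCone (𝟙 L))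
  have a' : (tensorShort K S').X₂.Acyclic := acyclic_tensor K _ (acyclic_mappingCone f)
  refine ⟨fun n => ?_⟩
  rw [quasiIsoAt_iff_isIso_homologyMap]
  have i₁ := hS.isIso_δ (n - 1) n (by simp) (a _).isZero_homology (a _).isZero_homology
  have i₂ := hS'.isIso_δ (n - 1) n (by simp) (a' _).isZero_homology (a' _).isZero_homology
  have nat := HomologicalComplex.HomologySequence.δ_naturality ψ hS hS' (n - 1) n (by simp)
  have : IsIso (HomologicalComplex.homologyMap ψ.τ₃ (n - 1)) :=
    ((HomologicalComplex.homologyFunctor A (.up ℤ) (n - 1)).mapIso (asIso ψ.τ₃)).isIso_hom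
  have h := IsIso.comp_isIso' this i₂
  rw [← nat] at h
  exact IsIso.of_isIso_comp_left (hS.δ (n - 1) n _) (HomologicalComplex.homologyMap ψ.τ₁ n)

end

section
variable (A : Type u) [Category.{v} A] [Abelian A] [MonoidalCategory A] [MonoidalPreadditive A]
  [SymmetricCategory A]
  [∀ X : A, PreservesFiniteLimits (tensorLeft X)]
  [∀ X : A, PreservesFiniteColimits (tensorLeft X)]

instance : (quasiIso A).IsMultiplicative := by
  dsimp only [quasiIso]
  infer_instance

theorem quasiIso_whiskerLeft (X : BoundedComplex A) {Y Z : BoundedComplex A} (g : Y ⟶ Z)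
    (hg : quasiIso A g) : quasiIso A (X ◁ g) := by
  have : QuasiIso g.hom := hg
  exact quasiIso_tensor X.obj g.hom

instance : (quasiIso A).RespectsIso := by
  dsimp only [quasiIso]
  infer_instance

instance : (quasiIso A).IsMonoidal where
  whiskerLeft X _ _ g hg := quasiIso_whiskerLeft A X g hg
  whiskerRight {X Y} f hf Z :=
    (MorphismProperty.arrow_mk_iso_iff _ (Arrow.isoMk (β_ X Z) (β_ Y Z)
      (BraidedCategory.braiding_naturality_left f Z).symm)).2 (quasiIso_whiskerLeft A Z f hf)

variable [HasDerivedCategory.{w} A]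

/-- The derived tensor product on the bounded derived category. As the tensor product is exact, it
is the one for which the localization functor `Qb A` from bounded complexes is monoidal. -/
noncomputable instance : MonoidalCategory (DerivedCategory.Bounded A) :=
  inferInstanceAs (MonoidalCategory (LocalizedMonoidal (Qb A) (quasiIso A) (Iso.refl _)))

/-- The symmetry constraint for which `Qb A` is braided. -/
noncomputable instance : SymmetricCategory (DerivedCategory.Bounded A) :=
  inferInstanceAs (SymmetricCategory (LocalizedMonoidal (Qb A) (quasiIso A) (Iso.refl _)))

noncomputable instance : (Qb A).Monoidal :=
  inferInstanceAs ((Localization.Monoidal.toMonoidalCategory (Qb A) (quasiIso A) (Iso.refl _)).Monoidal)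

noncomputable instance : (Qb A).Braided :=
  inferInstanceAs ((Localization.Monoidal.toMonoidalCategory (Qb A) (quasiIso A) (Iso.refl _)).Braided)

end

section
variable {C : Type u} [Category.{v} C] [MonoidalCategory C]

/-- The tensor powers of an object. -/
def tensorPow (X : C) : ℕ → C
  | 0 => 𝟙_ C
  | n + 1 => tensorPow X n ⊗ X

variable [SymmetricCategory C] (X : C)

/-- The exchange of the last two factors of `Y ⊗ X ⊗ X`. -/
def lastSwap (Y : C) : (Y ⊗ X) ⊗ X ⟶ (Y ⊗ X) ⊗ X :=
  (α_ Y X X).hom ≫ Y ◁ (β_ X X).hom ≫ (α_ Y X X).inv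

theorem lastSwap_lastSwap (Y : C) : lastSwap X Y ≫ lastSwap X Y = 𝟙 _ := by
  simp [lastSwap, ← MonoidalCategory.whiskerLeft_comp_assoc]

theorem lastSwap_naturality {Y Z : C} (f : Y ⟶ Z) :
    f ▷ X ▷ X ≫ lastSwap X Z = lastSwap X Y ≫ f ▷ X ▷ X := by
  rw [lastSwap, lastSwap, associator_naturality_left_assoc, ← whisker_exchange_assoc,
    associator_inv_naturality_left, assoc, assoc]

theorem lastSwap_braid (Y : C) :
    lastSwap X (Y ⊗ X) ≫ lastSwap X Y ▷ X ≫ lastSwap X (Y ⊗ X) =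
      lastSwap X Y ▷ X ≫ lastSwap X (Y ⊗ X) ≫ lastSwap X Y ▷ X := by
  have h := congrArg (fun t : X ⊗ X ⊗ X ⟶ X ⊗ X ⊗ X => (α_ (Y ⊗ X) X X).hom ≫
    (α_ Y X (X ⊗ X)).hom ≫ Y ◁ t ≫ (α_ Y X (X ⊗ X)).inv ≫ (α_ (Y ⊗ X) X X).inv)
    (BraidedCategory.yang_baxter X X X)
  refine Eq.trans ?_ (h.symm.trans ?_)
  · simp only [lastSwap]; monoidal
  · simp only [lastSwap]; monoidal

theorem lastSwap_aux {Y : C} (a : Y ⟶ Y) (c d : Y ⊗ X ⟶ Y ⊗ X) (h : c ≫ d = a ▷ X ≫ c) :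
    (lastSwap X Y ≫ c ▷ X) ≫ d ▷ X = a ▷ X ▷ X ≫ lastSwap X Y ≫ c ▷ X := by
  rw [← assoc (a ▷ X ▷ X), lastSwap_naturality, assoc, assoc, ← comp_whiskerRight, h,
    comp_whiskerRight]

theorem lastSwap_aux' {Y : C} (c : Y ⊗ X ⟶ Y ⊗ X) :
    (lastSwap X (Y ⊗ X) ≫ (lastSwap X Y ≫ c ▷ X) ▷ X) ≫ lastSwap X (Y ⊗ X) =
      lastSwap X Y ▷ X ≫ lastSwap X (Y ⊗ X) ≫ (lastSwap X Y ≫ c ▷ X) ▷ X := by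
  have b := lastSwap_braid X Y
  have n := lastSwap_naturality X c
  simp only [comp_whiskerRight, assoc, n]
  simp only [← assoc] at b ⊢
  rw [b]

/-- The exchange of the factors `i` and `i + 1`. -/
def adjSwap : ∀ {n : ℕ}, Fin n → (tensorPow X (n + 1) ⟶ tensorPow X (n + 1))
  | m + 1, i => Fin.lastCases (motive := fun _ => tensorPow X (m + 2) ⟶ tensorPow X (m + 2))
      (lastSwap X (tensorPow X m)) (fun j => adjSwap j ▷ X) i

/-- Moves the last factor to the position `p`. -/
def insertLast : ∀ {n : ℕ}, Fin (n + 1) → (tensorPow X (n + 1) ⟶ tensorPow X (n + 1))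
  | 0, _ => 𝟙 _
  | m + 1, p => Fin.lastCases (motive := fun _ => tensorPow X (m + 2) ⟶ tensorPow X (m + 2))
      (𝟙 _) (fun j => lastSwap X (tensorPow X m) ≫ insertLast j ▷ X) p

theorem adjSwap_last (m : ℕ) : adjSwap X (Fin.last m) = lastSwap X (tensorPow X m) := by
  exact Fin.lastCases_last ..

theorem adjSwap_castSucc {m : ℕ} (j : Fin m) : adjSwap X j.castSucc = adjSwap X j ▷ X := by
  exact Fin.lastCases_castSucc ..

theorem insertLast_last : ∀ m : ℕ, insertLast X (Fin.last m) = 𝟙 _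
  | 0 => rfl
  | m + 1 => by exact Fin.lastCases_last ..

theorem insertLast_castSucc {m : ℕ} (j : Fin (m + 1)) :
    insertLast X j.castSucc = lastSwap X (tensorPow X m) ≫ insertLast X j ▷ X := by
  exact Fin.lastCases_castSucc ..

theorem adjSwap_adjSwap : ∀ {n : ℕ} (i : Fin n), adjSwap X i ≫ adjSwap X i = 𝟙 _
  | m + 1, i => by
    cases i using Fin.lastCases with
    | last => rw [adjSwap_last]; exact lastSwap_lastSwap X _
    | cast j =>
      rw [adjSwap_castSucc]
      exact (comp_whiskerRight _ _ _).symm.trans (by rw [adjSwap_adjSwap, id_whiskerRight]; rfl)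

theorem insertLast_succ : ∀ {n : ℕ} (i : Fin n),
    insertLast X i.castSucc ≫ adjSwap X i = insertLast X i.succ
  | m + 1, i => by
    cases i using Fin.lastCases with
    | last =>
      rw [adjSwap_last, insertLast_castSucc, Fin.succ_last, insertLast_last, insertLast_last]
      exact (congrArg (· ≫ _) ((congrArg _ (id_whiskerRight _ _)).trans (comp_id _))).trans
        (lastSwap_lastSwap X _)
    | cast j =>
      rw [adjSwap_castSucc, insertLast_castSucc, Fin.succ_castSucc, insertLast_castSucc,
        ← insertLast_succ j]
      exact (assoc _ _ _).trans (congrArg _ (comp_whiskerRight _ _ _).symm)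

theorem insertLast_comm_of_lt : ∀ {m : ℕ} (j : Fin m) (p : Fin (m + 2)) (_ : j.val + 1 < p.val),
    insertLast X p ≫ adjSwap X j.castSucc = adjSwap X j ▷ X ≫ insertLast X p
  | k + 1, j, p, h => by
    rw [adjSwap_castSucc]
    cases p using Fin.lastCases with
    | last => rw [insertLast_last]; exact (id_comp _).trans (comp_id _).symm
    | cast p =>
      cases j using Fin.lastCases with
      | last => exact absurd p.2 (by simp at h; lia)
      | cast j =>
        have ih := insertLast_comm_of_lt j p (by simpa using h)
        rw [insertLast_castSucc, adjSwap_castSucc]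
        rw [adjSwap_castSucc] at ih
        exact lastSwap_aux X _ _ _ ih

theorem insertLast_comm_of_le : ∀ {m : ℕ} (j : Fin m) (p : Fin (m + 2)) (_ : p.val ≤ j.val),
    insertLast X p ≫ adjSwap X j.succ = adjSwap X j ▷ X ≫ insertLast X p
  | k + 1, j, p, h => by
    cases p using Fin.lastCases with
    | last => exact absurd j.2 (by simp at h; lia)
    | cast p =>
      cases j using Fin.lastCases with
      | last =>
        cases p using Fin.lastCases with
        | last => exact absurd h (by simp)
        | cast p =>
          rw [Fin.succ_last, adjSwap_last, adjSwap_last, insertLast_castSucc, insertLast_castSucc]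
          exact lastSwap_aux' X _
      | cast j =>
        have ih := insertLast_comm_of_le j p (by simpa using h)
        rw [Fin.succ_castSucc, adjSwap_castSucc, adjSwap_castSucc, insertLast_castSucc]
        exact lastSwap_aux X _ _ _ ih

end

section

/-- The permutation which sends the last element to `p` and is given by `τ` on the others,
the complement of `p` being identified with `Fin n` in increasing order. -/
def consPerm {n : ℕ} (p : Fin (n + 1)) (τ : Equiv.Perm (Fin n)) : Equiv.Perm (Fin (n + 1)) :=
  (finSuccEquiv' (Fin.last n)).trans ((Equiv.optionCongr τ).trans (finSuccEquiv' p).symm)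

theorem consPerm_last {n : ℕ} (p : Fin (n + 1)) (τ : Equiv.Perm (Fin n)) :
    consPerm p τ (Fin.last n) = p := by
  simp [consPerm]

theorem consPerm_castSucc {n : ℕ} (p : Fin (n + 1)) (τ : Equiv.Perm (Fin n)) (j : Fin n) :
    consPerm p τ j.castSucc = p.succAbove (τ j) := by
  have h : finSuccEquiv' (Fin.last n) j.castSucc = some j := by
    rw [← Fin.succAbove_last, finSuccEquiv'_succAbove]
  simp [consPerm, h]

theorem consPerm_bijective (n : ℕ) :
    Function.Bijective (fun x : Fin (n + 1) × Equiv.Perm (Fin n) => consPerm x.1 x.2) := by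
  rw [Fintype.bijective_iff_injective_and_card]
  refine ⟨fun ⟨p, τ⟩ ⟨q, τ'⟩ h => ?_, by simp [Fintype.card_perm, Nat.factorial_succ]⟩
  change consPerm p τ = consPerm q τ' at h
  obtain rfl : p = q := by rw [← consPerm_last p τ, h, consPerm_last]
  congr 1
  ext j : 1
  exact Fin.succAbove_right_injective (p := p)
    (by rw [← consPerm_castSucc, h, consPerm_castSucc])

/-- The decomposition of permutations of `n + 1` elements along the image of the last one. -/
noncomputable def consPermEquiv (n : ℕ) :
    Fin (n + 1) × Equiv.Perm (Fin n) ≃ Equiv.Perm (Fin (n + 1)) :=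
  Equiv.ofBijective _ (consPerm_bijective n)

theorem consPerm_inj {n : ℕ} (σ : Equiv.Perm (Fin (n + 1))) (p : Fin (n + 1)) (τ : Equiv.Perm (Fin n))
    (h₁ : σ (Fin.last n) = p) (h₂ : ∀ j, σ j.castSucc = p.succAbove (τ j)) :
    (consPermEquiv n).symm σ = (p, τ) := by
  rw [Equiv.symm_apply_eq]
  ext x : 1
  cases x using Fin.lastCases with
  | last => exact h₁.trans (consPerm_last p τ).symm
  | cast j => exact (h₂ j).trans (consPerm_castSucc p τ j).symm

theorem swap_succAbove_castSucc {n : ℕ} (i k : Fin n) :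
    Equiv.swap i.castSucc i.succ (i.castSucc.succAbove k) = i.succ.succAbove k := by
  grind [Fin.succAbove]

theorem swap_succAbove_succ {n : ℕ} (i k : Fin n) :
    Equiv.swap i.castSucc i.succ (i.succ.succAbove k) = i.castSucc.succAbove k := by
  grind [Fin.succAbove]

theorem swap_succAbove_of_lt {n : ℕ} (p : Fin (n + 2)) (i : Fin n) (h : i.val + 1 < p.val)
    (k : Fin (n + 1)) : Equiv.swap i.castSucc.castSucc i.castSucc.succ (p.succAbove k) =
      p.succAbove (Equiv.swap i.castSucc i.succ k) := by
  grind [Fin.succAbove]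

theorem swap_succAbove_of_le {n : ℕ} (p : Fin (n + 2)) (i : Fin n) (h : p.val ≤ i.val)
    (k : Fin (n + 1)) : Equiv.swap i.succ.castSucc i.succ.succ (p.succAbove k) =
      p.succAbove (Equiv.swap i.castSucc i.succ k) := by
  grind [Fin.succAbove]

variable {C : Type u} [Category.{v} C] [MonoidalCategory C] [SymmetricCategory C] (X : C)

/-- The action of permutations on the tensor powers: `permHom X σ` moves the factor `j` to
the position `σ j`. -/
noncomputable def permHom : ∀ (n : ℕ), Equiv.Perm (Fin n) → (tensorPow X n ⟶ tensorPow X n)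
  | 0, _ => 𝟙 _
  | n + 1, σ => permHom n ((consPermEquiv n).symm σ).2 ▷ X ≫
      insertLast X ((consPermEquiv n).symm σ).1

theorem permHom_cons {n : ℕ} (σ : Equiv.Perm (Fin (n + 1))) (p : Fin (n + 1))
    (τ : Equiv.Perm (Fin n))
    (h₁ : σ (Fin.last n) = p) (h₂ : ∀ j, σ j.castSucc = p.succAbove (τ j)) :
    permHom X (n + 1) σ = permHom X n τ ▷ X ≫ insertLast X p := by
  simp only [permHom, consPerm_inj σ p τ h₁ h₂]
  rfl

theorem permHom_one : ∀ n : ℕ, permHom X n 1 = 𝟙 _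
  | 0 => rfl
  | n + 1 => by
    rw [permHom_cons X 1 (Fin.last n) 1 rfl (fun j => by simp), permHom_one, insertLast_last,
      id_whiskerRight]
    exact id_comp _

theorem insertLast_succ' {n : ℕ} (i : Fin n) :
    insertLast X i.succ ≫ adjSwap X i = insertLast X i.castSucc := by
  rw [← insertLast_succ, assoc, adjSwap_adjSwap, comp_id]

theorem permHom_adj : ∀ (n : ℕ) (σ : Equiv.Perm (Fin (n + 1))) (i : Fin n),
    permHom X (n + 1) (Equiv.swap i.castSucc i.succ * σ) = permHom X (n + 1) σ ≫ adjSwap X i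
  | m + 1, σ, i => by
    obtain ⟨⟨p, τ⟩, rfl⟩ := (consPermEquiv (m + 1)).surjective σ
    change permHom X _ (_ * consPerm p τ) = permHom X _ (consPerm p τ) ≫ _
    have hl := consPerm_last p τ
    have hc := consPerm_castSucc p τ
    rw [permHom_cons X (consPerm p τ) p τ hl hc]
    generalize consPerm p τ = σ at hl hc
    refine Eq.trans ?_ (assoc (permHom X (m + 1) τ ▷ X) (insertLast X p) (adjSwap X i)).symm
    by_cases h₁ : p = i.castSucc
    · rw [permHom_cons X _ i.succ τ (by simp [hl, h₁]) (fun j => by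
        rw [Equiv.Perm.mul_apply, hc, h₁]
        exact swap_succAbove_castSucc i (τ j)), h₁]
      exact congrArg (fun t => permHom X (m + 1) τ ▷ X ≫ t) (insertLast_succ X i).symm
    · by_cases h₂ : p = i.succ
      · rw [permHom_cons X _ i.castSucc τ (by simp [hl, h₂]) (fun j => by
          rw [Equiv.Perm.mul_apply, hc, h₂]
          exact swap_succAbove_succ i (τ j)), h₂]
        exact congrArg (fun t => permHom X (m + 1) τ ▷ X ≫ t) (insertLast_succ' X i).symm
      · have h₃ : Equiv.swap i.castSucc i.succ p = p := Equiv.swap_apply_of_ne_of_ne h₁ h₂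
        by_cases h : i.val + 1 < p.val
        · cases i using Fin.lastCases with
          | last => exact absurd p.2 (by simp at h; lia)
          | cast i =>
            rw [permHom_cons X _ p (Equiv.swap i.castSucc i.succ * τ)
              (by rw [Equiv.Perm.mul_apply, hl, h₃]) (fun j => by
              rw [Equiv.Perm.mul_apply, hc, Equiv.Perm.mul_apply]
              exact swap_succAbove_of_lt p i (by simpa using h) (τ j)), permHom_adj]
            exact (congrArg (· ≫ _) (comp_whiskerRight _ _ _)).trans ((assoc _ _ _).trans
              (congrArg (fun t => permHom X (m + 1) τ ▷ X ≫ t)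
                (insertLast_comm_of_lt X i p (by simpa using h)).symm))
        · cases i using Fin.cases with
          | zero => exact absurd h (by grind)
          | succ i =>
            have h' : p.val ≤ i.val := by grind
            rw [permHom_cons X _ p (Equiv.swap i.castSucc i.succ * τ)
              (by rw [Equiv.Perm.mul_apply, hl, h₃]) (fun j => by
              rw [Equiv.Perm.mul_apply, hc, Equiv.Perm.mul_apply]
              exact swap_succAbove_of_le p i h' (τ j)), permHom_adj]
            exact (congrArg (· ≫ _) (comp_whiskerRight _ _ _)).trans ((assoc _ _ _).trans
              (congrArg (fun t => permHom X (m + 1) τ ▷ X ≫ t)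
                (insertLast_comm_of_le X i p h').symm))

theorem permHom_mul (n : ℕ) (σ τ : Equiv.Perm (Fin n)) :
    permHom X n (τ * σ) = permHom X n σ ≫ permHom X n τ := by
  cases n with
  | zero => exact (id_comp _).symm
  | succ n =>
    have h : τ ∈ Submonoid.closure
        (Set.range fun i : Fin n => Equiv.swap i.castSucc i.succ) := by
      rw [Equiv.Perm.mclosure_swap_castSucc_succ]
      trivial
    induction h using Submonoid.closure_induction_left generalizing σ with
    | one => rw [one_mul, permHom_one, comp_id]
    | mul_left s hs τ _ ih =>
      obtain ⟨i, rfl⟩ := hs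
      rw [mul_assoc, permHom_adj, ih, permHom_adj, assoc]

/-- The permutation which exchanges `i` and `i + 1` acts through the symmetry constraint. -/
theorem permHom_swap (n : ℕ) (i : Fin n) :
    permHom X (n + 1) (Equiv.swap i.castSucc i.succ) = adjSwap X i := by
  have h := permHom_adj X n 1 i
  rwa [mul_one, permHom_one, id_comp] at h

end

section
variable {C : Type u} [Category.{v} C] [Preadditive C] [Linear ℚ C] [MonoidalCategory C]
  [SymmetricCategory C]

/-- The projector `(1 / n!) ∑ σ` on the `n`-th tensor power. -/
noncomputable def symmetrizer (X : C) (n : ℕ) : tensorPow X n ⟶ tensorPow X n :=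
  ((n.factorial : ℚ)⁻¹) • ∑ σ : Equiv.Perm (Fin n), permHom X n σ

/-- The `n`-th symmetric power of `X`: an image of the projector `symmetrizer X n`, with its
inclusion `ι` into, and its projection `π` from, the tensor power. -/
structure SymPower (X : C) (n : ℕ) where
  obj : C
  ι : obj ⟶ tensorPow X n
  π : tensorPow X n ⟶ obj
  ι_π : ι ≫ π = 𝟙 obj
  π_ι : π ≫ ι = symmetrizer X n

/-- The `n`-th symmetric power of `X` exists and is zero. -/
def SymVanishes (X : C) (n : ℕ) : Prop := ∃ a : SymPower X n, IsZero a.obj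

/-- The functoriality of tensor powers. -/
def tensorPowMap {X Y : C} (f : X ⟶ Y) : ∀ n : ℕ, tensorPow X n ⟶ tensorPow Y n
  | 0 => 𝟙 _
  | n + 1 => tensorPowMap f n ⊗ₘ f

/-- The functoriality of symmetric powers. -/
def symMap {X Y : C} (f : X ⟶ Y) {n : ℕ} (a : SymPower X n) (b : SymPower Y n) :
    a.obj ⟶ b.obj :=
  a.ι ≫ tensorPowMap f n ≫ b.π

/-- The component of bidegree `(n, 1)` of the comultiplication of the symmetric coalgebra:
the factorization of the inclusion of `Sym ^ (n + 1)` into the tensor power through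
`Sym ^ n ⊗ X`, see `comult_ι`. -/
def comult {X : C} {n : ℕ} (a : SymPower X (n + 1)) (b : SymPower X n) :
    a.obj ⟶ b.obj ⊗ X :=
  a.ι ≫ b.π ▷ X

/-- The cup product with a morphism `c`, on `Sym ^ (n + 1)`. -/
def cup {X : C} {n : ℕ} (a : SymPower X (n + 1)) (b : SymPower X n) {K : C} (c : X ⟶ K) :
    a.obj ⟶ b.obj ⊗ K :=
  comult a b ≫ b.obj ◁ c

theorem symmetrizer_comp (X : C) (n : ℕ) (τ : Equiv.Perm (Fin n)) :
    symmetrizer X n ≫ permHom X n τ = symmetrizer X n := by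
  rw [symmetrizer, Linear.smul_comp, Preadditive.sum_comp]
  congr 1
  simp only [← permHom_mul]
  exact Fintype.sum_equiv (Equiv.mulLeft τ) _ _ (fun _ => rfl)

variable [MonoidalPreadditive C] [MonoidalLinear ℚ C]

theorem comp_symmetrizer_whiskerRight {X Y Z : C} {n : ℕ} (f : Z ⟶ tensorPow X n ⊗ Y)
    (h : ∀ τ : Equiv.Perm (Fin n), f ≫ permHom X n τ ▷ Y = f) :
    f ≫ symmetrizer X n ▷ Y = f := by
  have h' : (∑ σ : Equiv.Perm (Fin n), permHom X n σ) ▷ Y = ∑ σ, permHom X n σ ▷ Y :=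
    (tensorRight Y).map_sum _ _
  rw [symmetrizer, MonoidalLinear.smul_whiskerRight, Linear.comp_smul, h', Preadditive.comp_sum,
    Finset.sum_congr rfl fun σ _ => h σ, Finset.sum_const, Finset.card_univ, Fintype.card_perm,
    Fintype.card_fin, ← Nat.cast_smul_eq_nsmul ℚ, smul_smul,
    inv_mul_cancel₀ (Nat.cast_ne_zero.2 n.factorial_ne_zero), one_smul]

theorem comult_ι {X : C} {n : ℕ} (a : SymPower X (n + 1)) (b : SymPower X n) :
    comult a b ≫ b.ι ▷ X = a.ι := by
  refine ((assoc _ _ _).trans (congrArg (fun t : tensorPow X n ⊗ X ⟶ tensorPow X n ⊗ X =>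
    a.ι ≫ t) ?_)).trans (comp_symmetrizer_whiskerRight a.ι fun τ => ?_)
  · rw [← b.π_ι]
    exact (comp_whiskerRight _ _ _).symm
  · have h₁ := permHom_cons X (consPerm (Fin.last n) τ) _ τ (consPerm_last _ _)
      (consPerm_castSucc _ _)
    rw [insertLast_last] at h₁
    have h₂ : permHom X (n + 1) (consPerm (Fin.last n) τ) = permHom X n τ ▷ X :=
      h₁.trans (comp_id _)
    have h₃ := congrArg (fun t => a.ι ≫ t) (symmetrizer_comp X (n + 1) (consPerm (Fin.last n) τ))
    simp only [← a.π_ι, ← assoc, a.ι_π, id_comp] at h₃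
    rwa [h₂] at h₃
end

section
variable (A : Type u) [Category.{v} A] [Abelian A] [HasDerivedCategory.{w} A]

open DerivedCategory DerivedCategory.TStructure

/-- Objects of `A` as complexes in degree `0`, in the bounded derived category. -/
noncomputable def single : A ⥤ Bounded A :=
  t.bounded.lift (singleFunctor A 0) fun X =>
    ⟨⟨0, (inferInstance : ((singleFunctor A 0).obj X).IsGE 0)⟩,
      ⟨0, (inferInstance : ((singleFunctor A 0).obj X).IsLE 0)⟩⟩

variable {A}

/-- The class `W ⟶ U⟦1⟧` of an extension `0 ⟶ U ⟶ V ⟶ W ⟶ 0`, in the bounded derived category. -/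
noncomputable def extClass {S : ShortComplex A} (hS : S.ShortExact) :
    (single A).obj S.X₃ ⟶ ((single A).obj S.X₁)⟦(1 : ℤ)⟧ :=
  Bounded.ι.preimage (hS.singleδ ≫
    (((Bounded.ι (C := A)).commShiftIso (1 : ℤ)).inv.app ((single A).obj S.X₁) :
      ((singleFunctor A 0).obj S.X₁)⟦(1 : ℤ)⟧ ⟶ _))

variable {T : Type*} [Category T] [HasShift T ℤ] (q : Bounded A ⥤ T) [q.CommShift ℤ]

/-- The image under `q` of the class of an extension. -/
noncomputable def imageExtClass {S : ShortComplex A} (hS : S.ShortExact) :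
    q.obj ((single A).obj S.X₃) ⟶ (q.obj ((single A).obj S.X₁))⟦(1 : ℤ)⟧ :=
  q.map (extClass hS) ≫ (q.commShiftIso (1 : ℤ)).hom.app _

end

end TensorDerived

open TensorDerived Pretriangulated DerivedCategory

universe w v v' u u'

/-!
Let `0 ⟶ U ⟶ V ⟶ W ⟶ 0` be a short exact sequence in `A`, write `K` for the kernel of the
epimorphism `Sym ^ (n + 1) V ⟶ Sym ^ (n + 1) W`, and let `F` be the composition of
`A ⥤ Dᵇ(A)` with `q`. Since `F` is additive and symmetric monoidal, symmetric powers of `F X` are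
images of symmetric powers of `X`, which exist because `A` is idempotent complete; and
`F K ⟶ F (Sym ^ (n + 1) V) ⟶ F (Sym ^ (n + 1) W) ⟶ (F K)⟦1⟧` is a distinguished triangle. What has
to be shown is that `F K` is `F (Sym ^ n W ⊗ U)`, compatibly with the cup product.

The comultiplication followed by `V ⟶ W` on all the factors but the last gives a morphism of short
exact sequences (`symΦ`) from `0 ⟶ K ⟶ Sym ^ (n + 1) V ⟶ Sym ^ (n + 1) W ⟶ 0` to `Sym ^ n W`
tensored with `0 ⟶ U ⟶ V ⟶ W ⟶ 0`, and hence a morphism `symφ : K ⟶ Sym ^ n W ⊗ U`. It is an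
epimorphism (`epi_symφ`): composed with the multiplication `Sym ^ n V ⊗ U ⟶ K` it is, up to a
nonzero rational factor, the epimorphism `Sym ^ n V ⊗ U ⟶ Sym ^ n W ⊗ U`. Its kernel is killed by
`F` (`isZero_map_symKer`), by induction on `n`. Indeed, the kernel in degree `n + 2` is a retract of
an object `symPB` (`exists_retract`), which `F` identifies with `F ((Sym ^ n W ⊗ U) ⊗ U)` by the
induction hypothesis, and the inclusion becomes invariant under the exchange of the two factors `U`.
But this exchange acts as `-1` after `F`, because `Sym ^ 2 (F U) = 0` (`SymVanishes.lastSwap_eq`);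
the inclusion is thus zero after `F`.

So `F (symφ)` is invertible, and the triangle of `K`, rotated, becomes the required one. Its middle
morphism is the cup product by naturality of extension classes along `symΦ`, together with the
fact that the extension class of `R ⊗ S` is the tensor product of `R` with the extension class of
`S` (`whiskerLeft_extClass`). The latter holds because the derived tensor product with an object `R`
in degree `0` is induced by the exact functor `R ⊗ -` (`tensorSingle`). Every step is natural in
the short exact sequence, which makes the third morphisms natural.

What the argument uses about `F` is collected in the structure `TensorConnection`.
-/

set_option linter.unusedSectionVars false

namespace TensorDerived

/-! ### Functoriality of symmetric powers -/

section
variable {C : Type u} [Category.{v} C] [MonoidalCategory C]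

theorem tensorPowMap_id (X : C) : ∀ n : ℕ, tensorPowMap (𝟙 X) n = 𝟙 _
  | 0 => rfl
  | n + 1 => by
    rw [tensorPowMap, tensorPowMap_id X n]
    exact id_tensorHom_id _ _

theorem tensorPowMap_comp {X Y Z : C} (f : X ⟶ Y) (g : Y ⟶ Z) :
    ∀ n : ℕ, tensorPowMap (f ≫ g) n = tensorPowMap f n ≫ tensorPowMap g n
  | 0 => (id_comp _).symm
  | n + 1 => by
    rw [tensorPowMap, tensorPowMap_comp f g n]
    exact (tensorHom_comp_tensorHom _ _ _ _).symm

variable [SymmetricCategory C]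

/-- The exchange of the last two factors is natural in these factors and in the remaining one. -/
theorem tensorHom_lastSwap {X X' Y Y' : C} (f : X ⟶ X') (k : Y ⟶ Y') :
    ((k ⊗ₘ f) ⊗ₘ f) ≫ lastSwap X' Y' = lastSwap X Y ≫ ((k ⊗ₘ f) ⊗ₘ f) := by
  simp only [lastSwap, assoc, associator_naturality_assoc, ← associator_inv_naturality]
  rw [← id_tensorHom, ← id_tensorHom, tensorHom_comp_tensorHom_assoc,
    tensorHom_comp_tensorHom_assoc, comp_id, id_comp, BraidedCategory.braiding_naturality]

theorem tensorPowMap_insertLast {X Y : C} (f : X ⟶ Y) : ∀ {n : ℕ} (p : Fin (n + 1)),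
    tensorPowMap f (n + 1) ≫ insertLast Y p = insertLast X p ≫ tensorPowMap f (n + 1)
  | 0, p => (comp_id _).trans (id_comp _).symm
  | n + 1, p => by
    cases p using Fin.lastCases with
    | last => rw [insertLast_last, insertLast_last]; exact (comp_id _).trans (id_comp _).symm
    | cast j =>
      rw [insertLast_castSucc, insertLast_castSucc]
      have h₁ := tensorHom_lastSwap f (tensorPowMap f n)
      have h₂ : (tensorPowMap f (n + 1) ⊗ₘ f) ≫ insertLast Y j ▷ Y =
          insertLast X j ▷ X ≫ (tensorPowMap f (n + 1) ⊗ₘ f) := by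
        rw [← tensorHom_id, ← tensorHom_id, tensorHom_comp_tensorHom, tensorHom_comp_tensorHom,
          tensorPowMap_insertLast f j, id_comp, comp_id]
      exact (assoc _ _ _).symm.trans ((congrArg (· ≫ _) h₁).trans ((assoc _ _ _).trans
        ((congrArg (lastSwap X (tensorPow X n) ≫ ·) h₂).trans (assoc _ _ _).symm)))

theorem tensorPowMap_permHom {X Y : C} (f : X ⟶ Y) : ∀ {n : ℕ} (σ : Equiv.Perm (Fin n)),
    tensorPowMap f n ≫ permHom Y n σ = permHom X n σ ≫ tensorPowMap f n
  | 0, _ => (comp_id _).trans (id_comp _).symm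
  | n + 1, σ => by
    have h : ∀ τ : Equiv.Perm (Fin n), (tensorPowMap f n ⊗ₘ f) ≫ permHom Y n τ ▷ Y =
        permHom X n τ ▷ X ≫ (tensorPowMap f n ⊗ₘ f) := fun τ => by
      rw [← tensorHom_id, ← tensorHom_id, tensorHom_comp_tensorHom, tensorHom_comp_tensorHom,
        tensorPowMap_permHom f τ, id_comp, comp_id]
    refine (assoc _ _ _).symm.trans ((congrArg (· ≫ _) (h _)).trans ((assoc _ _ _).trans
      ((congrArg (_ ≫ ·) (tensorPowMap_insertLast f _)).trans (assoc _ _ _).symm)))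

end

section
variable {C : Type u} [Category.{v} C] [Preadditive C] [Linear ℚ C] [MonoidalCategory C]
  [SymmetricCategory C]

theorem tensorPowMap_symmetrizer {X Y : C} (f : X ⟶ Y) (n : ℕ) :
    tensorPowMap f n ≫ symmetrizer Y n = symmetrizer X n ≫ tensorPowMap f n := by
  simp only [symmetrizer, Linear.smul_comp, Linear.comp_smul, Preadditive.sum_comp,
    Preadditive.comp_sum, tensorPowMap_permHom]

theorem symmetrizer_idem (X : C) (n : ℕ) :
    symmetrizer X n ≫ symmetrizer X n = symmetrizer X n := by
  conv_lhs => enter [2]; rw [symmetrizer]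
  rw [Linear.comp_smul, Preadditive.comp_sum, Finset.sum_congr rfl
    fun σ _ => symmetrizer_comp X n σ, Finset.sum_const, Finset.card_univ, Fintype.card_perm,
    Fintype.card_fin, ← Nat.cast_smul_eq_nsmul ℚ, smul_smul,
    inv_mul_cancel₀ (Nat.cast_ne_zero.2 n.factorial_ne_zero), one_smul]

theorem SymPower.nonempty [IsIdempotentComplete C] (X : C) (n : ℕ) : Nonempty (SymPower X n) := by
  obtain ⟨Y, i, e, h₁, h₂⟩ := IsIdempotentComplete.idempotents_split _ _ (symmetrizer_idem X n)
  exact ⟨⟨Y, i, e, h₁, h₂⟩⟩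

namespace SymPower
variable {X : C} {n : ℕ} (a : SymPower X n)

theorem ι_symmetrizer : a.ι ≫ symmetrizer X n = a.ι := by
  rw [← a.π_ι, ← assoc, a.ι_π, id_comp]

theorem symmetrizer_π : symmetrizer X n ≫ a.π = a.π := by
  rw [← a.π_ι, assoc, a.ι_π, comp_id]

theorem ι_permHom (σ : Equiv.Perm (Fin n)) : a.ι ≫ permHom X n σ = a.ι := by
  rw [← a.ι_symmetrizer, assoc, symmetrizer_comp]

instance : IsSplitMono a.ι := ⟨⟨⟨a.π, a.ι_π⟩⟩⟩
instance : IsSplitEpi a.π := ⟨⟨⟨a.ι, a.ι_π⟩⟩⟩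

end SymPower

section
variable {X Y Z : C} {n : ℕ} (f : X ⟶ Y) (g : Y ⟶ Z)

theorem symMap_ι (a : SymPower X n) (b : SymPower Y n) :
    symMap f a b ≫ b.ι = a.ι ≫ tensorPowMap f n := by
  rw [symMap, assoc, assoc, b.π_ι, tensorPowMap_symmetrizer, reassoc_of% a.ι_symmetrizer]

theorem π_symMap (a : SymPower X n) (b : SymPower Y n) :
    a.π ≫ symMap f a b = tensorPowMap f n ≫ b.π := by
  rw [symMap, ← assoc, a.π_ι, ← reassoc_of% (tensorPowMap_symmetrizer f n), b.symmetrizer_π]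

theorem symMap_comp (a : SymPower X n) (b : SymPower Y n) (c : SymPower Z n) :
    symMap f a b ≫ symMap g b c = symMap (f ≫ g) a c := by
  rw [← cancel_mono c.ι, assoc, symMap_ι, reassoc_of% (symMap_ι f a b), symMap_ι, tensorPowMap_comp]

theorem symMap_id (a : SymPower X n) : symMap (𝟙 X) a a = 𝟙 _ := by
  rw [symMap, tensorPowMap_id, id_comp, a.ι_π]

/-- Two choices of the symmetric power are canonically isomorphic. -/
def symIso (a b : SymPower X n) : a.obj ≅ b.obj where
  hom := symMap (𝟙 X) a b
  inv := symMap (𝟙 X) b a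
  hom_inv_id := by rw [symMap_comp, id_comp, symMap_id]
  inv_hom_id := by rw [symMap_comp, id_comp, symMap_id]

theorem comult_naturality (a : SymPower X (n + 1)) (b : SymPower X n) (a' : SymPower Y (n + 1))
    (b' : SymPower Y n) :
    symMap f a a' ≫ comult a' b' = comult a b ≫ (symMap f b b' ⊗ₘ f) := by
  have h : (tensorPowMap f n ⊗ₘ f) ≫ b'.π ▷ Y = b.π ▷ X ≫ (symMap f b b' ⊗ₘ f) := by
    rw [← tensorHom_id, ← tensorHom_id, tensorHom_comp_tensorHom, tensorHom_comp_tensorHom,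
      comp_id, id_comp, π_symMap]
  have h₁ := (reassoc_of% (symMap_ι f a a')) (b'.π ▷ Y)
  refine h₁.trans ?_
  exact (congrArg (a.ι ≫ ·) h).trans (assoc _ _ _).symm

end

/-! ### Objects with vanishing symmetric square -/

/-- The symmetrizer on two factors. -/
theorem symmetrizer_two (X : C) : symmetrizer X 2 = (2 : ℚ)⁻¹ • (𝟙 _ + lastSwap X (𝟙_ C)) := by
  have h : (Finset.univ : Finset (Equiv.Perm (Fin 2))) = {1, Equiv.swap 0 1} := by decide
  have h₁ : permHom X 2 (Equiv.swap 0 1) = lastSwap X (𝟙_ C) :=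
    (permHom_swap X 1 0).trans (adjSwap_last X 0)
  rw [symmetrizer, h, Finset.sum_pair (by decide), permHom_one, h₁]
  rfl

variable [MonoidalPreadditive C]

omit [Linear ℚ C] [SymmetricCategory C] in
theorem whiskerLeft_neg' {X Y : C} (Z : C) (f : X ⟶ Y) : Z ◁ (-f) = -(Z ◁ f) :=
  (tensorLeft Z).map_neg

/-- If the second symmetric power of `X` vanishes, exchanging two factors `X` is `-1`. -/
theorem SymVanishes.lastSwap_eq {X : C} (h : SymVanishes X 2) (Y : C) : lastSwap X Y = -𝟙 _ := by
  obtain ⟨a, ha⟩ := h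
  have h₁ : symmetrizer X 2 = 0 := by rw [← a.π_ι, ha.eq_of_tgt a.π 0, zero_comp]
  have h₂ : (2 : ℚ)⁻¹ • (𝟙 ((𝟙_ C ⊗ X) ⊗ X) + lastSwap X (𝟙_ C)) = 0 :=
    (symmetrizer_two X).symm.trans h₁
  replace h₂ : lastSwap X (𝟙_ C) = -𝟙 _ := (neg_eq_of_add_eq_zero_right
    ((smul_eq_zero_iff_right (by norm_num)).1 h₂)).symm
  have h₃ : 𝟙_ C ◁ (β_ X X).hom = 𝟙_ C ◁ (-𝟙 (X ⊗ X)) := by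
    rw [← cancel_epi (α_ (𝟙_ C) X X).hom, ← cancel_mono (α_ (𝟙_ C) X X).inv, assoc]
    refine h₂.trans ?_
    rw [whiskerLeft_neg', MonoidalCategory.whiskerLeft_id, Preadditive.comp_neg,
      Preadditive.neg_comp, comp_id, Iso.hom_inv_id]
  have h₄ : (β_ X X).hom = -𝟙 _ := by
    rw [id_whiskerLeft, id_whiskerLeft, cancel_epi, cancel_mono] at h₃
    exact h₃
  rw [lastSwap, h₄, whiskerLeft_neg', MonoidalCategory.whiskerLeft_id, Preadditive.neg_comp,
    id_comp, Preadditive.comp_neg, Iso.hom_inv_id]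

end

section
variable {C : Type u} [Category.{v} C] [Preadditive C] [Linear ℚ C] [MonoidalCategory C]
  [SymmetricCategory C]

theorem symmetrizer_zero (X : C) : symmetrizer X 0 = 𝟙 _ := by
  rw [symmetrizer, Fintype.sum_unique, Nat.factorial_zero, Nat.cast_one, inv_one, one_smul]
  rfl

/-- `Sym ^ 0` is the unit object, and all morphisms induce isomorphisms on it. -/
theorem isIso_symMap_zero {X Y : C} (f : X ⟶ Y) (a : SymPower X 0) (b : SymPower Y 0) :
    IsIso (symMap f a b) := by
  have h (Z : C) (c : SymPower Z 0) : IsIso c.π := ⟨c.ι, c.π_ι.trans (symmetrizer_zero Z), c.ι_π⟩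
  have := h X a
  have h₁ : a.π ≫ symMap f a b = b.π := (π_symMap f a b).trans (id_comp _)
  have : IsIso (a.π ≫ symMap f a b) := by
    rw [h₁]
    exact h Y b
  exact IsIso.of_isIso_comp_left a.π _

end

/-! ### Symmetric powers and symmetric monoidal functors -/

section
open Functor.LaxMonoidal Functor.OplaxMonoidal Functor.Monoidal

variable {C : Type u} [Category.{v} C] [MonoidalCategory C] [SymmetricCategory C]
  {D : Type u'} [Category.{v'} D] [MonoidalCategory D] [SymmetricCategory D]
  (F : C ⥤ D) [F.Braided]

/-- The comparison of the tensor powers of `F X` with the image of those of `X`. The next lemmas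
show that it intertwines the action of permutations. -/
noncomputable def tensorPowIso (X : C) : ∀ n : ℕ, tensorPow (F.obj X) n ≅ F.obj (tensorPow X n)
  | 0 => εIso F
  | n + 1 => whiskerRightIso (tensorPowIso X n) (F.obj X) ≪≫ μIso F (tensorPow X n) X

theorem tensorPowIso_succ (X : C) (n : ℕ) : (tensorPowIso F X (n + 1)).hom =
    (tensorPowIso F X n).hom ▷ F.obj X ≫ μ F (tensorPow X n) X := rfl

/-- A braided functor preserves the exchange of the last two factors. -/
theorem μ_map_lastSwap (X Y : C) :
    (μ F Y X ▷ F.obj X ≫ μ F (Y ⊗ X) X) ≫ F.map (lastSwap X Y) =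
      lastSwap (F.obj X) (F.obj Y) ≫ μ F Y X ▷ F.obj X ≫ μ F (Y ⊗ X) X := by
  have h := Functor.map_braiding F X X
  simp only [lastSwap, Functor.map_comp, assoc, Functor.LaxMonoidal.associativity_assoc]
  rw [← μ_natural_right_assoc, h, MonoidalCategory.whiskerLeft_comp,
    MonoidalCategory.whiskerLeft_comp, assoc, assoc, whiskerLeft_μ_δ_assoc]
  rw [← cancel_mono (F.map (α_ Y X X).hom)]
  simp

section

variable {F}

theorem intertwine_comp {P : D} {Y : C} {E : P ⟶ F.obj Y} {a a' : P ⟶ P} {b b' : Y ⟶ Y}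
    (h : a ≫ E = E ≫ F.map b) (h' : a' ≫ E = E ≫ F.map b') :
    (a ≫ a') ≫ E = E ≫ F.map (b ≫ b') := by
  rw [assoc, h', reassoc_of% h, F.map_comp]

theorem intertwine_id {P : D} {Y : C} (E : P ⟶ F.obj Y) : 𝟙 P ≫ E = E ≫ F.map (𝟙 Y) := by
  simp

theorem intertwine_whiskerRight {P : D} {Y X : C} {e : P ⟶ F.obj Y} {a : P ⟶ P} {b : Y ⟶ Y}
    (h : a ≫ e = e ≫ F.map b) :
    a ▷ F.obj X ≫ e ▷ F.obj X ≫ μ F Y X = (e ▷ F.obj X ≫ μ F Y X) ≫ F.map (b ▷ X) := by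
  rw [assoc, ← μ_natural_left, ← comp_whiskerRight_assoc, h, comp_whiskerRight_assoc]

theorem intertwine_lastSwap {P : D} {Y X : C} (e : P ⟶ F.obj Y) :
    lastSwap (F.obj X) P ≫ (e ▷ F.obj X ≫ μ F Y X) ▷ F.obj X ≫ μ F (Y ⊗ X) X =
      ((e ▷ F.obj X ≫ μ F Y X) ▷ F.obj X ≫ μ F (Y ⊗ X) X) ≫ F.map (lastSwap X Y) := by
  have h := μ_map_lastSwap F X Y
  rw [assoc] at h
  rw [comp_whiskerRight, assoc, assoc, assoc, h,
    reassoc_of% (lastSwap_naturality (F.obj X) e)]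

end

theorem tensorPowIso_insertLast (X : C) : ∀ {n : ℕ} (p : Fin (n + 1)),
    insertLast (F.obj X) p ≫ (tensorPowIso F X (n + 1)).hom =
      (tensorPowIso F X (n + 1)).hom ≫ F.map (insertLast X p)
  | 0, _ => intertwine_id _
  | _ + 1, p => by
    cases p using Fin.lastCases with
    | last =>
      rw [insertLast_last, insertLast_last]
      exact intertwine_id _
    | cast j =>
      rw [insertLast_castSucc, insertLast_castSucc]
      exact intertwine_comp (intertwine_lastSwap (tensorPowIso F X _).hom)
        (intertwine_whiskerRight (tensorPowIso_insertLast X j))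

theorem tensorPowIso_permHom (X : C) : ∀ {n : ℕ} (σ : Equiv.Perm (Fin n)),
    permHom (F.obj X) n σ ≫ (tensorPowIso F X n).hom =
      (tensorPowIso F X n).hom ≫ F.map (permHom X n σ)
  | 0, _ => intertwine_id _
  | _ + 1, _ => intertwine_comp (intertwine_whiskerRight (tensorPowIso_permHom X _))
      (tensorPowIso_insertLast F X _)

theorem tensorPowIso_tensorPowMap {X Y : C} (f : X ⟶ Y) : ∀ n : ℕ,
    tensorPowMap (F.map f) n ≫ (tensorPowIso F Y n).hom =
      (tensorPowIso F X n).hom ≫ F.map (tensorPowMap f n)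
  | 0 => (id_comp _).trans ((comp_id _).symm.trans (congrArg (_ ≫ ·) (F.map_id _).symm))
  | n + 1 => by
    rw [tensorPowIso_succ, tensorPowIso_succ]
    change (tensorPowMap (F.map f) n ⊗ₘ F.map f) ≫ _ = _ ≫ F.map (tensorPowMap f n ⊗ₘ f)
    rw [assoc, ← μ_natural, ← tensorHom_id, ← tensorHom_id, tensorHom_comp_tensorHom_assoc,
      tensorHom_comp_tensorHom_assoc, tensorPowIso_tensorPowMap f n, id_comp, comp_id]

end

section
open Functor.LaxMonoidal Functor.OplaxMonoidal Functor.Monoidal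

variable {C : Type u} [Category.{v} C] [Preadditive C] [Linear ℚ C] [MonoidalCategory C]
  [SymmetricCategory C]
  {D : Type u'} [Category.{v'} D] [Preadditive D] [Linear ℚ D] [MonoidalCategory D]
  [SymmetricCategory D] (F : C ⥤ D) [F.Braided] [F.Additive]

theorem tensorPowIso_symmetrizer (X : C) (n : ℕ) :
    symmetrizer (F.obj X) n ≫ (tensorPowIso F X n).hom =
      (tensorPowIso F X n).hom ≫ F.map (symmetrizer X n) := by
  have : F.map (symmetrizer X n) =
      ((n.factorial : ℚ)⁻¹) • ∑ σ : Equiv.Perm (Fin n), F.map (permHom X n σ) := by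
    rw [symmetrizer, ← F.map_sum]
    exact map_rat_smul (F.mapAddHom (X := tensorPow X n) (Y := tensorPow X n)) _ _
  rw [this, symmetrizer, Linear.smul_comp, Linear.comp_smul, Preadditive.sum_comp,
    Preadditive.comp_sum]
  simp only [tensorPowIso_permHom]

variable {F}

/-- The image of a symmetric power under a braided additive functor. -/
noncomputable def SymPower.map (F : C ⥤ D) [F.Braided] [F.Additive] {X : C} {n : ℕ}
    (a : SymPower X n) : SymPower (F.obj X) n where
  obj := F.obj a.obj
  ι := F.map a.ι ≫ (tensorPowIso F X n).inv
  π := (tensorPowIso F X n).hom ≫ F.map a.π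
  ι_π := by rw [assoc, Iso.inv_hom_id_assoc, ← F.map_comp, a.ι_π, F.map_id]
  π_ι := by
    rw [assoc, ← F.map_comp_assoc, a.π_ι, ← assoc, ← tensorPowIso_symmetrizer, assoc,
      Iso.hom_inv_id, comp_id]

variable (F)

theorem symMap_map {X Y : C} (f : X ⟶ Y) {n : ℕ} (a : SymPower X n) (b : SymPower Y n) :
    symMap (F.map f) (a.map F) (b.map F) = F.map (symMap f a b) := by
  simp only [symMap, SymPower.map, assoc, F.map_comp]
  rw [← assoc (tensorPowMap _ _), tensorPowIso_tensorPowMap, assoc, Iso.inv_hom_id_assoc]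

theorem comult_map {X : C} {n : ℕ} (a : SymPower X (n + 1)) (b : SymPower X n) :
    comult (a.map F) (b.map F) ≫ μ F b.obj X = F.map (comult a b) := by
  have h : (δ F (tensorPow X n) X ≫ (tensorPowIso F X n).inv ▷ F.obj X) ≫
      ((tensorPowIso F X n).hom ≫ F.map b.π) ▷ F.obj X ≫ μ F b.obj X = F.map (b.π ▷ X) := by
    rw [assoc, ← comp_whiskerRight_assoc, Iso.inv_hom_id_assoc, μ_natural_left, δ_μ_assoc]
  exact (assoc _ _ _).trans ((assoc _ _ _).trans ((congrArg (F.map a.ι ≫ ·) h).trans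
    (F.map_comp a.ι (b.π ▷ X : tensorPow X n ⊗ X ⟶ b.obj ⊗ X)).symm))

end

section
open Functor.LaxMonoidal Functor.OplaxMonoidal Functor.Monoidal

variable {C : Type u} [Category.{v} C] [Preadditive C] [Linear ℚ C] [MonoidalCategory C]
  [SymmetricCategory C]
  {D : Type u'} [Category.{v'} D] [Preadditive D] [Linear ℚ D] [MonoidalCategory D]
  [SymmetricCategory D] {F : C ⥤ D} [F.Braided] [F.Additive]

/-- A symmetric power of the image of `X` is the image of a symmetric power of `X`. -/
noncomputable def SymPower.isoMap {X : C} {n : ℕ} (a : SymPower (F.obj X) n) (s : SymPower X n) :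
    a.obj ≅ F.obj s.obj :=
  symIso a (s.map F)

variable (F)

theorem symMap_isoMap {X Y : C} (f : X ⟶ Y) {n : ℕ} (a : SymPower (F.obj X) n)
    (b : SymPower (F.obj Y) n) (s : SymPower X n) (t : SymPower Y n) :
    symMap (F.map f) a b ≫ (b.isoMap t).hom = (a.isoMap s).hom ≫ F.map (symMap f s t) := by
  refine (symMap_comp _ _ _ _ _).trans (Eq.trans ?_ (congrArg (fun t => symMap _ a _ ≫ t)
    (symMap_map F f s t)))
  rw [symMap_comp, id_comp, comp_id]

theorem comult_isoMap {X : C} {n : ℕ} (a : SymPower (F.obj X) (n + 1)) (b : SymPower (F.obj X) n)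
    (s : SymPower X (n + 1)) (t : SymPower X n) :
    comult a b ≫ (b.isoMap t).hom ▷ F.obj X ≫ μ F t.obj X =
      (a.isoMap s).hom ≫ F.map (comult s t) := by
  have h := comult_naturality (𝟙 _) a b (s.map F) (t.map F)
  rw [tensorHom_id] at h
  refine (assoc _ _ _).symm.trans
    ((congrArg (fun t => t ≫ _) h.symm).trans ((assoc _ _ _).trans ?_))
  exact congrArg (fun t => symMap (𝟙 _) a _ ≫ t) (comult_map F s t)

end

/-! ### The comultiplication relative to a morphism -/

section
variable {C : Type u} [Category.{v} C] [MonoidalCategory C] [SymmetricCategory C]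

/-- A morphism on the last factor becomes a morphism on the last but one factor after the exchange
of the two. -/
theorem whiskerLeft_comp_lastSwap (Y : C) {X X' : C} (f : X' ⟶ X) :
    ∃ e : (Y ⊗ X) ⊗ X' ⟶ (Y ⊗ X') ⊗ X, (Y ⊗ X) ◁ f ≫ lastSwap X Y = e ≫ (Y ◁ f) ▷ X :=
  ⟨(α_ Y X X').hom ≫ Y ◁ (β_ X X').hom ≫ (α_ Y X' X).inv, by
    simp only [lastSwap, assoc, ← associator_inv_naturality_middle,
      associator_naturality_right_assoc]
    rw [← MonoidalCategory.whiskerLeft_comp_assoc, BraidedCategory.braiding_naturality_right,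
      MonoidalCategory.whiskerLeft_comp_assoc]⟩

/-- A morphism on the last but one factor, preceded by the exchange of the last two, factors through
the same morphism on the last factor. -/
theorem lastSwap_comp_whiskerRight (Y : C) {X X' : C} (f : X ⟶ X') :
    ∃ e : (Y ⊗ X) ⊗ X' ⟶ (Y ⊗ X') ⊗ X, lastSwap X Y ≫ (Y ◁ f) ▷ X = (Y ⊗ X) ◁ f ≫ e :=
  ⟨(α_ Y X X').hom ≫ Y ◁ (β_ X X').hom ≫ (α_ Y X' X).inv, by
    simp only [lastSwap, assoc, ← associator_inv_naturality_middle,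
      associator_naturality_right_assoc]
    rw [← MonoidalCategory.whiskerLeft_comp_assoc, ← BraidedCategory.braiding_naturality_right,
      MonoidalCategory.whiskerLeft_comp_assoc]⟩

/-- A morphism on the last factor, preceded by the exchange of the last two, factors through the
same morphism on the last but one factor. -/
theorem lastSwap_comp_whiskerLeft (Y : C) {X X' : C} (f : X ⟶ X') :
    ∃ e : (Y ⊗ X') ⊗ X ⟶ (Y ⊗ X) ⊗ X', lastSwap X Y ≫ (Y ⊗ X) ◁ f = (Y ◁ f) ▷ X ≫ e :=
  ⟨(α_ Y X' X).hom ≫ Y ◁ (β_ X' X).hom ≫ (α_ Y X X').inv, by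
    simp only [lastSwap, assoc, ← associator_inv_naturality_right,
      associator_naturality_middle_assoc]
    rw [← MonoidalCategory.whiskerLeft_comp_assoc, ← BraidedCategory.braiding_naturality_left,
      MonoidalCategory.whiskerLeft_comp_assoc]⟩

end

section
variable {C : Type u} [Category.{v} C] [Preadditive C] [Linear ℚ C] [MonoidalCategory C]
  [SymmetricCategory C]

/-- `symmetrizer X (n + 1)`, the last factor being split off. The objects `tensorPow X (n + 1)` and
`tensorPow X n ⊗ X` are equal by definition, but rewriting needs one of the two forms throughout;
the other definitions whose names contain `Succ` have the same purpose. -/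
noncomputable def symmetrizerSucc (X : C) (n : ℕ) : tensorPow X n ⊗ X ⟶ tensorPow X n ⊗ X :=
  symmetrizer X (n + 1)

omit [Preadditive C] [Linear ℚ C] in
/-- `insertLast X p`, the last factor being split off. -/
def insertLastSucc (X : C) {n : ℕ} (p : Fin (n + 1)) : tensorPow X n ⊗ X ⟶ tensorPow X n ⊗ X :=
  insertLast X p

namespace SymPower
variable {X : C} {n : ℕ}

/-- The inclusion of a symmetric power, the last factor being split off. -/
def ιSucc (a : SymPower X (n + 1)) : a.obj ⟶ tensorPow X n ⊗ X := a.ι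

/-- The projection onto a symmetric power, the last factor being split off. -/
def πSucc (a : SymPower X (n + 1)) : tensorPow X n ⊗ X ⟶ a.obj := a.π

/-- The inclusion of a symmetric power, the last two factors being split off. -/
def ιSucc₂ (a : SymPower X (n + 2)) : a.obj ⟶ (tensorPow X n ⊗ X) ⊗ X := a.ι

theorem ιSucc_πSucc (a : SymPower X (n + 1)) : a.ιSucc ≫ a.πSucc = 𝟙 _ := a.ι_π

theorem πSucc_ιSucc (a : SymPower X (n + 1)) : a.πSucc ≫ a.ιSucc = symmetrizerSucc X n := a.π_ι

theorem ιSucc₂_lastSwap (a : SymPower X (n + 2)) :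
    a.ιSucc₂ ≫ lastSwap X (tensorPow X n) = a.ιSucc₂ := by
  have h := a.ι_permHom (Equiv.swap (Fin.last n).castSucc (Fin.last n).succ)
  rw [permHom_swap, adjSwap_last] at h
  exact h

end SymPower

variable [MonoidalPreadditive C] [MonoidalLinear ℚ C]

/-- The symmetrizer on `n + 1` factors in terms of the one on the first `n` factors. -/
theorem symmetrizerSucc_eq (X : C) (n : ℕ) : symmetrizerSucc X n =
    ((n + 1 : ℕ) : ℚ)⁻¹ • ∑ p : Fin (n + 1), symmetrizer X n ▷ X ≫ insertLastSucc X p := by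
  have h : ∑ σ : Equiv.Perm (Fin (n + 1)), permHom X (n + 1) σ =
      ∑ p : Fin (n + 1), ∑ τ : Equiv.Perm (Fin n), (permHom X n τ ▷ X ≫ insertLastSucc X p) := by
    rw [← Fintype.sum_prod_type', ← (consPermEquiv n).sum_comp]
    exact Finset.sum_congr rfl fun x _ =>
      permHom_cons X _ x.1 x.2 (consPerm_last _ _) (consPerm_castSucc _ _)
  have h' : (∑ τ : Equiv.Perm (Fin n), permHom X n τ) ▷ X = ∑ τ, permHom X n τ ▷ X :=
    (tensorRight X).map_sum _ _
  have e : symmetrizerSucc X n = (((n + 1).factorial : ℚ)⁻¹) •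
      ∑ p : Fin (n + 1), ∑ τ : Equiv.Perm (Fin n), (permHom X n τ ▷ X ≫ insertLastSucc X p) :=
    congrArg (fun t => (((n + 1).factorial : ℚ)⁻¹) • t) h
  rw [e, Nat.factorial_succ, Nat.cast_mul, mul_inv, mul_smul, symmetrizer]
  congr 1
  rw [Finset.smul_sum]
  refine Finset.sum_congr rfl fun p _ => ?_
  rw [MonoidalLinear.smul_whiskerRight, Linear.smul_comp, h', Preadditive.sum_comp]

/-- If a morphism is invariant under the permutations of the first factors, and is killed by `g`
on all the factors but the last once the last factor has been moved, only the trivial coset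
contributes to its symmetrization. -/
theorem comp_symmetrizerSucc_comp {X Y Z : C} {n : ℕ} (t : Z ⟶ tensorPow X n ⊗ X) (g : X ⟶ Y)
    (ht : t ≫ symmetrizer X n ▷ X = t)
    (h : ∀ j : Fin n, t ≫ insertLastSucc X j.castSucc ≫ tensorPowMap g n ▷ X = 0) :
    t ≫ symmetrizerSucc X n ≫ tensorPowMap g n ▷ X =
      ((n + 1 : ℕ) : ℚ)⁻¹ • (t ≫ tensorPowMap g n ▷ X) := by
  have e : insertLastSucc X (Fin.last n) = 𝟙 _ := insertLast_last X n
  rw [symmetrizerSucc_eq, Linear.smul_comp, Linear.comp_smul, Preadditive.sum_comp,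
    Preadditive.comp_sum]
  congr 1
  simp only [assoc, reassoc_of% ht]
  rw [Fin.sum_univ_castSucc, Finset.sum_eq_zero fun j _ => h j, zero_add, e, id_comp]

omit [Linear ℚ C] [MonoidalPreadditive C] [MonoidalLinear ℚ C] in
/-- A criterion for the vanishing hypothesis of `comp_symmetrizerSucc_comp`: to move the last factor
to any other place one starts by exchanging it with the last but one. -/
theorem comp_insertLastSucc_comp {X Y Z : C} {n : ℕ} (t : Z ⟶ (tensorPow X n ⊗ X) ⊗ X)
    (g : X ⟶ Y) (h : t ≫ lastSwap X (tensorPow X n) ≫ (tensorPowMap g n ⊗ₘ g) ▷ X = 0)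
    (j : Fin (n + 1)) : (t : Z ⟶ tensorPow X (n + 1) ⊗ X) ≫ insertLastSucc X j.castSucc ≫
      tensorPowMap g (n + 1) ▷ X = 0 := by
  have h₁ : insertLastSucc X j ▷ X ≫ (tensorPowMap g n ⊗ₘ g) ▷ X =
      (tensorPowMap g n ⊗ₘ g) ▷ X ≫ insertLastSucc Y j ▷ X := by
    rw [← comp_whiskerRight, ← comp_whiskerRight]
    exact congrArg (· ▷ X) (tensorPowMap_insertLast g j).symm
  have h₂ : t ≫ (lastSwap X (tensorPow X n) ≫ insertLastSucc X j ▷ X) ≫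
      (tensorPowMap g n ⊗ₘ g) ▷ X = 0 := by rw [assoc, h₁, reassoc_of% h, zero_comp]
  have h₃ : insertLastSucc X j.castSucc = lastSwap X (tensorPow X n) ≫ insertLastSucc X j ▷ X :=
    insertLast_castSucc X j
  rw [h₃]
  exact h₂

/-- The comultiplication `Sym ^ (n + 1) V ⟶ Sym ^ n V ⊗ V` followed by a morphism `V ⟶ W` on all the
factors but the last. -/
def relComult {V W : C} (g : V ⟶ W) {n : ℕ} (a : SymPower V (n + 1)) (b : SymPower V n)
    (c : SymPower W n) : a.obj ⟶ c.obj ⊗ V :=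
  comult a b ≫ symMap g b c ▷ V

section
variable {V W : C} (g : V ⟶ W) {n : ℕ} (a : SymPower V (n + 1)) (b : SymPower V n)
    (c : SymPower W n) (d : SymPower W (n + 1))

theorem comult_whiskerRight_ι : comult a b ≫ b.ι ▷ V = a.ιSucc := comult_ι a b

theorem relComult_ι : relComult g a b c ≫ c.ι ▷ V = a.ιSucc ≫ tensorPowMap g n ▷ V := by
  rw [relComult, assoc, ← comp_whiskerRight, symMap_ι, comp_whiskerRight,
    reassoc_of% (comult_whiskerRight_ι a b)]

omit [MonoidalPreadditive C] [MonoidalLinear ℚ C] in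
theorem relComult_whiskerLeft : relComult g a b c ≫ c.obj ◁ g = symMap g a d ≫ comult d c := by
  rw [relComult, assoc, ← MonoidalCategory.tensorHom_def, comult_naturality g a b d c]

/-- The multiplication is a left inverse of the comultiplication, with the normalization chosen
here. -/
theorem comult_mult : comult a b ≫ b.ι ▷ V ≫ a.πSucc = 𝟙 _ := by
  rw [reassoc_of% (comult_whiskerRight_ι a b), a.ιSucc_πSucc]

instance mono_comult : Mono (comult a b) := ⟨fun x y h => by
  have := congrArg (fun t => t ≫ b.ι ▷ V ≫ a.πSucc) h
  simpa only [assoc, comult_mult, comp_id] using this⟩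

instance mono_whiskerRight_ι (U : C) : Mono (b.ι ▷ U) :=
  inferInstanceAs (Mono ((tensorRight U).map b.ι))

end

/-- The multiplication `Sym ^ n V ⊗ U ⟶ Sym ^ (n + 1) V` followed by the comultiplication relative
to `g`. As `g` kills `U`, only the permutations which fix the last factor contribute, whence the
factor `1 / (n + 1)`. -/
theorem mult_relComult {U V W : C} (f : U ⟶ V) (g : V ⟶ W) (w : f ≫ g = 0) {n : ℕ}
    (a : SymPower V (n + 1)) (b : SymPower V n) (c : SymPower W n) :
    (b.ι ⊗ₘ f) ≫ a.πSucc ≫ relComult g a b c =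
      ((n + 1 : ℕ) : ℚ)⁻¹ • (symMap g b c ⊗ₘ f) := by
  rw [← cancel_mono (c.ι ▷ V), assoc, assoc, relComult_ι, reassoc_of% a.πSucc_ιSucc,
    comp_symmetrizerSucc_comp]
  · rw [Linear.smul_comp, ← tensorHom_id, ← tensorHom_id, tensorHom_comp_tensorHom,
      tensorHom_comp_tensorHom, symMap_ι]
  · rw [← tensorHom_id, tensorHom_comp_tensorHom, b.ι_symmetrizer, comp_id]
  · intro j
    cases n with
    | zero => exact j.elim0
    | succ n =>
      refine comp_insertLastSucc_comp (b.ιSucc ⊗ₘ f) g ?_ j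
      obtain ⟨e, he⟩ := whiskerLeft_comp_lastSwap (X := V) (tensorPow V n) f
      have h : (tensorPow V n ◁ f) ▷ V ≫ (tensorPowMap g n ⊗ₘ g) ▷ V = 0 := by
        rw [← comp_whiskerRight, ← id_tensorHom, tensorHom_comp_tensorHom, w,
          MonoidalPreadditive.tensor_zero, MonoidalPreadditive.zero_whiskerRight]
      rw [MonoidalCategory.tensorHom_def, assoc, reassoc_of% he, h, comp_zero, comp_zero]

/-- If a morphism to `Sym ^ (n + 1) V ⊗ V` vanishes once `g` is applied to all the factors but the
last, and once `g` is applied to all the factors but the last but one, its composition with the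
multiplication vanishes once `g` is applied to all the factors but the last. -/
theorem comp_mult_relComult {Z V W : C} (g : V ⟶ W) {n : ℕ}
    (a : SymPower V (n + 2)) (b : SymPower V (n + 1)) (b' : SymPower V n) (c : SymPower W (n + 1))
    (c' : SymPower W n) (t : Z ⟶ b.obj ⊗ V) (h₁ : t ≫ symMap g b c ▷ V = 0)
    (h₂ : t ≫ relComult g b b' c' ▷ V ≫ (c'.obj ⊗ V) ◁ g = 0) :
    t ≫ (b.ι ▷ V ≫ a.πSucc) ≫ relComult g a b c = 0 := by
  rw [← cancel_mono (c.ι ▷ V), assoc, assoc, assoc, relComult_ι, zero_comp,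
    reassoc_of% a.πSucc_ιSucc, ← assoc, comp_symmetrizerSucc_comp]
  · rw [assoc, ← comp_whiskerRight, ← symMap_ι g b c, comp_whiskerRight, reassoc_of% h₁, zero_comp,
      smul_zero]
  · rw [assoc, ← comp_whiskerRight, b.ι_symmetrizer]
  · intro j
    refine comp_insertLastSucc_comp (t ≫ b.ιSucc ▷ V) g ?_ j
    obtain ⟨e, he⟩ := lastSwap_comp_whiskerRight (tensorPow W n) g
    have e₁ : lastSwap V (tensorPow V n) ≫ (tensorPowMap g n ⊗ₘ g) ▷ V =
        (tensorPowMap g n ▷ V) ▷ V ≫ (tensorPow W n ⊗ V) ◁ g ≫ e := by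
      rw [MonoidalCategory.tensorHom_def, comp_whiskerRight, ← reassoc_of% (lastSwap_naturality V
        (tensorPowMap g n)), he]
    have e₂ : b.ιSucc ▷ V ≫ (tensorPowMap g n ▷ V) ▷ V =
        relComult g b b' c' ▷ V ≫ c'.ι ▷ V ▷ V := by
      rw [← comp_whiskerRight, ← comp_whiskerRight, relComult_ι]
    have e₃ : c'.ι ▷ V ▷ V ≫ (tensorPow W n ⊗ V) ◁ g = (c'.obj ⊗ V) ◁ g ≫ c'.ι ▷ V ▷ W :=
      (whisker_exchange _ _).symm
    rw [e₁, assoc, reassoc_of% e₂, reassoc_of% e₃, reassoc_of% h₂, zero_comp]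

section
variable {V W : C} (g : V ⟶ W) {n : ℕ} (a : SymPower V (n + 2)) (b : SymPower V (n + 1))
  (b' : SymPower V n) (c : SymPower W (n + 1)) (c' : SymPower W n)

theorem comult_relComult_ι : (comult a b ≫ relComult g b b' c' ▷ V) ≫ c'.ι ▷ V ▷ V =
    a.ιSucc₂ ≫ tensorPowMap g n ▷ V ▷ V := by
  have h : comult a b ≫ b.ιSucc ▷ V = a.ιSucc₂ := comult_ι a b
  rw [assoc, ← comp_whiskerRight, relComult_ι, comp_whiskerRight, reassoc_of% h]

instance mono_whiskerRight_ι₂ (U U' : C) : Mono (c'.ι ▷ U ▷ U') :=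
  inferInstanceAs (Mono ((tensorRight U').map ((tensorRight U).map c'.ι)))

/-- The iterated comultiplication is invariant under the exchange of the last two factors. -/
theorem comult_relComult_lastSwap : (comult a b ≫ relComult g b b' c' ▷ V) ≫ lastSwap V c'.obj =
    comult a b ≫ relComult g b b' c' ▷ V := by
  rw [← cancel_mono (c'.ι ▷ V ▷ V), assoc, ← lastSwap_naturality, ← assoc, comult_relComult_ι,
    assoc, lastSwap_naturality, ← assoc, a.ιSucc₂_lastSwap]

/-- A morphism to a symmetric power which vanishes once `g` is applied to all the factors but the
last also vanishes once `g` is applied to all the factors but the last but one. -/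
theorem comp_comult_relComult {Z : C} (u : Z ⟶ a.obj) (hu : u ≫ relComult g a b c = 0) :
    u ≫ comult a b ≫ relComult g b b' c' ▷ V ≫ (c'.obj ⊗ V) ◁ g = 0 := by
  obtain ⟨e, he⟩ := lastSwap_comp_whiskerLeft c'.obj g
  have h := (reassoc_of% (comult_relComult_lastSwap g a b b' c')) ((c'.obj ⊗ V) ◁ g)
  rw [he, ← comp_whiskerRight_assoc, relComult_whiskerLeft g b b' c' c,
    comp_whiskerRight_assoc] at h
  rw [← h, ← assoc (comult a b), ← relComult, reassoc_of% hu, zero_comp]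

end

end

/-! ### The filtration of the symmetric powers of an extension -/

section
variable {A : Type u} [Category.{v} A] [Abelian A] [MonoidalCategory A] [MonoidalPreadditive A]
    [∀ X : A, PreservesFiniteLimits (tensorLeft X)]
    [∀ X : A, PreservesFiniteColimits (tensorLeft X)]

/-- The short exact sequence `X ⊗ S`. -/
noncomputable abbrev tensorSeq (X : A) (S : ShortComplex A) : ShortComplex A :=
  S.map (tensorLeft X)

theorem tensorSeq_shortExact (X : A) {S : ShortComplex A} (hS : S.ShortExact) :
    (tensorSeq X S).ShortExact :=
  hS.map_of_exact _

end

section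
variable {A : Type u} [Category.{v} A] [Abelian A] [Linear ℚ A]
    [MonoidalCategory A] [SymmetricCategory A] [MonoidalPreadditive A] [MonoidalLinear ℚ A]
    [∀ X : A, PreservesFiniteLimits (tensorLeft X)]
    [∀ X : A, PreservesFiniteColimits (tensorLeft X)]

instance preservesFiniteLimits_tensorRight (X : A) : PreservesFiniteLimits (tensorRight X) :=
  preservesFiniteLimits_of_natIso (BraidedCategory.tensorLeftIsoTensorRight X)

instance preservesFiniteColimits_tensorRight (X : A) : PreservesFiniteColimits (tensorRight X) :=
  preservesFiniteColimits_of_natIso (BraidedCategory.tensorLeftIsoTensorRight X)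

instance mono_whiskerLeft (X : A) {Y Z : A} (f : Y ⟶ Z) [Mono f] : Mono (X ◁ f) :=
  inferInstanceAs (Mono ((tensorLeft X).map f))

instance mono_whiskerRight (X : A) {Y Z : A} (f : Y ⟶ Z) [Mono f] : Mono (f ▷ X) :=
  inferInstanceAs (Mono ((tensorRight X).map f))

instance epi_whiskerLeft (X : A) {Y Z : A} (f : Y ⟶ Z) [Epi f] : Epi (X ◁ f) :=
  inferInstanceAs (Epi ((tensorLeft X).map f))

instance epi_whiskerRight (X : A) {Y Z : A} (f : Y ⟶ Z) [Epi f] : Epi (f ▷ X) :=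
  inferInstanceAs (Epi ((tensorRight X).map f))

/-- A pullback of a morphism has the same kernel. -/
noncomputable def kernelPullbackSndIso {X Y Z : A} (f : X ⟶ Z) (g : Y ⟶ Z) :
    kernel (pullback.snd f g) ≅ kernel f where
  hom := kernel.lift f (kernel.ι _ ≫ pullback.fst f g)
    (by rw [assoc, pullback.condition, kernel.condition_assoc, zero_comp])
  inv := kernel.lift (pullback.snd f g)
    (pullback.lift (kernel.ι f) 0 ((kernel.condition f).trans zero_comp.symm))
    (pullback.lift_snd _ _ _)
  hom_inv_id := by
    rw [← cancel_mono (kernel.ι _)]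
    apply pullback.hom_ext
    · simp only [assoc, id_comp, pullback.lift_fst, kernel.lift_ι]
    · simp only [assoc, id_comp, kernel.condition, comp_zero]
  inv_hom_id := by
    rw [← cancel_mono (kernel.ι _), assoc, kernel.lift_ι, kernel.lift_ι_assoc, pullback.lift_fst,
      id_comp]

theorem epi_tensorPowMap {V W : A} (g : V ⟶ W) [Epi g] : ∀ n : ℕ, Epi (tensorPowMap g n)
  | 0 => inferInstanceAs (Epi (𝟙 _))
  | n + 1 => by
    have := epi_tensorPowMap g n
    have h : tensorPowMap g (n + 1) = tensorPowMap g n ▷ V ≫ tensorPow W n ◁ g :=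
      MonoidalCategory.tensorHom_def _ _
    have h₁ : Epi (tensorPowMap g n ▷ V) := inferInstance
    have h₂ : Epi (tensorPow W n ◁ g) := inferInstance
    rw [h]
    exact @epi_comp _ _ _ _ _ _ h₁ _ h₂

theorem epi_symMap {V W : A} (g : V ⟶ W) [Epi g] {n : ℕ} (a : SymPower V n) (b : SymPower W n) :
    Epi (symMap g a b) := by
  have := epi_tensorPowMap g n
  have : Epi (a.π ≫ symMap g a b) := by
    rw [π_symMap]
    exact epi_comp _ _
  exact epi_of_epi a.π _

variable {S : ShortComplex A} (hS : S.ShortExact)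

/-- A choice of all the symmetric powers of all objects of an abelian category. -/
noncomputable def sym (X : A) (n : ℕ) : SymPower X n :=
  Classical.choice (SymPower.nonempty X n)

variable (S) in
/-- The sequence `0 ⟶ K ⟶ Sym ^ n X₂ ⟶ Sym ^ n X₃ ⟶ 0` attached to `0 ⟶ X₁ ⟶ X₂ ⟶ X₃ ⟶ 0`. -/
noncomputable abbrev symSeq (n : ℕ) : ShortComplex A :=
  ShortComplex.mk (kernel.ι (symMap S.g (sym S.X₂ n) (sym S.X₃ n)))
    (symMap S.g (sym S.X₂ n) (sym S.X₃ n)) (kernel.condition _)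

include hS in
theorem symSeq_shortExact (n : ℕ) : (symSeq S n).ShortExact := by
  have := hS.epi_g
  exact ShortComplex.ShortExact.mk' (ShortComplex.exact_kernel _) inferInstance (epi_symMap _ _ _)

variable (S) in
/-- The morphism `Sym ^ (n + 1) X₂ ⟶ Sym ^ n X₃ ⊗ X₂` given by the comultiplication. -/
noncomputable abbrev symθ (n : ℕ) : (sym S.X₂ (n + 1)).obj ⟶ (sym S.X₃ n).obj ⊗ S.X₂ :=
  relComult S.g (sym S.X₂ (n + 1)) (sym S.X₂ n) (sym S.X₃ n)

theorem symθ_g (n : ℕ) : symθ S n ≫ (sym S.X₃ n).obj ◁ S.g =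
    symMap S.g _ _ ≫ comult (sym S.X₃ (n + 1)) (sym S.X₃ n) :=
  relComult_whiskerLeft _ _ _ _ _

/-- The morphism induced by `symθ` on the kernels of the projections to `Sym ^ (n + 1) X₃` and to
`Sym ^ n X₃ ⊗ X₃`. -/
noncomputable def symφ (n : ℕ) : (symSeq S (n + 1)).X₁ ⟶ (sym S.X₃ n).obj ⊗ S.X₁ :=
  have := (tensorSeq_shortExact (sym S.X₃ n).obj hS).mono_f
  (tensorSeq_shortExact (sym S.X₃ n).obj hS).exact.lift (kernel.ι _ ≫ symθ S n) (by
    change (kernel.ι _ ≫ symθ S n) ≫ (sym S.X₃ n).obj ◁ S.g = 0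
    rw [assoc, symθ_g, kernel.condition_assoc, zero_comp])

theorem symφ_f (n : ℕ) : symφ hS n ≫ (sym S.X₃ n).obj ◁ S.f =
    (symSeq S (n + 1)).f ≫ symθ S n :=
  have := (tensorSeq_shortExact (sym S.X₃ n).obj hS).mono_f
  (tensorSeq_shortExact (sym S.X₃ n).obj hS).exact.lift_f _ _

/-- The morphism of short exact sequences from the one of symmetric powers to `Sym ^ n X₃ ⊗ S`. -/
noncomputable def symΦ (n : ℕ) : symSeq S (n + 1) ⟶ tensorSeq (sym S.X₃ n).obj S where
  τ₁ := symφ hS n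
  τ₂ := symθ S n
  τ₃ := comult _ _
  comm₁₂ := symφ_f hS n
  comm₂₃ := symθ_g n

/-- `symφ` is an epimorphism because the multiplication `Sym ^ n X₂ ⊗ X₁ ⟶ Sym ^ (n + 1) X₂` lifts
to its source, with composition a multiple of `Sym ^ n X₂ ⊗ X₁ ⟶ Sym ^ n X₃ ⊗ X₁`. -/
theorem epi_symφ (n : ℕ) : Epi (symφ hS n) := by
  have := hS.epi_g
  have := hS.mono_f
  let a := sym S.X₂ (n + 1)
  let b := sym S.X₂ n
  let c := sym S.X₃ n
  have h := mult_relComult S.f S.g S.zero a b c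
  have w : ((b.ι ⊗ₘ S.f) ≫ a.πSucc) ≫ symMap S.g a (sym S.X₃ (n + 1)) = 0 := by
    rw [← cancel_mono (comult (sym S.X₃ (n + 1)) c), assoc, assoc,
      ← relComult_whiskerLeft S.g a b c, zero_comp, reassoc_of% h, Linear.smul_comp,
      ← id_tensorHom, tensorHom_comp_tensorHom, S.zero, MonoidalPreadditive.tensor_zero, smul_zero]
  have e : kernel.lift _ _ w ≫ symφ hS n = ((n + 1 : ℕ) : ℚ)⁻¹ • (symMap S.g b c ▷ S.X₁) := by
    rw [← cancel_mono (c.obj ◁ S.f), assoc, symφ_f, kernel.lift_ι_assoc, assoc, h,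
      Linear.smul_comp, MonoidalCategory.tensorHom_def]
  have := epi_symMap S.g b c
  have : Epi (kernel.lift _ _ w ≫ symφ hS n) := by
    have hn : ((n + 1 : ℕ) : ℚ) ≠ 0 := Nat.cast_ne_zero.2 n.succ_ne_zero
    rw [e]
    refine Preadditive.epi_of_cancel_zero _ fun t ht => ?_
    rw [Linear.smul_comp, smul_eq_zero_iff_right (inv_ne_zero hn)] at ht
    rwa [← cancel_epi (symMap S.g b c ▷ S.X₁), comp_zero]
  exact epi_of_epi (kernel.lift _ _ w) _

theorem mono_symφ_zero : Mono (symφ hS 0) := by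
  have : Mono (symθ S 0) := by
    have h := relComult_ι S.g (sym S.X₂ 1) (sym S.X₂ 0) (sym S.X₃ 0)
    have e : tensorPowMap S.g 0 ▷ S.X₂ = 𝟙 _ := id_whiskerRight _ _
    rw [e] at h
    have h' : symθ S 0 ≫ (sym S.X₃ 0).ι ▷ S.X₂ = (sym S.X₂ 1).ιSucc := h.trans (comp_id _)
    have : Mono (symθ S 0 ≫ (sym S.X₃ 0).ι ▷ S.X₂) := by
      rw [h']
      exact inferInstanceAs (Mono (sym S.X₂ 1).ι)
    exact mono_of_mono _ ((sym S.X₃ 0).ι ▷ S.X₂)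
  have : Mono (symφ hS 0 ≫ (sym S.X₃ 0).obj ◁ S.f) := by
    rw [symφ_f]
    exact mono_comp _ _
  exact mono_of_mono _ ((sym S.X₃ 0).obj ◁ S.f)

section
variable (n : ℕ)

/-- The pullback of `(Sym ^ n X₃ ⊗ X₁) ⊗ X₁` along `symφ ▷ X₂`: the part, in
`Sym ^ (n + 1) X₂ ⊗ X₂`, of `K ⊗ X₂` for `K` the kernel of `Sym ^ (n + 1) X₂ ⟶ Sym ^ (n + 1) X₃`,
which maps to `(Sym ^ n X₃ ⊗ X₁) ⊗ X₁`. -/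
noncomputable abbrev symPB : A :=
  pullback (symφ hS n ▷ S.X₂) (((sym S.X₃ n).obj ⊗ S.X₁) ◁ S.f)

theorem symPB_cond : pullback.fst (symφ hS n ▷ S.X₂) (((sym S.X₃ n).obj ⊗ S.X₁) ◁ S.f) ≫
    (symSeq S (n + 1)).f ▷ S.X₂ ≫ symθ S n ▷ S.X₂ =
    pullback.snd _ _ ≫ ((sym S.X₃ n).obj ◁ S.f ⊗ₘ S.f) := by
  rw [← comp_whiskerRight, ← symφ_f hS, comp_whiskerRight, pullback.condition_assoc,
    whisker_exchange, ← MonoidalCategory.tensorHom_def]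

/-- The second step of the filtration of `Sym ^ (n + 1) X₂`: the kernel of
`Sym ^ (n + 1) X₂ ⟶ Sym ^ n X₃ ⊗ X₂`, presented as a subobject of the first step. -/
noncomputable abbrev symKer (n : ℕ) : A := kernel (symφ hS n)

/-- The inclusion of the second step of the filtration in `Sym ^ (n + 1) X₂`. -/
noncomputable abbrev symKerι (n : ℕ) : symKer hS n ⟶ (sym S.X₂ (n + 1)).obj :=
  kernel.ι (symφ hS n) ≫ (symSeq S (n + 1)).f

theorem symKerι_θ (n : ℕ) : symKerι hS n ≫ symθ S n = 0 := by
  rw [assoc, ← symφ_f hS, kernel.condition_assoc, zero_comp]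

/-- `symKer` is the kernel of `symθ`. -/
theorem exists_symKer_lift {Z : A} (t : Z ⟶ (sym S.X₂ (n + 1)).obj) (ht : t ≫ symθ S n = 0) :
    ∃ s : Z ⟶ symKer hS n, s ≫ symKerι hS n = t := by
  have := hS.mono_f
  have h₁ : t ≫ symMap S.g _ (sym S.X₃ (n + 1)) = 0 := by
    rw [← cancel_mono (comult (sym S.X₃ (n + 1)) (sym S.X₃ n)), assoc, ← symθ_g, reassoc_of% ht,
      zero_comp, zero_comp]
  have h₂ : kernel.lift _ t h₁ ≫ symφ hS n = 0 := by
    rw [← cancel_mono ((sym S.X₃ n).obj ◁ S.f), assoc, symφ_f, kernel.lift_ι_assoc, ht, zero_comp]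
  exact ⟨kernel.lift _ _ h₂, by rw [kernel.lift_ι_assoc, kernel.lift_ι]⟩

/-- The second step of the filtration of `Sym ^ (n + 2) X₂` is a direct summand of `symPB`: the
inclusion is induced by the comultiplication and the retraction by the multiplication. The
inclusion becomes invariant under the exchange of the factors `X₁` in
`(Sym ^ n X₃ ⊗ X₁) ⊗ X₁`. -/
theorem exists_retract : ∃ (i : symKer hS (n + 1) ⟶ symPB hS n)
    (r : symPB hS n ⟶ symKer hS (n + 1)), i ≫ r = 𝟙 _ ∧
      (i ≫ pullback.snd _ _) ≫ lastSwap S.X₁ (sym S.X₃ n).obj = i ≫ pullback.snd _ _ := by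
  have := hS.mono_f
  let u := symKerι hS (n + 1)
  let a := sym S.X₂ (n + 2)
  let b := sym S.X₂ (n + 1)
  let c := sym S.X₃ (n + 1)
  have hu : u ≫ symθ S (n + 1) = 0 := symKerι_θ hS (n + 1)
  have hK := (symSeq_shortExact hS (n + 1)).map_of_exact (tensorRight S.X₂)
  have := hK.mono_f
  -- `u ≫ comult a b` lands in `K ⊗ X₂`, where `K` is the first step of the filtration; this is `k`.
  have hk : (u ≫ comult a b) ≫ symMap S.g b c ▷ S.X₂ = 0 := (assoc _ _ _).trans hu
  obtain ⟨k, hk⟩ : ∃ k : symKer hS (n + 1) ⟶ (symSeq S (n + 1)).X₁ ⊗ S.X₂,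
      k ≫ (symSeq S (n + 1)).f ▷ S.X₂ = u ≫ comult a b :=
    ⟨hK.exact.lift _ hk, hK.exact.lift_f _ _⟩
  have hR := tensorSeq_shortExact ((sym S.X₃ n).obj ⊗ S.X₁) hS
  have := hR.mono_f
  -- By symmetry of the comultiplication the last factor is killed by `g` too, which gives `p`.
  have hp : (k ≫ symφ hS n ▷ S.X₂) ≫ ((sym S.X₃ n).obj ⊗ S.X₁) ◁ S.g = 0 := by
    rw [← cancel_mono (((sym S.X₃ n).obj ◁ S.f) ▷ S.X₃), assoc, assoc, whisker_exchange,
      ← comp_whiskerRight_assoc, symφ_f, comp_whiskerRight_assoc, reassoc_of% hk, zero_comp]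
    exact comp_comult_relComult S.g a b _ c _ u hu
  obtain ⟨p, hp⟩ : ∃ p : symKer hS (n + 1) ⟶ ((sym S.X₃ n).obj ⊗ S.X₁) ⊗ S.X₁,
      p ≫ ((sym S.X₃ n).obj ⊗ S.X₁) ◁ S.f = k ≫ symφ hS n ▷ S.X₂ :=
    ⟨hR.exact.lift _ hp, hR.exact.lift_f _ _⟩
  let i : symKer hS (n + 1) ⟶ symPB hS n := pullback.lift k p hp.symm
  let m : symPB hS n ⟶ b.obj ⊗ S.X₂ := pullback.fst _ _ ≫ (symSeq S (n + 1)).f ▷ S.X₂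
  have him : i ≫ m = u ≫ comult a b := by rw [← hk, pullback.lift_fst_assoc]
  have him' : i ≫ pullback.fst _ _ ≫ (symSeq S (n + 1)).f ▷ S.X₂ = u ≫ comult a b := him
  -- Conversely the multiplication sends `symPB` to the second step of the filtration.
  have hm : (m ≫ b.ι ▷ S.X₂ ≫ a.πSucc) ≫ symθ S (n + 1) = 0 := by
    rw [assoc]
    refine comp_mult_relComult S.g a b (sym S.X₂ n) c (sym S.X₃ n) m ?_ ?_
    · rw [assoc, ← comp_whiskerRight, (symSeq S (n + 1)).zero,
        MonoidalPreadditive.zero_whiskerRight, comp_zero]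
    · have h := symPB_cond hS n
      have e : m ≫ symθ S n ▷ S.X₂ = pullback.snd _ _ ≫ ((sym S.X₃ n).obj ◁ S.f ⊗ₘ S.f) := by
        rw [assoc, h]
      rw [reassoc_of% e, MonoidalCategory.tensorHom_def, assoc, ← MonoidalCategory.whiskerLeft_comp,
        S.zero, MonoidalPreadditive.whiskerLeft_zero, comp_zero, comp_zero]
  obtain ⟨r, hr⟩ := exists_symKer_lift hS (n + 1) _ hm
  refine ⟨i, r, ?_, ?_⟩
  · have : Mono u := mono_comp _ _
    have hc : comult a b ≫ b.ι ▷ S.X₂ ≫ a.πSucc = 𝟙 _ := comult_mult a b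
    rw [← cancel_mono u, assoc, hr, ← assoc, him, assoc, hc, comp_id, id_comp]
  · have hM : Mono ((sym S.X₃ n).obj ◁ S.f ⊗ₘ S.f) := by
      rw [MonoidalCategory.tensorHom_def]
      exact mono_comp _ _
    have e : (i ≫ pullback.snd _ _) ≫ ((sym S.X₃ n).obj ◁ S.f ⊗ₘ S.f) =
        u ≫ comult a b ≫ symθ S n ▷ S.X₂ := by
      rw [assoc, ← symPB_cond, reassoc_of% him']
    have e' := tensorHom_lastSwap S.f (𝟙 (sym S.X₃ n).obj)
    rw [id_tensorHom] at e'
    rw [← cancel_mono ((sym S.X₃ n).obj ◁ S.f ⊗ₘ S.f), assoc, ← e', ← assoc, e, assoc,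
      comult_relComult_lastSwap]

end

section
open Functor.LaxMonoidal Functor.OplaxMonoidal Functor.Monoidal

variable {T : Type u'} [Category.{v'} T] [Preadditive T] [Linear ℚ T]
    [MonoidalCategory T] [SymmetricCategory T] [MonoidalPreadditive T]
    (F : A ⥤ T) [F.Additive] [F.Braided]

theorem isZero_map_tensor {X : A} (Y : A) (h : IsZero (F.obj X)) : IsZero (F.obj (X ⊗ Y)) :=
  ((tensorRight (F.obj Y)).map_isZero h).of_iso (μIso F X Y).symm

theorem map_lastSwap_eq {X : A} (hX : SymVanishes (F.obj X) 2) (Y : A) :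
    F.map (lastSwap X Y) = -𝟙 _ := by
  let e : (F.obj Y ⊗ F.obj X) ⊗ F.obj X ≅ F.obj ((Y ⊗ X) ⊗ X) :=
    whiskerRightIso (μIso F Y X) (F.obj X) ≪≫ μIso F (Y ⊗ X) X
  have h : e.hom ≫ F.map (lastSwap X Y) = lastSwap (F.obj X) (F.obj Y) ≫ e.hom :=
    μ_map_lastSwap F X Y
  rw [← cancel_epi e.hom, h, hX.lastSwap_eq, Preadditive.neg_comp, Preadditive.comp_neg, id_comp,
    comp_id]

/-- If `F` inverts epimorphisms whose kernel it kills, and the second symmetric power of `F X₁`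
vanishes, `F` kills the second step of the filtration of `Sym ^ (n + 1) X₂`. -/
theorem isZero_map_symKer
    (hF : ∀ {S : ShortComplex A}, S.ShortExact → IsZero (F.obj S.X₁) → IsIso (F.map S.g))
    (hU : SymVanishes (F.obj S.X₁) 2) : ∀ n : ℕ, IsZero (F.obj (symKer hS n))
  | 0 => by
    have := mono_symφ_zero hS
    exact F.map_isZero (isZero_kernel_of_mono _)
  | n + 1 => by
    have := epi_symφ hS n
    obtain ⟨i, r, h₁, h₂⟩ := exists_retract hS n
    let p : symPB hS n ⟶ ((sym S.X₃ n).obj ⊗ S.X₁) ⊗ S.X₁ := pullback.snd _ _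
    -- `p` is an epimorphism whose kernel is that of `symφ hS n ▷ X₂`, killed by `F` by induction.
    have hp : IsIso (F.map p) := by
      have ex : (ShortComplex.mk (kernel.ι p) p (kernel.condition p)).ShortExact :=
        ShortComplex.ShortExact.mk' (ShortComplex.exact_kernel _) inferInstance
          (inferInstanceAs (Epi (pullback.snd _ _)))
      refine hF ex ((isZero_map_tensor F S.X₂ (isZero_map_symKer hF hU n)).of_iso (F.mapIso ?_))
      exact kernelPullbackSndIso _ _ ≪≫ (PreservesKernel.iso (tensorRight S.X₂) (symφ hS n)).symm
    -- `F (i ≫ p)` is invariant under the exchange of the factors `X₁`, which acts by `-1`.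
    have hi : F.map (i ≫ p) = 0 := by
      have h := congrArg F.map h₂
      rw [F.map_comp, map_lastSwap_eq F hU, Preadditive.comp_neg, comp_id] at h
      rwa [neg_eq_iff_add_eq_zero, ← two_smul ℚ, smul_eq_zero_iff_right two_ne_zero] at h
    rw [IsZero.iff_id_eq_zero, ← F.map_id, ← h₁, F.map_comp]
    have : F.map i = 0 := by rw [← cancel_mono (F.map p), ← F.map_comp, hi, zero_comp]
    rw [this, zero_comp]

/-- `F` identifies the kernel of `Sym ^ (n + 1) X₂ ⟶ Sym ^ (n + 1) X₃` with `Sym ^ n X₃ ⊗ X₁`. -/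
theorem isIso_map_symφ
    (hF : ∀ {S : ShortComplex A}, S.ShortExact → IsZero (F.obj S.X₁) → IsIso (F.map S.g))
    (hU : SymVanishes (F.obj S.X₁) 2) (n : ℕ) : IsIso (F.map (symφ hS n)) := by
  have := epi_symφ hS n
  exact hF (ShortComplex.ShortExact.mk' (ShortComplex.exact_kernel (symφ hS n)) inferInstance
    inferInstance) (isZero_map_symKer hS F hF hU n)

end
end

/-! ### Naturality of the filtration -/

section
variable {A : Type u} [Category.{v} A] [Abelian A] [Linear ℚ A]
    [MonoidalCategory A] [SymmetricCategory A] [MonoidalPreadditive A] [MonoidalLinear ℚ A]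
    [∀ X : A, PreservesFiniteLimits (tensorLeft X)]
    [∀ X : A, PreservesFiniteColimits (tensorLeft X)]
    {S S' : ShortComplex A}

/-- The functoriality of `symSeq`. -/
noncomputable def symSeqMap (φ : S ⟶ S') (n : ℕ) : symSeq S n ⟶ symSeq S' n :=
  have h : symMap S.g (sym S.X₂ n) (sym S.X₃ n) ≫ symMap φ.τ₃ (sym S.X₃ n) (sym S'.X₃ n) =
      symMap φ.τ₂ (sym S.X₂ n) (sym S'.X₂ n) ≫ symMap S'.g (sym S'.X₂ n) (sym S'.X₃ n) := by
    rw [symMap_comp, symMap_comp, φ.comm₂₃]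
  { τ₁ := kernel.map _ _ (symMap φ.τ₂ _ _) (symMap φ.τ₃ _ _) h
    τ₂ := symMap φ.τ₂ _ _
    τ₃ := symMap φ.τ₃ _ _
    comm₁₂ := kernel.lift_ι _ _ _
    comm₂₃ := h.symm }

theorem symθ_naturality (φ : S ⟶ S') (n : ℕ) : symθ S n ≫ (symMap φ.τ₃ _ _ ⊗ₘ φ.τ₂) =
    symMap φ.τ₂ _ _ ≫ symθ S' n := by
  simp only [symθ, relComult, assoc, reassoc_of% (comult_naturality φ.τ₂ (sym S.X₂ (n + 1))
    (sym S.X₂ n) (sym S'.X₂ (n + 1)) (sym S'.X₂ n))]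
  rw [← tensorHom_id, ← tensorHom_id, tensorHom_comp_tensorHom, tensorHom_comp_tensorHom,
    symMap_comp, symMap_comp, φ.comm₂₃, comp_id, id_comp]

theorem symφ_naturality (hS : S.ShortExact) (hS' : S'.ShortExact) (φ : S ⟶ S') (n : ℕ) :
    symφ hS n ≫ (symMap φ.τ₃ _ _ ⊗ₘ φ.τ₁) = (symSeqMap φ (n + 1)).τ₁ ≫ symφ hS' n := by
  have := hS'.mono_f
  have h := (symSeqMap φ (n + 1)).comm₁₂
  rw [← cancel_mono ((sym S'.X₃ n).obj ◁ S'.f), assoc, assoc, symφ_f, reassoc_of% h,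
    ← id_tensorHom, tensorHom_comp_tensorHom, φ.comm₁₂, comp_id]
  have h₁ : (symMap φ.τ₃ (sym S.X₃ n) (sym S'.X₃ n) ⊗ₘ (S.f ≫ φ.τ₂)) =
      (sym S.X₃ n).obj ◁ S.f ≫ (symMap φ.τ₃ _ _ ⊗ₘ φ.τ₂) := by
    rw [← id_tensorHom, tensorHom_comp_tensorHom, id_comp]
  rw [h₁, reassoc_of% (symφ_f hS n), symθ_naturality]
  rfl

end

/-! ### Complexes in degree `0` -/

section
variable {A : Type u} [Category.{v} A] [Abelian A]

open HomologicalComplex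

/-- Objects of `A` as bounded complexes in degree `0`. -/
noncomputable def singleComplex (A : Type u) [Category.{v} A] [Abelian A] : A ⥤ BoundedComplex A :=
  (isBounded A).lift (CochainComplex.singleFunctor A 0) fun _ =>
    ⟨⟨0, inferInstance⟩, ⟨0, inferInstance⟩⟩

/-- The identification of the component of degree `0`. The degree is a variable `i` with `i = 0` so
that transports along equalities of degrees are avoided. -/
noncomputable def singleX (X : A) (i : ℤ) (h : i = 0) : ((singleComplex A).obj X).obj.X i ≅ X :=
  singleObjXIsoOfEq (.up ℤ) 0 X i h

theorem isZero_singleX (X : A) (i : ℤ) (h : i ≠ 0) : IsZero (((singleComplex A).obj X).obj.X i) :=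
  isZero_single_obj_X (.up ℤ) 0 X i h

theorem singleX_inv_map {X Y : A} (f : X ⟶ Y) :
    (singleX X 0 rfl).inv ≫ ((singleComplex A).map f).hom.f 0 = f ≫ (singleX Y 0 rfl).inv := by
  rw [Iso.inv_comp_eq]
  exact single_map_f_self (.up ℤ) 0 f

theorem singleX_inv_map_assoc {X Y : A} (f : X ⟶ Y) {Z : A}
    (h : ((singleComplex A).obj Y).obj.X 0 ⟶ Z) :
    (singleX X 0 rfl).inv ≫ ((singleComplex A).map f).hom.f 0 ≫ h =
      f ≫ (singleX Y 0 rfl).inv ≫ h := by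
  rw [← assoc, singleX_inv_map, assoc]

theorem singleComplex_hom_ext {X : A} {K : BoundedComplex A} {f g : (singleComplex A).obj X ⟶ K}
    (h : (singleX X 0 rfl).inv ≫ f.hom.f 0 = (singleX X 0 rfl).inv ≫ g.hom.f 0) : f = g := by
  ext : 1
  exact from_single_hom_ext ((cancel_epi (singleX X 0 rfl).inv).1 h)

variable [MonoidalCategory A] [MonoidalPreadditive A]

open GradedObject.Monoidal

/-- The component of degree `n` of the isomorphism between `R ⊗ L` and the tensor product of the
complex `R` with `L`. -/
noncomputable def singleTensorX (R : A) (L : BoundedComplex A) (n : ℤ) :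
    R ⊗ L.obj.X n ≅ GradedObject.Monoidal.tensorObj ((singleComplex A).obj R).obj.X L.obj.X n where
  hom := (singleX R 0 rfl).inv ▷ L.obj.X n ≫
    GradedObject.Monoidal.ιTensorObj ((singleComplex A).obj R).obj.X L.obj.X 0 n n (zero_add n)
  inv := tensorObjDesc (fun i j hij => if h : i = 0 then
      (singleX R i h).hom ▷ L.obj.X j ≫ eqToHom (by obtain rfl : j = n := by lia
                                                    rfl) else 0)
  hom_inv_id := by
    rw [assoc, ι_tensorObjDesc, dif_pos rfl, eqToHom_refl, comp_id, ← comp_whiskerRight,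
      Iso.inv_hom_id, id_whiskerRight]
  inv_hom_id := by
    refine tensorObj_ext _ _ (fun i j hij => ?_)
    rw [← assoc, ι_tensorObjDesc]
    split_ifs with h
    · subst h
      obtain rfl : j = n := by lia
      rw [eqToHom_refl, comp_id, ← comp_whiskerRight_assoc, Iso.hom_inv_id, id_whiskerRight,
        id_comp, comp_id]
    · exact (isZero_tensor_left (isZero_singleX R i h) _).eq_of_src _ _

theorem singleTensorX_comm (R : A) (L : BoundedComplex A) (n : ℤ) :
    (singleTensorX R L n).hom ≫ tensorD ((singleComplex A).obj R) L n =
      R ◁ L.obj.d n (n + 1) ≫ (singleTensorX R L (n + 1)).hom := by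
  have h : ((singleComplex A).obj R).obj.d 0 (0 + 1) = 0 := single_obj_d _ _ _ _ _
  dsimp only [singleTensorX]
  rw [assoc, ι_tensorD, h, MonoidalPreadditive.zero_whiskerRight, zero_comp, zero_add,
    Int.negOnePow_zero, one_smul, ← whisker_exchange_assoc]

/-- The tensor product with a complex in degree `0` is computed degreewise. -/
noncomputable def singleTensor (R : A) (L : BoundedComplex A) :
    ((tensorLeft R).mapHomologicalComplex (.up ℤ)).obj L.obj ≅
      ((singleComplex A).obj R ⊗ L).obj :=
  Hom.isoOfComponents (singleTensorX R L) (by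
    rintro n _ rfl
    exact singleTensorX_comm R L n)

theorem singleTensor_naturality_right (R : A) {L L' : BoundedComplex A} (f : L ⟶ L') :
    ((tensorLeft R).mapHomologicalComplex (.up ℤ)).map f.hom ≫ (singleTensor R L').hom =
      (singleTensor R L).hom ≫ ((singleComplex A).obj R ◁ f).hom := by
  ext n
  change R ◁ f.hom.f n ≫ (singleTensorX R L' n).hom = (singleTensorX R L n).hom ≫
    GradedObject.Monoidal.tensorHom (𝟙 _) f.hom.f n
  dsimp only [singleTensorX]
  rw [assoc, ι_tensorHom, GradedObject.categoryOfGradedObjects_id, MonoidalCategory.id_tensorHom,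
    whisker_exchange_assoc]

theorem singleTensor_naturality_left {R R' : A} (r : R ⟶ R') (L : BoundedComplex A) :
    (NatTrans.mapHomologicalComplex ((tensoringLeft A).map r) (.up ℤ)).app L.obj ≫
      (singleTensor R' L).hom =
      (singleTensor R L).hom ≫ ((singleComplex A).map r ▷ L).hom := by
  ext n
  change r ▷ L.obj.X n ≫ (singleTensorX R' L n).hom = (singleTensorX R L n).hom ≫
    GradedObject.Monoidal.tensorHom ((singleComplex A).map r).hom.f (𝟙 _) n
  dsimp only [singleTensorX]
  rw [assoc, ι_tensorHom, GradedObject.categoryOfGradedObjects_id, MonoidalCategory.tensorHom_id,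
    ← comp_whiskerRight_assoc, ← comp_whiskerRight_assoc, singleX_inv_map]

/-- The identification of `X ⊗ Y`, in degree `0`, with the tensor product of the complexes `X` and
`Y` in degree `0`. -/
noncomputable def singleδ (X Y : A) :
    (singleComplex A).obj (X ⊗ Y) ≅ (singleComplex A).obj X ⊗ (singleComplex A).obj Y :=
  ObjectProperty.isoMk _ ((singleMapHomologicalComplex (tensorLeft X) (.up ℤ) 0).symm.app Y ≪≫
    singleTensor X ((singleComplex A).obj Y))

/-- `singleδ` is characterized by its component of degree `0`. -/
theorem singleδ_hom_f (X Y : A) : (singleX (X ⊗ Y) 0 rfl).inv ≫ (singleδ X Y).hom.hom.f 0 =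
    ((singleX X 0 rfl).inv ⊗ₘ (singleX Y 0 rfl).inv) ≫ ιTensorObj ((singleComplex A).obj X).obj.X
      ((singleComplex A).obj Y).obj.X 0 0 0 (zero_add 0) := by
  have h := singleMapHomologicalComplex_inv_app_self (tensorLeft X) (.up ℤ) (0 : ℤ) Y
  have e : (singleδ X Y).hom.hom.f 0 = ((singleX (X ⊗ Y) 0 rfl).hom ≫
      X ◁ (singleX Y 0 rfl).inv) ≫ (singleTensorX X ((singleComplex A).obj Y) 0).hom :=
    congrArg (· ≫ (singleTensorX X ((singleComplex A).obj Y) 0).hom) h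
  refine (congrArg (fun t : ((singleComplex A).obj (X ⊗ Y)).obj.X 0 ⟶
    GradedObject.Monoidal.tensorObj ((singleComplex A).obj X).obj.X
      ((singleComplex A).obj Y).obj.X 0 => (singleX (X ⊗ Y) 0 rfl).inv ≫ t) e).trans ?_
  rw [assoc, Iso.inv_hom_id_assoc, singleTensorX, whisker_exchange_assoc,
    MonoidalCategory.tensorHom_def, assoc]

-- The coherence of `singleδ` reduces to identities between morphisms from objects of `A` to the
-- components of degree `0` of tensor products of graded objects.
section
variable {x x' y y' z xy yz e : GradedObject ℤ A} [IsBdd x] [IsBdd x'] [IsBdd y] [IsBdd y']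
  [IsBdd z] [IsBdd xy] [IsBdd yz] [IsBdd e] {X X' Y Y' Z : A} {a : X ⟶ x 0} {a' : X' ⟶ x' 0}
  {b : Y ⟶ y 0} {b' : Y' ⟶ y' 0} {c : Z ⟶ z 0}

theorem tensorHom_ι_tensorHom {f : X ⟶ X'} {g : Y ⟶ Y'} {φ : x ⟶ x'} {ψ : y ⟶ y'}
    (hf : a ≫ φ 0 = f ≫ a') (hg : b ≫ ψ 0 = g ≫ b') :
    (f ⊗ₘ g) ≫ (a' ⊗ₘ b') ≫ ιTensorObj x' y' 0 0 0 (zero_add 0) =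
      ((a ⊗ₘ b) ≫ ιTensorObj x y 0 0 0 (zero_add 0)) ≫ GradedObject.Monoidal.tensorHom φ ψ 0 := by
  rw [assoc, ι_tensorHom, MonoidalCategory.tensorHom_comp_tensorHom_assoc,
    MonoidalCategory.tensorHom_comp_tensorHom_assoc, hf, hg]

theorem leftUnitor_inv_ι (u : 𝟙_ A ⟶ e 0) :
    a ≫ (λ_ (x 0)).inv ≫ u ▷ x 0 ≫ ιTensorObj e x 0 0 0 (zero_add 0) =
      (λ_ X).inv ≫ (u ⊗ₘ a) ≫ ιTensorObj e x 0 0 0 (zero_add 0) := by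
  rw [MonoidalCategory.tensorHom_def', assoc, leftUnitor_inv_naturality_assoc]

theorem rightUnitor_inv_ι (u : 𝟙_ A ⟶ e 0) :
    a ≫ (ρ_ (x 0)).inv ≫ x 0 ◁ u ≫ ιTensorObj x e 0 0 0 (zero_add 0) =
      (ρ_ X).inv ≫ (a ⊗ₘ u) ≫ ιTensorObj x e 0 0 0 (zero_add 0) := by
  rw [MonoidalCategory.tensorHom_def, assoc, rightUnitor_inv_naturality_assoc]

theorem tensorHom_ι_associator {δ : xy ⟶ GradedObject.Monoidal.tensorObj x y} {ab : X ⊗ Y ⟶ xy 0}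
    (h : ab ≫ δ 0 = (a ⊗ₘ b) ≫ ιTensorObj x y 0 0 0 (zero_add 0))
    {δ' : yz ⟶ GradedObject.Monoidal.tensorObj y z} {bc : Y ⊗ Z ⟶ yz 0}
    (h' : bc ≫ δ' 0 = (b ⊗ₘ c) ≫ ιTensorObj y z 0 0 0 (zero_add 0)) :
    ((ab ⊗ₘ c) ≫ ιTensorObj xy z 0 0 0 (zero_add 0)) ≫
      GradedObject.Monoidal.tensorHom δ (𝟙 z) 0 ≫ (GradedObject.Monoidal.associator x y z).hom 0 =
    (α_ X Y Z).hom ≫ ((a ⊗ₘ bc) ≫ ιTensorObj x yz 0 0 0 (zero_add 0)) ≫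
      GradedObject.Monoidal.tensorHom (𝟙 x) δ' 0 := by
  rw [assoc, ι_tensorHom_assoc, MonoidalCategory.tensorHom_comp_tensorHom_assoc, assoc, ι_tensorHom,
    MonoidalCategory.tensorHom_comp_tensorHom_assoc, h, h', GradedObject.categoryOfGradedObjects_id,
    GradedObject.categoryOfGradedObjects_id, comp_id, comp_id]
  have e₁ : ((a ⊗ₘ b) ≫ ιTensorObj x y 0 0 0 (zero_add 0) ⊗ₘ c) =
      ((a ⊗ₘ b) ⊗ₘ c) ≫ ιTensorObj x y 0 0 0 (zero_add 0) ▷ z 0 := by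
    rw [← MonoidalCategory.tensorHom_id, MonoidalCategory.tensorHom_comp_tensorHom, comp_id]
  have e₂ : (a ⊗ₘ (b ⊗ₘ c) ≫ ιTensorObj y z 0 0 0 (zero_add 0)) =
      (a ⊗ₘ b ⊗ₘ c) ≫ x 0 ◁ ιTensorObj y z 0 0 0 (zero_add 0) := by
    rw [← MonoidalCategory.id_tensorHom, MonoidalCategory.tensorHom_comp_tensorHom, comp_id]
  rw [e₁, e₂, assoc, assoc, ← ιTensorObj₃'_eq_assoc x y z 0 0 0 0 rfl 0 rfl,
    ιTensorObj₃'_associator_hom, ← ιTensorObj₃_eq x y z 0 0 0 0 rfl 0 rfl,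
    MonoidalCategory.associator_naturality_assoc]

end

theorem singleδ_naturality {X X' Y Y' : A} (f : X ⟶ X') (g : Y ⟶ Y') :
    (singleComplex A).map (f ⊗ₘ g) ≫ (singleδ X' Y').hom =
      (singleδ X Y).hom ≫ ((singleComplex A).map f ⊗ₘ (singleComplex A).map g) := by
  refine singleComplex_hom_ext ?_
  refine (singleX_inv_map_assoc _ _).trans ?_
  refine (congrArg (fun t => (f ⊗ₘ g) ≫ t) (singleδ_hom_f _ _)).trans ?_
  refine Eq.trans ?_ (assoc _ _ _)
  refine Eq.trans ?_ (congrArg (fun t => t ≫ GradedObject.Monoidal.tensorHom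
    ((singleComplex A).map f).hom.f ((singleComplex A).map g).hom.f 0) (singleδ_hom_f _ _).symm)
  exact tensorHom_ι_tensorHom (singleX_inv_map f) (singleX_inv_map g)

theorem singleδ_left_unitality (X : A) : (λ_ ((singleComplex A).obj X)).inv =
    (singleComplex A).map (λ_ X).inv ≫ (singleδ (𝟙_ A) X).hom := by
  refine singleComplex_hom_ext ?_
  refine Eq.trans ?_ (singleX_inv_map_assoc _ _).symm
  refine Eq.trans ?_ (congrArg (fun t => (λ_ X).inv ≫ t) (singleδ_hom_f _ _)).symm
  refine (congrArg (fun t => (singleX X 0 rfl).inv ≫ t)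
    (leftUnitor'_inv ((singleComplex A).obj X).obj 0)).trans ?_
  exact leftUnitor_inv_ι (e := ((singleComplex A).obj (𝟙_ A)).obj.X) _

theorem singleδ_right_unitality (X : A) : (ρ_ ((singleComplex A).obj X)).inv =
    (singleComplex A).map (ρ_ X).inv ≫ (singleδ X (𝟙_ A)).hom := by
  refine singleComplex_hom_ext ?_
  refine Eq.trans ?_ (singleX_inv_map_assoc _ _).symm
  refine Eq.trans ?_ (congrArg (fun t => (ρ_ X).inv ≫ t) (singleδ_hom_f _ _)).symm
  refine (congrArg (fun t => (singleX X 0 rfl).inv ≫ t)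
    (rightUnitor'_inv ((singleComplex A).obj X).obj 0)).trans ?_
  exact rightUnitor_inv_ι (e := ((singleComplex A).obj (𝟙_ A)).obj.X) _

theorem singleδ_associativity (X Y Z : A) :
    (singleδ (X ⊗ Y) Z).hom ≫ (singleδ X Y).hom ▷ (singleComplex A).obj Z ≫ (α_ _ _ _).hom =
      (singleComplex A).map (α_ X Y Z).hom ≫ (singleδ X (Y ⊗ Z)).hom ≫
        (singleComplex A).obj X ◁ (singleδ Y Z).hom := by
  refine singleComplex_hom_ext ?_
  refine (assoc _ _ _).symm.trans ?_
  refine (congrArg (fun t => t ≫ GradedObject.Monoidal.tensorHom (singleδ X Y).hom.hom.f (𝟙 _) 0 ≫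
    (GradedObject.Monoidal.associator ((singleComplex A).obj X).obj.X
      ((singleComplex A).obj Y).obj.X ((singleComplex A).obj Z).obj.X).hom 0)
    (singleδ_hom_f _ _)).trans ?_
  refine Eq.trans ?_ (singleX_inv_map_assoc _ _).symm
  refine Eq.trans ?_ (congrArg (fun t => (α_ X Y Z).hom ≫ t) (assoc _ _ _))
  refine Eq.trans ?_ (congrArg (fun t => (α_ X Y Z).hom ≫ t ≫ GradedObject.Monoidal.tensorHom
    (𝟙 ((singleComplex A).obj X).obj.X) (singleδ Y Z).hom.hom.f 0) (singleδ_hom_f _ _)).symm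
  exact tensorHom_ι_associator (singleδ_hom_f X Y) (singleδ_hom_f Y Z)

/-- The monoidal structure on the inclusion of the objects of `A` as complexes in degree `0`. -/
noncomputable def singleCoreMonoidal : (singleComplex A).CoreMonoidal where
  εIso := Iso.refl ((singleComplex A).obj (𝟙_ A))
  μIso X Y := (singleδ X Y).symm
  μIso_hom_natural_left f X := by
    have h := singleδ_naturality f (𝟙 X)
    rw [MonoidalCategory.tensorHom_id, (singleComplex A).map_id, MonoidalCategory.tensorHom_id] at h
    rw [Iso.symm_hom, Iso.symm_hom, Iso.eq_inv_comp, ← assoc, ← h, assoc, Iso.hom_inv_id, comp_id]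
  μIso_hom_natural_right X f := by
    have h := singleδ_naturality (𝟙 X) f
    rw [MonoidalCategory.id_tensorHom, (singleComplex A).map_id, MonoidalCategory.id_tensorHom] at h
    rw [Iso.symm_hom, Iso.symm_hom, Iso.eq_inv_comp, ← assoc, ← h, assoc, Iso.hom_inv_id, comp_id]
  associativity X Y Z := by
    have h := singleδ_associativity X Y Z
    simp only [Iso.symm_hom]
    rw [← cancel_epi ((singleδ X Y).hom ▷ (singleComplex A).obj Z),
      ← cancel_epi (singleδ (X ⊗ Y) Z).hom, reassoc_of% h, hom_inv_whiskerRight_assoc,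
      Iso.hom_inv_id_assoc, ← MonoidalCategory.whiskerLeft_comp_assoc, Iso.hom_inv_id,
      MonoidalCategory.whiskerLeft_id, id_comp, Iso.hom_inv_id, comp_id]
  left_unitality X := by
    have h := singleδ_left_unitality X
    have e : (Iso.refl ((singleComplex A).obj (𝟙_ A))).hom ▷ (singleComplex A).obj X = 𝟙 _ :=
      id_whiskerRight _ _
    rw [Iso.symm_hom]
    refine Eq.trans ?_ ((congrArg (fun t => t ≫ _) e).trans (id_comp _)).symm
    exact congrArg Iso.inv (Iso.ext h : (λ_ ((singleComplex A).obj X)).symm =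
      ((singleComplex A).mapIso (λ_ X)).symm ≪≫ singleδ (𝟙_ A) X)
  right_unitality X := by
    have h := singleδ_right_unitality X
    have e : (singleComplex A).obj X ◁ (Iso.refl ((singleComplex A).obj (𝟙_ A))).hom = 𝟙 _ :=
      MonoidalCategory.whiskerLeft_id _ _
    rw [Iso.symm_hom]
    refine Eq.trans ?_ ((congrArg (fun t => t ≫ _) e).trans (id_comp _)).symm
    exact congrArg Iso.inv (Iso.ext h : (ρ_ ((singleComplex A).obj X)).symm =
      ((singleComplex A).mapIso (ρ_ X)).symm ≪≫ singleδ X (𝟙_ A))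

noncomputable instance : (singleComplex A).Monoidal := singleCoreMonoidal.toMonoidal

open Functor.LaxMonoidal Functor.OplaxMonoidal Functor.Monoidal

theorem μ_singleComplex (X Y : A) : μ (singleComplex A) X Y = (singleδ X Y).inv := rfl

variable [SymmetricCategory A]

theorem singleδ_braiding (X Y : A) : (singleδ X Y).hom ≫ (β_ _ _).hom =
    (singleComplex A).map (β_ X Y).hom ≫ (singleδ Y X).hom := by
  refine singleComplex_hom_ext ?_
  refine (assoc _ _ _).symm.trans ?_
  refine (congrArg (fun t => t ≫ swap ((singleComplex A).obj X).obj.X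
      ((singleComplex A).obj Y).obj.X 0) (singleδ_hom_f _ _)).trans ?_
  refine Eq.trans ?_ (singleX_inv_map_assoc _ _).symm
  refine Eq.trans ?_ (congrArg (fun t => (β_ X Y).hom ≫ t) (singleδ_hom_f _ _)).symm
  rw [assoc, ι_swap, mul_zero, Int.negOnePow_zero, one_smul,
    BraidedCategory.braiding_naturality_assoc]
  rfl

noncomputable instance : (singleComplex A).Braided where
  braided X Y := by
    rw [μ_singleComplex, μ_singleComplex, Iso.inv_comp_eq, ← assoc, singleδ_braiding, assoc,
      Iso.hom_inv_id, comp_id]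

end

section
variable {A : Type u} [Category.{v} A] [Abelian A]
    [MonoidalCategory A] [SymmetricCategory A] [MonoidalPreadditive A]
    [∀ X : A, PreservesFiniteLimits (tensorLeft X)]
    [∀ X : A, PreservesFiniteColimits (tensorLeft X)] [HasDerivedCategory.{w} A]

-- The bounded derived category is a monoidal localization of bounded complexes, and `single A` is
-- the composition of `singleComplex A` with the localization functor.
noncomputable instance : (single A).Braided :=
  inferInstanceAs (singleComplex A ⋙ Qb A).Braided

end

/-! ### Natural transformations between derived functors of exact functors -/

section
open Localization

/-- A natural transformation between functors on a localized category commutes with shifts if it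
does so before the localization. -/
theorem commShift_of_whiskerLeft {C D E M : Type*} [Category* C] [Category* D] [Category* E]
    [AddMonoid M] [HasShift C M] [HasShift D M] [HasShift E M] (L : C ⥤ D)
    (W : MorphismProperty C) [L.IsLocalization W] [L.CommShift M] {F G : D ⥤ E} [F.CommShift M]
    [G.CommShift M] (σ : F ⟶ G) [NatTrans.CommShift (Functor.whiskerLeft L σ) M] :
    NatTrans.CommShift σ M where
  shift_comm a := natTrans_ext L W fun X => by
    have h := NatTrans.shift_app_comm (Functor.whiskerLeft L σ) a X
    rw [Functor.commShiftIso_comp_hom_app, Functor.commShiftIso_comp_hom_app] at h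
    rw [← cancel_epi (F.map ((L.commShiftIso a).hom.app X))]
    refine (assoc _ _ _).symm.trans (h.trans ?_)
    refine (assoc _ _ _).symm.trans (Eq.trans ?_ (assoc _ _ _))
    exact congrArg (fun t => t ≫ _) (σ.naturality _).symm

instance commShift_mapHomologicalComplex {A B : Type*} [Category* A] [Category* B] [Preadditive A]
    [Preadditive B] {F G : A ⥤ B} [F.Additive] [G.Additive] (α : F ⟶ G) :
    NatTrans.CommShift (NatTrans.mapHomologicalComplex α (.up ℤ)) ℤ where
  shift_comm n := by
    ext K i
    exact (id_comp _).trans (comp_id _).symm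

theorem singleMapHomologicalComplex_naturality {A B : Type*} [Category* A]
    [Category* B] [Abelian A] [Abelian B] {F G : A ⥤ B} [F.Additive] [G.Additive] (α : F ⟶ G)
    {ι : Type*} [DecidableEq ι] (c : ComplexShape ι)
    (j : ι) (X : A) :
    (HomologicalComplex.singleMapHomologicalComplex F c j).hom.app X ≫
        (HomologicalComplex.single B c j).map (α.app X) =
      (NatTrans.mapHomologicalComplex α c).app ((HomologicalComplex.single A c j).obj X) ≫
        (HomologicalComplex.singleMapHomologicalComplex G c j).hom.app X := by
  apply HomologicalComplex.to_single_hom_ext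
  have h₁ := HomologicalComplex.singleMapHomologicalComplex_hom_app_self F c j X
  have h₂ := HomologicalComplex.singleMapHomologicalComplex_hom_app_self G c j X
  have h₃ := HomologicalComplex.single_map_f_self c j (α.app X)
  refine (congr (congrArg CategoryStruct.comp h₁) h₃).trans
    (Eq.trans ?_ (congrArg (fun t => α.app _ ≫ t) h₂).symm)
  exact (assoc _ _ _).trans ((congrArg (fun t => F.map _ ≫ t) (Iso.inv_hom_id_assoc _ _)).trans
    (α.naturality_assoc _ _))

end

section
open Localization DerivedCategory

variable {A B : Type*} [Category* A] [Category* B] [Abelian A] [Abelian B]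
  [HasDerivedCategory A] [HasDerivedCategory B]
  {F G : A ⥤ B} [F.Additive] [PreservesFiniteLimits F] [PreservesFiniteColimits F]
  [G.Additive] [PreservesFiniteLimits G] [PreservesFiniteColimits G] (α : F ⟶ G)

/-- The natural transformation on derived categories induced by a natural transformation between
exact functors. -/
noncomputable def mapDerivedCategoryHom : F.mapDerivedCategory ⟶ G.mapDerivedCategory :=
  liftNatTrans Q (HomologicalComplex.quasiIso A (.up ℤ)) (F.mapHomologicalComplex _ ⋙ Q)
    (G.mapHomologicalComplex _ ⋙ Q) _ _
    (Functor.whiskerRight (NatTrans.mapHomologicalComplex α (.up ℤ)) Q)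

theorem mapDerivedCategoryHom_app (K : CochainComplex A ℤ) :
    (mapDerivedCategoryHom α).app (Q.obj K) = F.mapDerivedCategoryFactors.hom.app K ≫
      Q.map ((NatTrans.mapHomologicalComplex α (.up ℤ)).app K) ≫
      G.mapDerivedCategoryFactors.inv.app K :=
  liftNatTrans_app ..

instance : NatTrans.CommShift (mapDerivedCategoryHom α) ℤ := by
  have h : Functor.whiskerLeft Q (mapDerivedCategoryHom α) = F.mapDerivedCategoryFactors.hom ≫
      Functor.whiskerRight (NatTrans.mapHomologicalComplex α (.up ℤ)) Q ≫
      G.mapDerivedCategoryFactors.inv := by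
    ext K
    exact mapDerivedCategoryHom_app α K
  have : NatTrans.CommShift (Functor.whiskerLeft Q (mapDerivedCategoryHom α)) ℤ := by
    rw [h]
    infer_instance
  exact commShift_of_whiskerLeft Q (HomologicalComplex.quasiIso A (.up ℤ)) _

theorem mapDerivedCategorySingleFunctor_hom_app (F : A ⥤ B) [F.Additive] [PreservesFiniteLimits F]
    [PreservesFiniteColimits F] (X : A) : (F.mapDerivedCategorySingleFunctor 0).hom.app X =
    F.mapDerivedCategoryFactors.hom.app ((HomologicalComplex.single A (.up ℤ) 0).obj X) ≫
      Q.map ((HomologicalComplex.singleMapHomologicalComplex F (.up ℤ) 0).hom.app X) :=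
  ((congrArg (fun t => F.mapDerivedCategoryFactors.hom.app _ ≫ t)
    (F.mapDerivedCategoryFactors_inv_app_mapDerivedCategorySingleFunctor_hom_app X)).symm.trans
    (Iso.hom_inv_id_app_assoc _ _ _)).symm

theorem mapDerivedCategorySingleFunctor_naturality (X : A) :
    (F.mapDerivedCategorySingleFunctor 0).hom.app X ≫ (singleFunctor B 0).map (α.app X) =
      (mapDerivedCategoryHom α).app ((singleFunctor A 0).obj X) ≫
        (G.mapDerivedCategorySingleFunctor 0).hom.app X := by
  let K := (HomologicalComplex.single A (.up ℤ) 0).obj X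
  have h := congrArg (fun t => Q.map t) (singleMapHomologicalComplex_naturality α (.up ℤ) 0 X)
  simp only [Functor.map_comp] at h
  refine (congrArg (fun t => t ≫ _) (mapDerivedCategorySingleFunctor_hom_app F X)).trans ?_
  refine Eq.trans ?_ (congr (congrArg CategoryStruct.comp (mapDerivedCategoryHom_app α K))
    (mapDerivedCategorySingleFunctor_hom_app G X)).symm
  refine (assoc _ _ _).trans
    ((congrArg (fun t => F.mapDerivedCategoryFactors.hom.app K ≫ t) h).trans ?_)
  exact ((assoc _ _ _).trans (congrArg (fun t => F.mapDerivedCategoryFactors.hom.app K ≫ t)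
    ((assoc _ _ _).trans (congrArg (fun t => Q.map _ ≫ t)
      (Iso.inv_hom_id_app_assoc G.mapDerivedCategoryFactors K _))))).symm

end

/-! ### The derived tensor product with an object in degree `0` -/

section
open Functor.LaxMonoidal Functor.OplaxMonoidal Functor.Monoidal DerivedCategory Localization
variable {A : Type u} [Category.{v} A] [Abelian A]
    [MonoidalCategory A] [SymmetricCategory A] [MonoidalPreadditive A]
    [∀ X : A, PreservesFiniteLimits (tensorLeft X)]
    [∀ X : A, PreservesFiniteColimits (tensorLeft X)] [HasDerivedCategory.{w} A]

/-- On bounded complexes, the derived tensor product with an object of `A` is computed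
degreewise. -/
noncomputable def tensorSingleQb (R : A) (L : BoundedComplex A) :
    Bounded.ι.obj ((single A).obj R ⊗ (Qb A).obj L) ≅
      (tensorLeft R).mapDerivedCategory.obj (Bounded.ι.obj ((Qb A).obj L)) :=
  Bounded.ι.mapIso (μIso (Qb A) ((singleComplex A).obj R) L) ≪≫
    Q.mapIso (singleTensor R L).symm ≪≫
    ((tensorLeft R).mapDerivedCategoryFactors.app L.obj).symm

theorem tensorSingleQb_naturality (R : A) {L L' : BoundedComplex A} (f : L ⟶ L') :
    Bounded.ι.map ((single A).obj R ◁ (Qb A).map f) ≫ (tensorSingleQb R L').hom =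
      (tensorSingleQb R L).hom ≫
        (tensorLeft R).mapDerivedCategory.map (Bounded.ι.map ((Qb A).map f)) := by
  let s := (singleComplex A).obj R
  have h₁ := congrArg (fun t => Bounded.ι.map t) (μ_natural_right (Qb A) s f)
  have h₂ : Q.map (s ◁ f).hom ≫ Q.map (singleTensor R L').inv =
      Q.map (singleTensor R L).inv ≫
        Q.map (((tensorLeft R).mapHomologicalComplex (.up ℤ)).map f.hom) := by
    rw [← Q.map_comp, ← Q.map_comp]
    exact congrArg (fun t => Q.map t) ((Iso.comp_inv_eq _).2 (((Iso.eq_inv_comp _).2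
      (singleTensor_naturality_right R f).symm).trans (assoc _ _ _).symm))
  have h₃ := (tensorLeft R).mapDerivedCategoryFactors.inv.naturality f.hom
  simp only [Functor.map_comp] at h₁
  refine ((assoc _ _ _).symm.trans (congrArg (fun t => t ≫ _) h₁)).trans ?_
  refine (assoc _ _ _).trans (Eq.trans ?_ (assoc _ _ _).symm)
  refine congrArg (fun t => Bounded.ι.map (μ (Qb A) s L) ≫ t) ?_
  refine ((assoc _ _ _).symm.trans (congrArg (fun t => t ≫ _) h₂)).trans ?_
  refine (assoc _ _ _).trans (Eq.trans ?_ (assoc _ _ _).symm)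
  exact congrArg (fun t => Q.map (singleTensor R L).inv ≫ t) h₃

theorem tensorSingleQb_naturality_left {R R' : A} (r : R ⟶ R') (L : BoundedComplex A) :
    Bounded.ι.map ((single A).map r ▷ (Qb A).obj L) ≫ (tensorSingleQb R' L).hom =
      (tensorSingleQb R L).hom ≫
        (mapDerivedCategoryHom ((tensoringLeft A).map r)).app (Bounded.ι.obj ((Qb A).obj L)) := by
  let s := (singleComplex A).obj R
  let α := (tensoringLeft A).map r
  have h₁ := congrArg (fun t => Bounded.ι.map t)
    (μ_natural_left (Qb A) ((singleComplex A).map r) L)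
  have h₂ : Q.map ((singleComplex A).map r ▷ L).hom ≫ Q.map (singleTensor R' L).inv =
      Q.map (singleTensor R L).inv ≫
        Q.map ((NatTrans.mapHomologicalComplex α (.up ℤ)).app L.obj) := by
    rw [← Q.map_comp, ← Q.map_comp]
    exact congrArg (fun t => Q.map t) ((Iso.comp_inv_eq _).2 (((Iso.eq_inv_comp _).2
      (singleTensor_naturality_left r L).symm).trans (assoc _ _ _).symm))
  have h₃ : Q.map ((NatTrans.mapHomologicalComplex α (.up ℤ)).app L.obj) ≫
      (tensorLeft R').mapDerivedCategoryFactors.inv.app L.obj =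
      (tensorLeft R).mapDerivedCategoryFactors.inv.app L.obj ≫
        (mapDerivedCategoryHom α).app (Q.obj L.obj) := by
    refine Eq.trans ?_ (congrArg (fun t => _ ≫ t) (mapDerivedCategoryHom_app α L.obj)).symm
    exact (Iso.inv_hom_id_app_assoc (tensorLeft R).mapDerivedCategoryFactors L.obj _).symm
  simp only [Functor.map_comp] at h₁
  refine ((assoc _ _ _).symm.trans (congrArg (fun t => t ≫ _) h₁)).trans ?_
  refine (assoc _ _ _).trans (Eq.trans ?_ (assoc _ _ _).symm)
  refine congrArg (fun t => Bounded.ι.map (μ (Qb A) s L) ≫ t) ?_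
  refine ((assoc _ _ _).symm.trans (congrArg (fun t => t ≫ _) h₂)).trans ?_
  refine (assoc _ _ _).trans (Eq.trans ?_ (assoc _ _ _).symm)
  exact congrArg (fun t => Q.map (singleTensor R L).inv ≫ t) h₃

/-- The derived tensor product with an object `R` of `A` is induced by the exact functor
`R ⊗ -`. -/
noncomputable def tensorSingle (R : A) : tensorLeft ((single A).obj R) ⋙ Bounded.ι ≅
    Bounded.ι ⋙ (tensorLeft R).mapDerivedCategory :=
  letI : Lifting (Qb A) (quasiIso A) (Qb A ⋙ tensorLeft ((single A).obj R) ⋙ Bounded.ι)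
    (tensorLeft ((single A).obj R) ⋙ Bounded.ι) := ⟨Iso.refl _⟩
  letI : Lifting (Qb A) (quasiIso A) (Qb A ⋙ Bounded.ι ⋙ (tensorLeft R).mapDerivedCategory)
    (Bounded.ι ⋙ (tensorLeft R).mapDerivedCategory) := ⟨Iso.refl _⟩
  liftNatIso (Qb A) (quasiIso A) (Qb A ⋙ tensorLeft ((single A).obj R) ⋙ Bounded.ι)
    (Qb A ⋙ Bounded.ι ⋙ (tensorLeft R).mapDerivedCategory) _ _
    (NatIso.ofComponents (tensorSingleQb R) (tensorSingleQb_naturality R))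

theorem tensorSingle_app (R : A) (L : BoundedComplex A) :
    (tensorSingle R).hom.app ((Qb A).obj L) = (tensorSingleQb R L).hom :=
  (liftNatTrans_app ..).trans ((id_comp _).trans (comp_id _))

/-- `tensorSingle` is natural in the object of `A`. -/
theorem tensorSingle_naturality_left {R R' : A} (r : R ⟶ R') (Z : Bounded A) :
    Bounded.ι.map ((single A).map r ▷ Z) ≫ (tensorSingle R').hom.app Z =
      (tensorSingle R).hom.app Z ≫
        (mapDerivedCategoryHom ((tensoringLeft A).map r)).app (Bounded.ι.obj Z) := by
  let t : tensorLeft ((single A).obj R) ⋙ Bounded.ι ⟶ tensorLeft ((single A).obj R') ⋙ Bounded.ι :=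
    Functor.whiskerRight ((tensoringLeft (Bounded A)).map ((single A).map r)) Bounded.ι
  have h : t ≫ (tensorSingle R').hom = (tensorSingle R).hom ≫
      Functor.whiskerLeft Bounded.ι (mapDerivedCategoryHom ((tensoringLeft A).map r)) :=
    natTrans_ext (Qb A) (quasiIso A) fun L => by
      refine (congrArg (fun s => _ ≫ s) (tensorSingle_app R' L)).trans
        (Eq.trans ?_ (congrArg (fun s => s ≫ _) (tensorSingle_app R L)).symm)
      exact tensorSingleQb_naturality_left r L
  exact NatTrans.congr_app h Z

/-- On objects in degree `0`, `tensorSingle` is the monoidal structure of `single A`. -/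
theorem tensorSingle_single (R U : A) :
    (tensorSingle R).hom.app ((single A).obj U) ≫
      ((tensorLeft R).mapDerivedCategorySingleFunctor 0).hom.app U =
    Bounded.ι.map (μ (single A) R U) := by
  let K := (singleComplex A).obj U
  refine (congr (congrArg CategoryStruct.comp (tensorSingle_app R K))
    (mapDerivedCategorySingleFunctor_hom_app (tensorLeft R) U)).trans ?_
  have h : μ (single A) R U = μ (Qb A) ((singleComplex A).obj R) K ≫
    (Qb A).map (singleδ R U).inv := rfl
  refine Eq.trans ?_ ((congrArg (fun t => Bounded.ι.map t) h).trans (Functor.map_comp _ _ _)).symm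
  refine (assoc _ _ _).trans (congrArg (fun t => Bounded.ι.map (μ (Qb A) _ K) ≫ t) ?_)
  refine (assoc _ _ _).trans ?_
  refine (congrArg (fun t => Q.map (singleTensor R K).inv ≫ t)
    (Iso.inv_hom_id_app_assoc (tensorLeft R).mapDerivedCategoryFactors K.obj _)).trans ?_
  exact (Q.map_comp _ _).symm

end

/-! ### Extension classes and the tensor product -/

section
open Functor.LaxMonoidal Functor.OplaxMonoidal Functor.Monoidal DerivedCategory Pretriangulated
variable {A : Type u} [Category.{v} A] [Abelian A] [HasDerivedCategory.{w} A]

theorem comp₃_naturality {C : Type*} [Category* C] {X₁ X₂ X₃ X₄ Y₁ Y₂ Y₃ Y₄ : C} {f₁ : X₁ ⟶ X₂}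
    {f₂ : X₂ ⟶ X₃} {f₃ : X₃ ⟶ X₄} {g₁ : Y₁ ⟶ Y₂} {g₂ : Y₂ ⟶ Y₃} {g₃ : Y₃ ⟶ Y₄} {a₁ : X₁ ⟶ Y₁}
    {a₂ : X₂ ⟶ Y₂} {a₃ : X₃ ⟶ Y₃} {a₄ : X₄ ⟶ Y₄} (h₁ : a₁ ≫ g₁ = f₁ ≫ a₂) (h₂ : a₂ ≫ g₂ = f₂ ≫ a₃)
    (h₃ : a₃ ≫ g₃ = f₃ ≫ a₄) : a₁ ≫ g₁ ≫ g₂ ≫ g₃ = (f₁ ≫ f₂ ≫ f₃) ≫ a₄ := by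
  rw [reassoc_of% h₁, reassoc_of% h₂, h₃, assoc, assoc]

/-- The extension class is the connecting morphism of the unbounded derived category. -/
theorem ι_extClass {S : ShortComplex A} (hS : S.ShortExact) :
    Bounded.ι.map (extClass hS) ≫ (Bounded.ι.commShiftIso (1 : ℤ)).hom.app ((single A).obj S.X₁) =
      hS.singleδ := by
  rw [extClass, Functor.map_preimage]
  refine (assoc _ _ _).trans ?_
  exact (congrArg (fun t => hS.singleδ ≫ t) (Iso.inv_hom_id_app (Bounded.ι.commShiftIso (1 : ℤ))
    ((single A).obj S.X₁))).trans (comp_id _)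

theorem extClass_naturality {S S' : ShortComplex A} (hS : S.ShortExact) (hS' : S'.ShortExact)
    (φ : S ⟶ S') : extClass hS ≫ ((single A).map φ.τ₁)⟦(1 : ℤ)⟧' =
      (single A).map φ.τ₃ ≫ extClass hS' := by
  apply Bounded.ι.map_injective
  rw [Functor.map_comp, Functor.map_comp,
    ← cancel_mono ((Bounded.ι.commShiftIso (1 : ℤ)).hom.app ((single A).obj S'.X₁))]
  have h := (ShortComplex.ShortExact.singleTriangle.map hS hS' φ).comm₃
  refine Eq.trans ?_ (h.trans ?_)
  · refine (assoc _ _ _).trans ((congrArg (fun t => Bounded.ι.map (extClass hS) ≫ t)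
      (Bounded.ι.commShiftIso_hom_naturality ((single A).map φ.τ₁) (1 : ℤ))).trans ?_)
    exact (assoc _ _ _).symm.trans (congrArg (fun t => t ≫ _) (ι_extClass hS))
  · exact ((assoc _ _ _).trans (congrArg (fun t => _ ≫ t) (ι_extClass hS'))).symm

theorem extTriangle_distinguished {S : ShortComplex A} (hS : S.ShortExact) :
    Triangle.mk ((single A).map S.f) ((single A).map S.g) (extClass hS) ∈
      distTriang (Bounded A) := by
  refine isomorphic_distinguished _ hS.singleTriangle_distinguished
    (Bounded.ι.mapTriangle.obj (Triangle.mk ((single A).map S.f) ((single A).map S.g)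
      (extClass hS))) (Triangle.isoMk _ _ (Iso.refl _) (Iso.refl _) (Iso.refl _) ?_ ?_ ?_)
  · exact (comp_id _).trans (id_comp _).symm
  · exact (comp_id _).trans (id_comp _).symm
  · refine (congrArg (fun t => _ ≫ t) ((shiftFunctor _ (1 : ℤ)).map_id _)).trans ?_
    exact (comp_id _).trans ((ι_extClass hS).trans (id_comp _).symm)

variable [MonoidalCategory A] [SymmetricCategory A] [MonoidalPreadditive A]
    [∀ X : A, PreservesFiniteLimits (tensorLeft X)]
    [∀ X : A, PreservesFiniteColimits (tensorLeft X)]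

/-- The isomorphism `R ⊗ U⟦1⟧ ≅ (R ⊗ U)⟦1⟧` for objects `R`, `U` of `A`, in the unbounded derived
category. It comes from the compatibility of the functor `R ⊗ -` with shifts. -/
noncomputable def tensorShiftAux (R U : A) :
    Bounded.ι.obj ((single A).obj R ⊗ ((single A).obj U)⟦(1 : ℤ)⟧) ≅
      Bounded.ι.obj (((single A).obj (R ⊗ U))⟦(1 : ℤ)⟧) :=
  (tensorSingle R).app (((single A).obj U)⟦(1 : ℤ)⟧) ≪≫
    (tensorLeft R).mapDerivedCategory.mapIso
      ((Bounded.ι.commShiftIso (1 : ℤ)).app ((single A).obj U)) ≪≫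
    ((tensorLeft R).mapDerivedCategory.commShiftIso (1 : ℤ)).app _ ≪≫
    (shiftFunctor (DerivedCategory A) (1 : ℤ)).mapIso
      (((tensorLeft R).mapDerivedCategorySingleFunctor 0).app U) ≪≫
    ((Bounded.ι.commShiftIso (1 : ℤ)).app ((single A).obj (R ⊗ U))).symm

/-- The isomorphism `R ⊗ U⟦1⟧ ≅ (R ⊗ U)⟦1⟧` for objects `R`, `U` of `A`, in the bounded derived
category. -/
noncomputable def tensorShift (R U : A) :
    (single A).obj R ⊗ ((single A).obj U)⟦(1 : ℤ)⟧ ≅ ((single A).obj (R ⊗ U))⟦(1 : ℤ)⟧ :=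
  Bounded.ι.preimageIso (tensorShiftAux R U)

theorem ι_tensorShift (R U : A) : Bounded.ι.map (tensorShift R U).hom ≫
    (Bounded.ι.commShiftIso (1 : ℤ)).hom.app ((single A).obj (R ⊗ U)) =
    (tensorSingle R).hom.app (((single A).obj U)⟦(1 : ℤ)⟧) ≫
      (tensorLeft R).mapDerivedCategory.map
        ((Bounded.ι.commShiftIso (1 : ℤ)).hom.app ((single A).obj U)) ≫
      ((tensorLeft R).mapDerivedCategory.commShiftIso (1 : ℤ)).hom.app _ ≫
      (((tensorLeft R).mapDerivedCategorySingleFunctor 0).hom.app U)⟦(1 : ℤ)⟧' := by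
  have h : Bounded.ι.map (tensorShift R U).hom = (tensorShiftAux R U).hom :=
    Bounded.ι.map_preimage _
  rw [h]
  simp only [tensorShiftAux, Iso.trans_hom, assoc]
  refine congrArg (fun t => (tensorSingle R).hom.app (((single A).obj U)⟦(1 : ℤ)⟧) ≫ t) ?_
  refine congrArg (fun t => (tensorLeft R).mapDerivedCategory.map
    ((Bounded.ι.commShiftIso (1 : ℤ)).hom.app ((single A).obj U)) ≫ t) ?_
  refine congrArg (fun t => ((tensorLeft R).mapDerivedCategory.commShiftIso (1 : ℤ)).hom.app
    (Bounded.ι.obj ((single A).obj U)) ≫ t) ?_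
  refine (assoc _ _ _).trans ?_
  exact (congrArg (fun t => (((tensorLeft R).mapDerivedCategorySingleFunctor 0).hom.app U)⟦(1 : ℤ)⟧'
    ≫ t) (Iso.inv_hom_id_app (Bounded.ι.commShiftIso (1 : ℤ))
    ((single A).obj (R ⊗ U)))).trans (comp_id _)

/-- The class of the extension `R ⊗ S` is the tensor product of `R` with the class of `S`: the
functor induced by `R ⊗ -` preserves connecting morphisms. -/
theorem whiskerLeft_extClass (R : A) {S : ShortComplex A} (hS : S.ShortExact) :
    (single A).obj R ◁ extClass hS ≫ (tensorShift R S.X₁).hom =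
      μ (single A) R S.X₃ ≫ extClass (tensorSeq_shortExact R hS) := by
  let D := (tensorLeft R).mapDerivedCategory
  let m := (tensorLeft R).mapDerivedCategorySingleFunctor 0
  let c := (Bounded.ι (C := A)).commShiftIso (1 : ℤ)
  have h₁ : D.map hS.singleδ ≫ (D.commShiftIso (1 : ℤ)).hom.app _ ≫ (m.hom.app S.X₁)⟦(1 : ℤ)⟧' =
      m.hom.app S.X₃ ≫ (tensorSeq_shortExact R hS).singleδ := by
    have h := hS.mapShiftedHom_singleδ' (tensorLeft R)
    exact (assoc _ _ _).symm.trans ((Iso.inv_comp_eq (m.app S.X₃)).1 h)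
  have h₂ : D.map (Bounded.ι.map (extClass hS)) ≫ D.map (c.hom.app ((single A).obj S.X₁)) =
      D.map hS.singleδ :=
    (D.map_comp _ _).symm.trans (congrArg (fun t => D.map t) (ι_extClass hS))
  apply Bounded.ι.map_injective
  refine (Functor.map_comp _ _ _).trans (Eq.trans ?_ (Functor.map_comp _ _ _).symm)
  refine (cancel_mono (c.hom.app _)).1 ?_
  refine (assoc _ _ _).trans ((congrArg
    (fun t => Bounded.ι.map ((single A).obj R ◁ extClass hS) ≫ t) (ι_tensorShift R S.X₁)).trans ?_)
  refine ((tensorSingle R).hom.naturality_assoc (extClass hS) _).trans ?_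
  refine (congrArg (fun t => (tensorSingle R).hom.app ((single A).obj S.X₃) ≫ t)
    ((assoc _ _ _).symm.trans ((congrArg (fun t => t ≫ _) h₂).trans h₁))).trans ?_
  refine (assoc _ _ _).symm.trans
    ((congrArg (fun t => t ≫ _) (tensorSingle_single R S.X₃)).trans ?_)
  exact ((assoc _ _ _).trans (congrArg (fun t => _ ≫ t)
    (ι_extClass (tensorSeq_shortExact R hS)))).symm

theorem tensorShift_naturality_right (R : A) {U U' : A} (f : U ⟶ U') :
    (single A).obj R ◁ ((single A).map f)⟦(1 : ℤ)⟧' ≫ (tensorShift R U').hom =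
      (tensorShift R U).hom ≫ ((single A).map (R ◁ f))⟦(1 : ℤ)⟧' := by
  let D := (tensorLeft R).mapDerivedCategory
  let m := (tensorLeft R).mapDerivedCategorySingleFunctor 0
  let c := (Bounded.ι (C := A)).commShiftIso (1 : ℤ)
  have h₁ : D.map (Bounded.ι.map (((single A).map f)⟦(1 : ℤ)⟧')) ≫ D.map (c.hom.app _) =
      D.map (c.hom.app _) ≫ D.map ((Bounded.ι.map ((single A).map f))⟦(1 : ℤ)⟧') := by
    rw [← D.map_comp, ← D.map_comp]
    exact congrArg (fun t => D.map t) (c.hom.naturality ((single A).map f))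
  have h₂ := (D.commShiftIso (1 : ℤ)).hom.naturality (Bounded.ι.map ((single A).map f))
  have h₃ : (D.map (Bounded.ι.map ((single A).map f)))⟦(1 : ℤ)⟧' ≫ (m.hom.app U')⟦(1 : ℤ)⟧' =
      (m.hom.app U)⟦(1 : ℤ)⟧' ≫ (Bounded.ι.map ((single A).map (R ◁ f)))⟦(1 : ℤ)⟧' :=
    (Functor.map_comp _ _ _).symm.trans ((congrArg (fun t => t⟦(1 : ℤ)⟧')
      (m.hom.naturality f)).trans (Functor.map_comp _ _ _))
  have h₄ := c.hom.naturality ((single A).map (R ◁ f))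
  apply Bounded.ι.map_injective
  refine (Functor.map_comp _ _ _).trans (Eq.trans ?_ (Functor.map_comp _ _ _).symm)
  refine (cancel_mono (c.hom.app _)).1 ?_
  refine (assoc _ _ _).trans ((congrArg (fun t => Bounded.ι.map
    ((single A).obj R ◁ ((single A).map f)⟦(1 : ℤ)⟧') ≫ t) (ι_tensorShift R U')).trans ?_)
  refine ((tensorSingle R).hom.naturality_assoc (((single A).map f)⟦(1 : ℤ)⟧') _).trans ?_
  refine Eq.trans ?_ ((assoc _ _ _).trans (congrArg (fun t => _ ≫ t) h₄)).symm
  refine Eq.trans ?_ ((assoc _ _ _).symm.trans (congrArg (fun t => t ≫ _) (ι_tensorShift R U))).symm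
  refine Eq.trans ?_ (assoc _ _ _).symm
  refine congrArg (fun t => (tensorSingle R).hom.app (((single A).obj U)⟦(1 : ℤ)⟧) ≫ t) ?_
  exact comp₃_naturality h₁ h₂ h₃

theorem tensorShift_naturality_left {R R' : A} (r : R ⟶ R') (U : A) :
    (single A).map r ▷ ((single A).obj U)⟦(1 : ℤ)⟧ ≫ (tensorShift R' U).hom =
      (tensorShift R U).hom ≫ ((single A).map (r ▷ U))⟦(1 : ℤ)⟧' := by
  let α := mapDerivedCategoryHom ((tensoringLeft A).map r)
  let D := (tensorLeft R).mapDerivedCategory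
  let D' := (tensorLeft R').mapDerivedCategory
  let m := (tensorLeft R).mapDerivedCategorySingleFunctor 0
  let m' := (tensorLeft R').mapDerivedCategorySingleFunctor 0
  let c := (Bounded.ι (C := A)).commShiftIso (1 : ℤ)
  have h₁ : α.app _ ≫ D'.map (c.hom.app ((single A).obj U)) = D.map (c.hom.app _) ≫ α.app _ :=
    (α.naturality _).symm
  have h₂ := (NatTrans.shift_app_comm α (1 : ℤ) (Bounded.ι.obj ((single A).obj U))).symm
  have h₃ : (α.app (Bounded.ι.obj ((single A).obj U)))⟦(1 : ℤ)⟧' ≫ (m'.hom.app U)⟦(1 : ℤ)⟧' =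
      (m.hom.app U)⟦(1 : ℤ)⟧' ≫ (Bounded.ι.map ((single A).map (r ▷ U)))⟦(1 : ℤ)⟧' :=
    (Functor.map_comp _ _ _).symm.trans ((congrArg (fun t => t⟦(1 : ℤ)⟧')
      (mapDerivedCategorySingleFunctor_naturality ((tensoringLeft A).map r) U).symm).trans
        (Functor.map_comp _ _ _))
  have h₄ := c.hom.naturality ((single A).map (r ▷ U))
  apply Bounded.ι.map_injective
  refine (Functor.map_comp _ _ _).trans (Eq.trans ?_ (Functor.map_comp _ _ _).symm)
  refine (cancel_mono (c.hom.app _)).1 ?_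
  refine (assoc _ _ _).trans ((congrArg (fun t => Bounded.ι.map
    ((single A).map r ▷ ((single A).obj U)⟦(1 : ℤ)⟧) ≫ t) (ι_tensorShift R' U)).trans ?_)
  refine ((assoc _ _ _).symm.trans (congrArg (fun t => t ≫ _)
    (tensorSingle_naturality_left r (((single A).obj U)⟦(1 : ℤ)⟧)))).trans ?_
  refine (assoc _ _ _).trans ?_
  refine Eq.trans ?_ ((assoc _ _ _).trans (congrArg (fun t => _ ≫ t) h₄)).symm
  refine Eq.trans ?_ ((assoc _ _ _).symm.trans (congrArg (fun t => t ≫ _) (ι_tensorShift R U))).symm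
  refine Eq.trans ?_ (assoc _ _ _).symm
  refine congrArg (fun t => (tensorSingle R).hom.app (((single A).obj U)⟦(1 : ℤ)⟧) ≫ t) ?_
  exact comp₃_naturality h₁ h₂ h₃

end

/-! ### Connecting morphisms compatible with the tensor product -/

section
open Functor.LaxMonoidal Functor.OplaxMonoidal Functor.Monoidal Pretriangulated

variable {A : Type u} [Category.{v} A] [Abelian A]
    [MonoidalCategory A] [MonoidalPreadditive A]
    [∀ X : A, PreservesFiniteLimits (tensorLeft X)]
    [∀ X : A, PreservesFiniteColimits (tensorLeft X)]
    {T : Type u'} [Category.{v'} T] [Preadditive T] [HasZeroObject T]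
    [HasShift T ℤ] [∀ n : ℤ, (shiftFunctor T n).Additive] [Pretriangulated T]
    [MonoidalCategory T]

/-- A monoidal functor from an abelian category to a triangulated category together with natural
connecting morphisms which turn short exact sequences into distinguished triangles, and which are
compatible with the tensor product by an object of the abelian category. -/
structure TensorConnection (F : A ⥤ T) [F.Monoidal] where
  /-- The connecting morphism of a short exact sequence. -/
  e {S : ShortComplex A} (hS : S.ShortExact) : F.obj S.X₃ ⟶ (F.obj S.X₁)⟦(1 : ℤ)⟧
  distinguished {S : ShortComplex A} (hS : S.ShortExact) :
    Triangle.mk (F.map S.f) (F.map S.g) (e hS) ∈ distTriang T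
  e_naturality {S S' : ShortComplex A} (hS : S.ShortExact) (hS' : S'.ShortExact) (φ : S ⟶ S') :
    e hS ≫ (F.map φ.τ₁)⟦(1 : ℤ)⟧' = F.map φ.τ₃ ≫ e hS'
  /-- The exchange of shift and tensor product. -/
  ω (R U : A) : F.obj R ⊗ (F.obj U)⟦(1 : ℤ)⟧ ≅ (F.obj (R ⊗ U))⟦(1 : ℤ)⟧
  ω_naturality_right (R : A) {U U' : A} (f : U ⟶ U') :
    F.obj R ◁ (F.map f)⟦(1 : ℤ)⟧' ≫ (ω R U').hom = (ω R U).hom ≫ (F.map (R ◁ f))⟦(1 : ℤ)⟧'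
  ω_naturality_left {R R' : A} (r : R ⟶ R') (U : A) :
    F.map r ▷ (F.obj U)⟦(1 : ℤ)⟧ ≫ (ω R' U).hom = (ω R U).hom ≫ (F.map (r ▷ U))⟦(1 : ℤ)⟧'
  whiskerLeft_e (R : A) {S : ShortComplex A} (hS : S.ShortExact) :
    F.obj R ◁ e hS ≫ (ω R S.X₁).hom = μ F R S.X₃ ≫ e (tensorSeq_shortExact R hS)

namespace TensorConnection

section
variable {F : A ⥤ T} [F.Monoidal] (E : TensorConnection F)

theorem ω_naturality {R R' U U' : A} (r : R ⟶ R') (f : U ⟶ U') :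
    (F.map r ⊗ₘ (F.map f)⟦(1 : ℤ)⟧') ≫ (E.ω R' U').hom =
      (E.ω R U).hom ≫ (F.map (r ⊗ₘ f))⟦(1 : ℤ)⟧' := by
  rw [MonoidalCategory.tensorHom_def, MonoidalCategory.tensorHom_def, assoc,
    E.ω_naturality_right, ← assoc, E.ω_naturality_left, assoc, F.map_comp, Functor.map_comp]

include E in
/-- An epimorphism whose kernel is killed is inverted. -/
theorem isIso_map_g {S : ShortComplex A} (hS : S.ShortExact) (h : IsZero (F.obj S.X₁)) :
    IsIso (F.map S.g) :=
  (Triangle.isZero₁_iff_isIso₂ _ (E.distinguished hS)).1 h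

end

variable [Linear ℚ A] [SymmetricCategory A] [MonoidalLinear ℚ A] [Linear ℚ T]
    [SymmetricCategory T] [MonoidalPreadditive T]
    {F : A ⥤ T} [F.Additive] [F.Braided] (E : TensorConnection F)
    {S S' : ShortComplex A} (hS : S.ShortExact) (hU : SymVanishes (F.obj S.X₁) 2)
    (hS' : S'.ShortExact) (hU' : SymVanishes (F.obj S'.X₁) 2)

include E hS hU in
theorem isIso_map_symφ (n : ℕ) : IsIso (F.map (symφ hS n)) :=
  TensorDerived.isIso_map_symφ hS F (fun hS h => E.isIso_map_g hS h) hU n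

/-- The identification of `Sym ^ n X₃ ⊗ X₁⟦1⟧` with the shifted kernel of
`Sym ^ (n + 1) X₂ ⟶ Sym ^ (n + 1) X₃`. -/
noncomputable def kernelIso (n : ℕ) (c : SymPower (F.obj S.X₃) n) :
    c.obj ⊗ (F.obj S.X₁)⟦(1 : ℤ)⟧ ≅ (F.obj (symSeq S (n + 1)).X₁)⟦(1 : ℤ)⟧ :=
  have := E.isIso_map_symφ hS hU n
  whiskerRightIso (c.isoMap (sym S.X₃ n)) _ ≪≫ E.ω _ _ ≪≫
    (shiftFunctor T (1 : ℤ)).mapIso (asIso (F.map (symφ hS n))).symm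

theorem kernelIso_hom_symφ (n : ℕ) (c : SymPower (F.obj S.X₃) n) :
    (E.kernelIso hS hU n c).hom ≫ (F.map (symφ hS n))⟦(1 : ℤ)⟧' =
      (c.isoMap (sym S.X₃ n)).hom ▷ _ ≫ (E.ω _ _).hom := by
  have := E.isIso_map_symφ hS hU n
  have h : (inv (F.map (symφ hS n)))⟦(1 : ℤ)⟧' ≫ (F.map (symφ hS n))⟦(1 : ℤ)⟧' = 𝟙 _ := by
    rw [← Functor.map_comp, IsIso.inv_hom_id, CategoryTheory.Functor.map_id]
  simp only [kernelIso, Iso.trans_hom, Functor.mapIso_hom, Iso.symm_hom, asIso_inv, assoc,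
    whiskerRightIso_hom]
  rw [h, comp_id]

/-- The cup product with the connecting morphism of `S` is the connecting morphism of the sequence
of symmetric powers. -/
theorem cup_kernelIso (n : ℕ) (b : SymPower (F.obj S.X₃) (n + 1))
    (c : SymPower (F.obj S.X₃) n) :
    cup b c (E.e hS) ≫ (E.kernelIso hS hU n c).hom =
      (b.isoMap (sym S.X₃ (n + 1))).hom ≫ E.e (symSeq_shortExact hS (n + 1)) := by
  have := E.isIso_map_symφ hS hU n
  have h₁ : E.e (symSeq_shortExact hS (n + 1)) ≫ (F.map (symφ hS n))⟦(1 : ℤ)⟧' =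
      F.map (comult _ _) ≫ E.e (tensorSeq_shortExact (sym S.X₃ n).obj hS) :=
    E.e_naturality _ _ (symΦ hS n)
  have h₂ := comult_isoMap F b c (sym S.X₃ (n + 1)) (sym S.X₃ n)
  rw [← cancel_mono ((F.map (symφ hS n))⟦(1 : ℤ)⟧'), assoc, assoc, kernelIso_hom_symφ, cup, assoc,
    whisker_exchange_assoc, E.whiskerLeft_e, h₁]
  exact (reassoc_of% h₂) (E.e (tensorSeq_shortExact (sym S.X₃ n).obj hS))

/-- The third morphism of the triangle of symmetric powers. The sign comes from the rotation of
the triangle given by the kernel of `Sym ^ (n + 1) X₂ ⟶ Sym ^ (n + 1) X₃`. -/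
noncomputable def third (n : ℕ) (a : SymPower (F.obj S.X₂) (n + 1))
    (c : SymPower (F.obj S.X₃) n) : c.obj ⊗ (F.obj S.X₁)⟦(1 : ℤ)⟧ ⟶ a.obj⟦(1 : ℤ)⟧ :=
  (E.kernelIso hS hU n c).hom ≫ (-(F.map (symSeq S (n + 1)).f)⟦(1 : ℤ)⟧') ≫
    (a.isoMap (sym S.X₂ (n + 1))).inv⟦(1 : ℤ)⟧'

theorem third_distinguished (n : ℕ) (a : SymPower (F.obj S.X₂) (n + 1))
    (b : SymPower (F.obj S.X₃) (n + 1)) (c : SymPower (F.obj S.X₃) n) :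
    Triangle.mk (symMap (F.map S.g) a b) (cup b c (E.e hS)) (E.third hS hU n a c) ∈
      distTriang T := by
  refine isomorphic_distinguished _ (rot_of_distTriang _
    (E.distinguished (symSeq_shortExact hS (n + 1)))) _ (Triangle.isoMk _ _
      (a.isoMap (sym S.X₂ (n + 1))) (b.isoMap (sym S.X₃ (n + 1)))
      (E.kernelIso hS hU n c) ?_ (E.cup_kernelIso hS hU n b c) ?_)
  · exact symMap_isoMap F S.g a b _ _
  · have h : (a.isoMap (sym S.X₂ (n + 1))).inv⟦(1 : ℤ)⟧' ≫
        (a.isoMap (sym S.X₂ (n + 1))).hom⟦(1 : ℤ)⟧' = 𝟙 _ := by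
      rw [← Functor.map_comp, Iso.inv_hom_id, CategoryTheory.Functor.map_id]
    refine (assoc _ _ _).trans ?_
    refine congrArg (fun t => (E.kernelIso hS hU n c).hom ≫ t) ?_
    exact (assoc _ _ _).trans ((congrArg (fun t => _ ≫ t) h).trans (comp_id _))

theorem kernelIso_naturality (φ : S ⟶ S') (n : ℕ) (c : SymPower (F.obj S.X₃) n)
    (c' : SymPower (F.obj S'.X₃) n) :
    (E.kernelIso hS hU n c).hom ≫ (F.map (symSeqMap φ (n + 1)).τ₁)⟦(1 : ℤ)⟧' =
      (symMap (F.map φ.τ₃) c c' ⊗ₘ (F.map φ.τ₁)⟦(1 : ℤ)⟧') ≫ (E.kernelIso hS' hU' n c').hom := by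
  have := E.isIso_map_symφ hS' hU' n
  have h : (F.map (symSeqMap φ (n + 1)).τ₁)⟦(1 : ℤ)⟧' ≫ (F.map (symφ hS' n))⟦(1 : ℤ)⟧' =
      (F.map (symφ hS n))⟦(1 : ℤ)⟧' ≫
        (F.map (symMap φ.τ₃ (sym S.X₃ n) (sym S'.X₃ n) ⊗ₘ φ.τ₁))⟦(1 : ℤ)⟧' := by
    simp only [← Functor.map_comp, symφ_naturality hS hS']
  rw [← cancel_mono ((F.map (symφ hS' n))⟦(1 : ℤ)⟧'), assoc, assoc, kernelIso_hom_symφ, h,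
    reassoc_of% (E.kernelIso_hom_symφ hS hU n c), ← E.ω_naturality, ← tensorHom_id, ← tensorHom_id,
    tensorHom_comp_tensorHom_assoc, tensorHom_comp_tensorHom_assoc, id_comp, comp_id,
    symMap_isoMap F φ.τ₃ c c' (sym S.X₃ n)]

theorem third_naturality (φ : S ⟶ S') (n : ℕ) (a : SymPower (F.obj S.X₂) (n + 1))
    (c : SymPower (F.obj S.X₃) n) (a' : SymPower (F.obj S'.X₂) (n + 1))
    (c' : SymPower (F.obj S'.X₃) n) :
    E.third hS hU n a c ≫ (symMap (F.map φ.τ₂) a a')⟦(1 : ℤ)⟧' =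
      (symMap (F.map φ.τ₃) c c' ⊗ₘ (F.map φ.τ₁)⟦(1 : ℤ)⟧') ≫ E.third hS' hU' n a' c' := by
  have h₁ : (a.isoMap (sym S.X₂ (n + 1))).inv⟦(1 : ℤ)⟧' ≫ (symMap (F.map φ.τ₂) a a')⟦(1 : ℤ)⟧' =
      (F.map (symSeqMap φ (n + 1)).τ₂)⟦(1 : ℤ)⟧' ≫
        (a'.isoMap (sym S'.X₂ (n + 1))).inv⟦(1 : ℤ)⟧' := by
    rw [← Functor.map_comp, ← Functor.map_comp]
    refine congrArg (fun t => t⟦(1 : ℤ)⟧') ?_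
    rw [Iso.inv_comp_eq, ← assoc, Iso.eq_comp_inv]
    exact symMap_isoMap F φ.τ₂ a a' _ _
  have h₂ : (F.map (symSeq S (n + 1)).f)⟦(1 : ℤ)⟧' ≫ (F.map (symSeqMap φ (n + 1)).τ₂)⟦(1 : ℤ)⟧' =
      (F.map (symSeqMap φ (n + 1)).τ₁)⟦(1 : ℤ)⟧' ≫ (F.map (symSeq S' (n + 1)).f)⟦(1 : ℤ)⟧' := by
    simp only [← Functor.map_comp, (symSeqMap φ (n + 1)).comm₁₂]
  rw [third, third, assoc, assoc, h₁, ← assoc (_ ⊗ₘ _), ← E.kernelIso_naturality hS hU hS' hU' φ n,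
    assoc, Preadditive.neg_comp, Preadditive.neg_comp, Preadditive.comp_neg, Preadditive.comp_neg,
    Preadditive.comp_neg, reassoc_of% h₂]

end TensorConnection
end

/-! ### The connecting morphisms given by the bounded derived category -/

section
open Functor.LaxMonoidal Functor.OplaxMonoidal Functor.Monoidal Pretriangulated
  DerivedCategory

variable {A : Type u} [Category.{v} A] [Abelian A]
    [MonoidalCategory A] [SymmetricCategory A] [MonoidalPreadditive A]
    [∀ X : A, PreservesFiniteLimits (tensorLeft X)]
    [∀ X : A, PreservesFiniteColimits (tensorLeft X)] [HasDerivedCategory.{w} A]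
    {T : Type u'} [Category.{v'} T] [HasShift T ℤ] [MonoidalCategory T]
    (q : Bounded A ⥤ T) [q.CommShift ℤ] [q.Monoidal]

/-- The isomorphism `R ⊗ U⟦1⟧ ≅ (R ⊗ U)⟦1⟧` after application of `q`. -/
noncomputable def imageTensorShift (R U : A) :
    q.obj ((single A).obj R) ⊗ (q.obj ((single A).obj U))⟦(1 : ℤ)⟧ ≅
      (q.obj ((single A).obj (R ⊗ U)))⟦(1 : ℤ)⟧ :=
  whiskerLeftIso (q.obj ((single A).obj R))
      ((q.commShiftIso (1 : ℤ)).app ((single A).obj U)).symm ≪≫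
    μIso q _ _ ≪≫ q.mapIso (tensorShift R U) ≪≫
    (q.commShiftIso (1 : ℤ)).app ((single A).obj (R ⊗ U))

theorem commShiftIso_whiskerLeft_imageTensorShift (R U : A) :
    q.obj ((single A).obj R) ◁ (q.commShiftIso (1 : ℤ)).hom.app ((single A).obj U) ≫
      (imageTensorShift q R U).hom = μ q _ _ ≫ q.map (tensorShift R U).hom ≫
        (q.commShiftIso (1 : ℤ)).hom.app ((single A).obj (R ⊗ U)) := by
  have h : q.obj ((single A).obj R) ◁ (q.commShiftIso (1 : ℤ)).hom.app ((single A).obj U) ≫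
      q.obj ((single A).obj R) ◁ (q.commShiftIso (1 : ℤ)).inv.app ((single A).obj U) = 𝟙 _ := by
    rw [← MonoidalCategory.whiskerLeft_comp, Iso.hom_inv_id_app, MonoidalCategory.whiskerLeft_id]
  exact (assoc _ _ _).symm.trans ((congrArg (fun t => t ≫ _) h).trans (id_comp _))

end

section
open Functor.LaxMonoidal Functor.OplaxMonoidal Functor.Monoidal Pretriangulated DerivedCategory

variable {A : Type u} [Category.{v} A] [Abelian A] [HasDerivedCategory.{w} A]

instance single_additive : (single A).Additive where
  map_add {_ _ f g} := Bounded.ι.map_injective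
    (((singleFunctor A 0).map_add (f := f) (g := g)).trans
      ((Bounded.ι (C := A)).map_add (f := (single A).map f) (g := (single A).map g)).symm)

variable [MonoidalCategory A] [SymmetricCategory A] [MonoidalPreadditive A]
    [∀ X : A, PreservesFiniteLimits (tensorLeft X)]
    [∀ X : A, PreservesFiniteColimits (tensorLeft X)]
    {T : Type u'} [Category.{v'} T] [HasShift T ℤ] [MonoidalCategory T]
    (q : Bounded A ⥤ T) [q.CommShift ℤ] [q.Monoidal]

theorem imageTensorShift_naturality_right (R : A) {U U' : A} (f : U ⟶ U') :
    q.obj ((single A).obj R) ◁ (q.map ((single A).map f))⟦(1 : ℤ)⟧' ≫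
        (imageTensorShift q R U').hom =
      (imageTensorShift q R U).hom ≫ (q.map ((single A).map (R ◁ f)))⟦(1 : ℤ)⟧' := by
  have h := congrArg (fun t => q.map t) (tensorShift_naturality_right R f)
  simp only [Functor.map_comp] at h
  rw [← cancel_epi (q.obj ((single A).obj R) ◁ (q.commShiftIso (1 : ℤ)).hom.app _),
    reassoc_of% (commShiftIso_whiskerLeft_imageTensorShift q R U),
    ← MonoidalCategory.whiskerLeft_comp_assoc, ← q.commShiftIso_hom_naturality,
    MonoidalCategory.whiskerLeft_comp_assoc, commShiftIso_whiskerLeft_imageTensorShift,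
    ← q.commShiftIso_hom_naturality, μ_natural_right_assoc, reassoc_of% h]

theorem imageTensorShift_naturality_left {R R' : A} (r : R ⟶ R') (U : A) :
    q.map ((single A).map r) ▷ (q.obj ((single A).obj U))⟦(1 : ℤ)⟧ ≫
        (imageTensorShift q R' U).hom =
      (imageTensorShift q R U).hom ≫ (q.map ((single A).map (r ▷ U)))⟦(1 : ℤ)⟧' := by
  have h := congrArg (fun t => q.map t) (tensorShift_naturality_left r U)
  simp only [Functor.map_comp] at h
  rw [← cancel_epi (q.obj ((single A).obj R) ◁ (q.commShiftIso (1 : ℤ)).hom.app _),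
    reassoc_of% (commShiftIso_whiskerLeft_imageTensorShift q R U)]
  refine (whisker_exchange_assoc (q.map ((single A).map r))
    ((q.commShiftIso (1 : ℤ)).hom.app ((single A).obj U)) _).trans ?_
  rw [commShiftIso_whiskerLeft_imageTensorShift, ← q.commShiftIso_hom_naturality]
  refine (μ_natural_left_assoc q ((single A).map r) (((single A).obj U)⟦(1 : ℤ)⟧) _).trans ?_
  rw [reassoc_of% h]

theorem whiskerLeft_imageExtClass (R : A) {S : ShortComplex A} (hS : S.ShortExact) :
    q.obj ((single A).obj R) ◁ imageExtClass q hS ≫ (imageTensorShift q R S.X₁).hom =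
      (μ q _ _ ≫ q.map (μ (single A) R S.X₃)) ≫
        imageExtClass q (tensorSeq_shortExact R hS) := by
  have h : q.obj ((single A).obj R) ◁ imageExtClass q hS ≫ (imageTensorShift q R S.X₁).hom =
      μ q _ _ ≫ q.map ((single A).obj R ◁ extClass hS ≫ (tensorShift R S.X₁).hom) ≫
        (q.commShiftIso (1 : ℤ)).hom.app ((single A).obj (R ⊗ S.X₁)) := by
    rw [imageExtClass, MonoidalCategory.whiskerLeft_comp_assoc,
      commShiftIso_whiskerLeft_imageTensorShift, μ_natural_right_assoc, q.map_comp_assoc]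
  refine h.trans ((congrArg (fun t => μ q _ _ ≫ q.map t ≫ _) (whiskerLeft_extClass R hS)).trans ?_)
  exact (congrArg (fun t => μ q _ _ ≫ t) ((congrArg (fun t => t ≫ _) (q.map_comp _ _)).trans
    (assoc _ _ _))).trans (assoc _ _ _).symm

omit [MonoidalCategory A] [SymmetricCategory A] [MonoidalPreadditive A]
    [∀ X : A, PreservesFiniteLimits (tensorLeft X)]
    [∀ X : A, PreservesFiniteColimits (tensorLeft X)] [MonoidalCategory T] [q.Monoidal] in
theorem imageExtClass_naturality {S S' : ShortComplex A} (hS : S.ShortExact) (hS' : S'.ShortExact)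
    (φ : S ⟶ S') : imageExtClass q hS ≫ (q.map ((single A).map φ.τ₁))⟦(1 : ℤ)⟧' =
      q.map ((single A).map φ.τ₃) ≫ imageExtClass q hS' := by
  rw [imageExtClass, imageExtClass, assoc, ← q.commShiftIso_hom_naturality, ← q.map_comp_assoc,
    extClass_naturality hS hS', q.map_comp_assoc]

variable [Preadditive T] [HasZeroObject T] [∀ n : ℤ, (shiftFunctor T n).Additive]
    [Pretriangulated T] [q.IsTriangulated]

/-- The connecting morphisms given by the images of extension classes under a triangulated monoidal
functor on the bounded derived category. -/
noncomputable def derivedConnection : TensorConnection (single A ⋙ q) where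
  e hS := imageExtClass q hS
  distinguished hS := q.map_distinguished _ (extTriangle_distinguished hS)
  e_naturality hS hS' φ := imageExtClass_naturality q hS hS' φ
  ω R U := imageTensorShift q R U
  ω_naturality_right R _ _ f := imageTensorShift_naturality_right q R f
  ω_naturality_left r U := imageTensorShift_naturality_left q r U
  whiskerLeft_e R _ hS := whiskerLeft_imageExtClass q R hS

end
end TensorDerived


theorem mainTheorem11 {A : Type u} [Category.{v} A] [Abelian A] [Linear ℚ A]
    [MonoidalCategory A] [SymmetricCategory A] [MonoidalPreadditive A] [MonoidalLinear ℚ A]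
    [∀ X : A, PreservesFiniteLimits (tensorLeft X)]
    [∀ X : A, PreservesFiniteColimits (tensorLeft X)] [HasDerivedCategory.{w} A]
    {T : Type u'} [Category.{v'} T] [Preadditive T] [Linear ℚ T] [HasZeroObject T]
    [HasShift T ℤ] [∀ n : ℤ, (shiftFunctor T n).Additive] [Pretriangulated T] [IsTriangulated T]
    [MonoidalCategory T] [SymmetricCategory T] [MonoidalPreadditive T] [MonoidalLinear ℚ T]
    (q : Bounded A ⥤ T) [q.CommShift ℤ] [q.IsTriangulated] [q.Braided] :
    (∀ (X : A) (n : ℕ), Nonempty (SymPower (q.obj ((single A).obj X)) n)) ∧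
    (∀ (S : ShortComplex A), S.ShortExact → SymVanishes (q.obj ((single A).obj S.X₁)) 2 →
      ∀ (a : SymPower (q.obj ((single A).obj S.X₂)) 0)
        (b : SymPower (q.obj ((single A).obj S.X₃)) 0) (Z : T), IsZero Z →
        Triangle.mk (symMap (q.map ((single A).map S.g)) a b) (0 : b.obj ⟶ Z) 0 ∈ distTriang T) ∧
    ∃ h : ∀ (S : ShortComplex A), S.ShortExact →
        SymVanishes (q.obj ((single A).obj S.X₁)) 2 → ∀ (n : ℕ)
        (a : SymPower (q.obj ((single A).obj S.X₂)) (n + 1))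
        (_ : SymPower (q.obj ((single A).obj S.X₃)) (n + 1))
        (c : SymPower (q.obj ((single A).obj S.X₃)) n),
        c.obj ⊗ (q.obj ((single A).obj S.X₁))⟦(1 : ℤ)⟧ ⟶ a.obj⟦(1 : ℤ)⟧,
      (∀ (S : ShortComplex A) (hS : S.ShortExact)
        (hU : SymVanishes (q.obj ((single A).obj S.X₁)) 2) (n : ℕ)
        (a : SymPower (q.obj ((single A).obj S.X₂)) (n + 1))
        (b : SymPower (q.obj ((single A).obj S.X₃)) (n + 1))
        (c : SymPower (q.obj ((single A).obj S.X₃)) n),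
        Triangle.mk (symMap (q.map ((single A).map S.g)) a b) (cup b c (imageExtClass q hS))
          (h S hS hU n a b c) ∈ distTriang T) ∧
      (∀ (S S' : ShortComplex A) (hS : S.ShortExact) (hS' : S'.ShortExact)
        (hU : SymVanishes (q.obj ((single A).obj S.X₁)) 2)
        (hU' : SymVanishes (q.obj ((single A).obj S'.X₁)) 2) (φ : S ⟶ S') (n : ℕ)
        (a : SymPower (q.obj ((single A).obj S.X₂)) (n + 1))
        (b : SymPower (q.obj ((single A).obj S.X₃)) (n + 1))
        (c : SymPower (q.obj ((single A).obj S.X₃)) n)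
        (a' : SymPower (q.obj ((single A).obj S'.X₂)) (n + 1))
        (b' : SymPower (q.obj ((single A).obj S'.X₃)) (n + 1))
        (c' : SymPower (q.obj ((single A).obj S'.X₃)) n),
        h S hS hU n a b c ≫ (symMap (q.map ((single A).map φ.τ₂)) a a')⟦(1 : ℤ)⟧' =
          (symMap (q.map ((single A).map φ.τ₃)) c c' ⊗ₘ
            (q.map ((single A).map φ.τ₁))⟦(1 : ℤ)⟧') ≫ h S' hS' hU' n a' b' c') := by
  let E := derivedConnection q
  refine ⟨fun X n => ⟨(sym X n).map (single A ⋙ q)⟩, fun S _ _ a b Z hZ => ?_,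
    fun S hS hU n a _ c => E.third hS hU n a c,
    fun S hS hU n a b c => E.third_distinguished hS hU n a b c,
    fun S S' hS hS' hU hU' φ n a _ c a' _ c' => E.third_naturality hS hU hS' hU' φ n a c a' c'⟩
  -- In degree `0` the first morphism is invertible.
  have := isIso_symMap_zero (q.map ((single A).map S.g)) a b
  let i : a.obj ≅ b.obj := asIso (symMap (q.map ((single A).map S.g)) a b)
  exact isomorphic_distinguished _ (contractible_distinguished b.obj) _
    (Triangle.isoMk _ _ i (Iso.refl _) (hZ.iso (isZero_zero T))
    rfl ((isZero_zero T).eq_of_tgt _ _) (hZ.eq_of_src _ _))
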